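/- Fix integers $N\ge 0$ and $m\ge 1$ and put $t_N=t^m$. Let $\mathcal P_N=\{1,2\}^N$. Identify $\alpha\in\mathcal P_N$ with the path from $(0,0)$ whose $i$-th step is $(1,-1)$ if $\alpha_i=1$ and $(1,1)$ if $\alpha_i=2$, and write $\alpha\le\beta$ if the path $\alpha$ is weakly below the path $\beta$ (this is the Bruhat order on minimal coset representatives for $S_N^C/S_N$). Let $\lambda(\alpha)$ be the set of boxes (unit squares rotated by 45 degrees, identified with their centres) with centres $(i,j)\in\mathbb Z^2$, $0<i\le N$, $|j|\le i$, $i+j$ odd, below the path $\alpha$; the boxes with $i=N$ are the anchor boxes. Let $\ell_m(\alpha)$ be the number of non-anchor boxes plus $m$ times the number of anchor boxes of $\lambda(\alpha)$, and write $\mathbf t^{|\alpha|-|\beta|}:=t^{\ell_m(\alpha)-\ell_m(\beta)}$. Let $\mathcal M^-$ be the free $\mathbb C[t^{\pm1}]$-module on $m_\alpha$, $\alpha\in\mathcal P_N$, with the action of the type $B_N$ Hecke algebra with parameters $t,\dots,t,t^m$ given by: for $1\le i\le N-1$, $T_im_\alpha=-t^{-1}m_\alpha$ if $\alpha_i=\alpha_{i+1}$,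 $T_im_\alpha=m_{s_i\alpha}$ if $\alpha_i<\alpha_{i+1}$, $T_im_\alpha=m_{s_i\alpha}+(t-t^{-1})m_\alpha$ if $\alpha_i>\alpha_{i+1}$; and $T_Nm_\alpha=m_{s_N\alpha}$ if $\alpha_N=1$, $T_Nm_\alpha=m_{s_N\alpha}+(t^m-t^{-m})m_\alpha$ if $\alpha_N=2$. Here $s_i$ exchanges the letters $i$ and $i+1$, and $s_N$ changes the last letter. The bar involution of $\mathcal M^-$ is semilinear for $t\mapsto t^{-1}$, fixes $m_{1\cdots1}$ and satisfies $\overline{T_iv}=T_i^{-1}\bar v$. Let $C_\beta$ be the Kazhdan–Lusztig basis, $C_\beta=\overline{C_\beta}=\sum_{\alpha\le\beta}\mathbf t^{|\alpha|-|\beta|}P^{B,-}_{\alpha,\beta}m_\alpha$ with $P^{B,-}_{\beta,\beta}=1$ and $\mathbf t^{|\alpha|-|\beta|}P^{B,-}_{\alpha,\beta}\in t^{-1}\mathbb Z[t^{-1}]$ for $\alpha<\beta$. A ballot strip of length $(l,l')$ is the set of boxes centred at the vertices of a path with steps $(1,\pm1)$ from some $(x,y)$ to $(x+2l+l',y+l')$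 that stays weakly above height $y$. For $\alpha\le\beta$ let $Q^{B,II,-}_{\alpha,\beta}$ be the sum, over all partitions of $\lambda(\beta)\setminus\lambda(\alpha)$ into ballot strips that satisfy the rules below, of the product of the weights of the strips, where a strip of length $(l,l')$ has weight $(-1)^{l'}t^{2l+2l'}$ if $l'<m$, $t^{m+l'+2l}$ if $l'\ge m$ and $l'-m$ is even, and $t^{m+l'+2l-1}$ if $l'\ge m$ and $l'-m$ is odd. The rules are: (0) the rightmost box of a strip with $l'\ge1$ is an anchor box; (IIa) if a box of a strip $D'\neq D$ is just above (by $(0,2)$), NW (by $(-1,1)$) or NE (by $(1,1)$) of a box of a strip $D$, then all positions with abscissa $\le N$ just above, NW or NE of boxes of $D$ are boxes of $D$ or $D'$; (IIb) if $D$ has length $(l,l')$ with $l'\ge m$ and $l'-m$ even (resp. odd), then there is a strip of length $(l'',l'+1)$ with $l''\ge l$ just above $D$ (resp. of length $(l'',l'-1)$ with $l''\le l$ just below $D$). In $\beta$, match the letters $2$ and $1$ as opening and closing parentheses; this gives the $21$ pairs. Number the unpaired $2$'s from the right. For $1\le j\le m$ the $j$-th one carries the label $m+1-j$. For $j\ge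 m+1$ with $j-m$ odd, the $j$-th and $(j+1)$-th ones (if both exist) form a $22$ pair. Let $F^B(\beta)$ be the set of $\alpha\le\beta$ obtained from $\beta$ by flipping some $21$ pairs (to $12$), some $22$ pairs (to $11$) and some labelled unpaired $2$'s (to $1$). For $\alpha\in F^B(\beta)$ let $d^B$ be the number of flipped $21$ and $22$ pairs and $d_p$ the number of flipped unpaired $2$'s with label $p$, and put $$\sigma'=\sum_{p=1}^m(m-p)\,d_p,\qquad d=d^B+\sum_{p=1}^m p\,d_p .$$ **Corollary.** Let $\alpha\le\beta$. Then $P^{B,-}_{\alpha,\beta}=Q^{B,II,-}_{\alpha,\beta}$. If $\alpha\in F^B(\beta)$, then $$\mathbf t^{|\alpha|-|\beta|}Q^{B,II,-}_{\alpha,\beta}=\mathbf t^{|\alpha|-|\beta|}P^{B,-}_{\alpha,\beta}=(-1)^{\sigma'}t^{-d};$$ in particular the normalized polynomial is, up to sign, a monomial in $t^{-1}$. If $\alpha\notin F^B(\beta)$, then $P^{B,-}_{\alpha,\beta}=Q^{B,II,-}_{\alpha,\beta}=0$. -/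

import Mathlib

namespace BallotKL

open LaurentPolynomial

/-! ### Binary strings, paths and boxes -/

/-- Binary strings of length `N` in the letters `1`, `2`; the letter `2` is coded by `true`
and the letter `1` by `false` (so that `1 < 2`). Positions `1, …, N` are coded by `Fin N`. -/
abbrev Str (N : ℕ) : Type := Fin N → Bool

/-- The letter `1`. -/
abbrev one : Bool := false

/-- The letter `2`. -/
abbrev two : Bool := true

/-- The height, above abscissa `x`, of the path of `α` for the sign `ε = -`: it starts at `(0, 0)`,
a letter `1` is a step `(1, -1)` and a letter `2` is a step `(1, 1)`. -/
def height {N : ℕ} (α : Str N) (x : ℕ) : ℤ :=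
  ∑ i : Fin N, if (i : ℕ) < x then (if α i = two then (1 : ℤ) else -1) else 0

/-- The Bruhat order on minimal coset representatives, read on paths:
`α ≤ β` when the path of `α` is weakly below the path of `β`. -/
def pathLE {N : ℕ} (α β : Str N) : Prop := ∀ x ≤ N, height α x ≤ height β x

/-- The set of (centres of) boxes of the shifted Ferrers diagram `λ⁻(α)`. A box is
identified with its centre. -/
noncomputable def boxes {N : ℕ} (α : Str N) : Finset (ℤ × ℤ) :=
  (Finset.Icc (1 : ℤ) N ×ˢ Finset.Icc (-N : ℤ) N).filter
    fun b => |b.2| ≤ b.1 ∧ Even (b.1 + b.2 - 1) ∧ b.2 < height α b.1.toNat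

/-- The exponent of `t` in `𝐭^{l(w⁻(α))}` when `t_N = t ^ m`: a box `(i, j)` stands for a letter
`s_i` of the reduced word `w⁻(α)`, so it counts `1` for `i < N` and `m` for `i = N`. -/
noncomputable def wlen {N : ℕ} (m : ℕ) (α : Str N) : ℤ :=
  ∑ b ∈ boxes α, if b.1 = (N : ℤ) then (m : ℤ) else 1

/-- The skew diagram `λ⁻(β) / λ⁻(α)`. -/
noncomputable def skew {N : ℕ} (α β : Str N) : Finset (ℤ × ℤ) := boxes β \ boxes α

/-! ### The module `𝓜⁻` with `t_N = t ^ m` and its Kazhdan–Lusztig basis -/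

/-- The ground ring `ℂ[t, t⁻¹]`; the power `t ^ k` is `T k`. -/
abbrev Coef : Type := ℂ[T;T⁻¹]

/-- The module `𝓜⁻`, free on the strings; `m_α` is `Finsupp.single α 1`. -/
abbrev Mod (N : ℕ) : Type := Str N →₀ Coef

/-- The basis vector `m_α`. -/
noncomputable abbrev mvec {N : ℕ} (α : Str N) : Mod N := Finsupp.single α 1

/-- The vector `T_i m_α`; `i + 1 < N` is the case of the generators `T_1, …, T_{N-1}`, and the
remaining index is that of `T_N`, with parameter `t_N = t ^ m`. -/
noncomputable def heckeVec {N : ℕ} (m : ℕ) (i : Fin N) (α : Str N) : Mod N :=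
  if h : (i : ℕ) + 1 < N then
    let i' : Fin N := ⟨i + 1, h⟩
    if α i = α i' then -(T (-1) : Coef) • mvec α
    else if α i < α i' then mvec (α ∘ Equiv.swap i i')
    else mvec (α ∘ Equiv.swap i i') + (T 1 - T (-1) : Coef) • mvec α
  else
    if α i = one then mvec (Function.update α i two)
    else mvec (Function.update α i one) + (T (m : ℤ) - T (-(m : ℤ)) : Coef) • mvec α

/-- The operator `T_i` on `𝓜⁻`. -/
noncomputable def heckeT {N : ℕ} (m : ℕ) (i : Fin N) : Mod N →ₗ[Coef] Mod N :=
  Finsupp.linearCombination Coef (heckeVec m i)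

/-- `ψ` is the bar involution of `𝓜⁻`: it is semilinear for `t ↦ t⁻¹`, it fixes the generator
`m_{1…1}`, and it intertwines `T_i` with `T_i⁻¹` (that is, `ψ (T_i v) = T_i⁻¹ (ψ v)`). -/
structure IsBar {N : ℕ} (m : ℕ) (ψ : Mod N →+ Mod N) : Prop where
  map_smul : ∀ (r : Coef) (v : Mod N), ψ (r • v) = (invert r : Coef) • ψ v
  map_base : ψ (mvec fun _ => one) = mvec fun _ => one
  map_hecke : ∀ (i : Fin N) (v : Mod N), heckeT m i (ψ (heckeT m i v)) = ψ v

/-- `ℤ(Γ₋)`, the integral span of the powers `t ^ (-k)` with `k > 0`. -/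
noncomputable def ZGammaNeg : AddSubgroup Coef :=
  AddSubgroup.closure {r | ∃ k : ℕ, 0 < k ∧ r = T (-(k : ℤ))}

/-- `C` is the Kazhdan–Lusztig basis of `𝓜⁻`: `C_β` is bar-invariant and is the sum of `m_β`
and of a combination of the `m_α`, `α < β`, with coefficients in `ℤ(Γ₋)`. -/
structure IsKLBasis {N : ℕ} (m : ℕ) (C : Str N → Mod N) : Prop where
  bar_invariant : ∃ ψ : Mod N →+ Mod N, IsBar m ψ ∧ ∀ β, ψ (C β) = C β
  coeff_self : ∀ β, C β β = 1
  coeff_mem : ∀ α β, pathLE α β → α ≠ β → C β α ∈ ZGammaNeg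
  coeff_eq_zero : ∀ α β, ¬ pathLE α β → C β α = 0

open Classical in
/-- The Kazhdan–Lusztig basis (the junk value `0` would be taken if there were none). -/
noncomputable def klBasis {N : ℕ} (m : ℕ) : Str N → Mod N :=
  if h : ∃ C : Str N → Mod N, IsKLBasis m C then h.choose else 0

/-- The parabolic Kazhdan–Lusztig polynomial `P_{α,β}` of `𝓜⁻` for `t_N = t ^ m`, defined by
`C_β = ∑_{α ≤ β} 𝐭^{l(α) - l(β)} P_{α,β} m_α`. -/
noncomputable def klP {N : ℕ} (m : ℕ) (α β : Str N) : Coef :=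
  T (wlen m β - wlen m α) * klBasis m β α

/-! ### Ballot strips, Rule 0 and Rule II -/

/-- `D` is (the set of centres of boxes of) a ballot strip of length `(l, l')`: the vertices of a
path from `(x, y)` to `(x + 2 l + l', y + l')` with steps `(1, ±1)` that stays weakly above the
horizontal line of height `y`. -/
def IsBallotStrip (l l' : ℕ) (D : Finset (ℤ × ℤ)) : Prop :=
  ∃ (x y : ℤ) (p : ℕ → ℤ),
    p 0 = y ∧ p (2 * l + l') = y + l' ∧
    (∀ k < 2 * l + l', p (k + 1) = p k + 1 ∨ p (k + 1) = p k - 1) ∧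
    (∀ k ≤ 2 * l + l', y ≤ p k) ∧
    D = (Finset.range (2 * l + l' + 1)).image fun k : ℕ => (x + (k : ℤ), p k)

theorem IsBallotStrip.unique {l l' k k' : ℕ} {D : Finset (ℤ × ℤ)}
    (h₁ : IsBallotStrip l l' D) (h₂ : IsBallotStrip k k' D) : l = k ∧ l' = k' := by
  obtain ⟨x, y, p, hp0, hpn, -, -, hD⟩ := h₁
  obtain ⟨u, v, q, hq0, hqn, -, -, hE⟩ := h₂
  have key : ∀ i < 2 * l + l' + 1, ∃ j < 2 * k + k' + 1, u + (j : ℤ) = x + i ∧ q j = p i := by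
    intro i hi
    have : (x + (i : ℤ), p i) ∈ D := by
      rw [hD]; exact Finset.mem_image.2 ⟨i, Finset.mem_range.2 hi, rfl⟩
    rw [hE] at this
    obtain ⟨j, hj, he⟩ := Finset.mem_image.1 this
    exact ⟨j, Finset.mem_range.1 hj, congrArg Prod.fst he, congrArg Prod.snd he⟩
  have key' : ∀ i < 2 * k + k' + 1, ∃ j < 2 * l + l' + 1, x + (j : ℤ) = u + i ∧ p j = q i := by
    intro i hi
    have : (u + (i : ℤ), q i) ∈ D := by
      rw [hE]; exact Finset.mem_image.2 ⟨i, Finset.mem_range.2 hi, rfl⟩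
    rw [hD] at this
    obtain ⟨j, hj, he⟩ := Finset.mem_image.1 this
    exact ⟨j, Finset.mem_range.1 hj, congrArg Prod.fst he, congrArg Prod.snd he⟩
  obtain ⟨a, ha, ha1, ha2⟩ := key 0 (by omega)
  obtain ⟨b, hb, hb1, hb2⟩ := key' 0 (by omega)
  obtain ⟨c, hc, hc1, hc2⟩ := key (2 * l + l') (by omega)
  obtain ⟨d, hd, hd1, hd2⟩ := key' (2 * k + k') (by omega)
  have ea : a = 0 := by omega
  have hxu : x = u := by omega
  have ec : c = 2 * k + k' := by omega
  have ed : 2 * k + k' = 2 * l + l' := by omega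
  subst ea
  rw [ec] at hc2
  omega

open Classical in
/-- The length `(l, l')` of a ballot strip (the junk value `(0, 0)` for other sets of boxes). -/
noncomputable def stripLength (D : Finset (ℤ × ℤ)) : ℕ × ℕ :=
  if h : ∃ q : ℕ × ℕ, IsBallotStrip q.1 q.2 D then h.choose else (0, 0)

theorem IsBallotStrip.stripLength_eq {l l' : ℕ} {D : Finset (ℤ × ℤ)}
    (h : IsBallotStrip l l' D) : stripLength D = (l, l') := by
  have hex : ∃ q : ℕ × ℕ, IsBallotStrip q.1 q.2 D := ⟨(l, l'), h⟩
  have := hex.choose_spec.unique h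
  rw [stripLength, dif_pos hex]
  exact Prod.ext this.1 this.2

/-- Rule 0: the rightmost box of a strip with `l' ≥ 1` is an anchor box, i.e. has abscissa `N`. -/
def Rule0 (N : ℕ) (D : Finset (ℤ × ℤ)) : Prop :=
  1 ≤ (stripLength D).2 → ∀ b ∈ D, (∀ c ∈ D, c.1 ≤ b.1) → b.1 = (N : ℤ)

/-- `c` is just above, NW or NE of `b`. -/
def Covers (b c : ℤ × ℤ) : Prop :=
  c = (b.1, b.2 + 2) ∨ c = (b.1 - 1, b.2 + 1) ∨ c = (b.1 + 1, b.2 + 1)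

/-- Some box of `D'` is just above some box of `D`. -/
def JustAbove (D D' : Finset (ℤ × ℤ)) : Prop := ∃ b ∈ D, (b.1, b.2 + 2) ∈ D'

/-- Rule II (a), for the set `parts` of strips: if some box of another strip `D'` is just above,
NW or NE of a box of `D`, then all boxes just above, NW and NE of the boxes of `D` belong to `D`
or `D'`. There are no boxes to the right of the anchor boxes, i.e. with abscissa larger
than `N`. -/
def RuleIIa (N : ℕ) (parts : Finset (Finset (ℤ × ℤ))) : Prop :=
  ∀ D ∈ parts, ∀ D' ∈ parts, D ≠ D' → (∃ b ∈ D, ∃ c ∈ D', Covers b c) →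
    ∀ b ∈ D, ∀ c : ℤ × ℤ, Covers b c → c.1 ≤ (N : ℤ) → c ∈ D ∨ c ∈ D'

/-- Rule II (b): a strip of length `(l, l')` with `l' ≥ m` and `l' - m` even has just above it a
strip of length `(l'', l' + 1)`, `l'' ≥ l`; one with `l' ≥ m` and `l' - m` odd has just below it a
strip of length `(l'', l' - 1)`, `l'' ≤ l`. -/
def RuleIIb (m : ℕ) (parts : Finset (Finset (ℤ × ℤ))) : Prop :=
  ∀ D ∈ parts, m ≤ (stripLength D).2 →
    (Even ((stripLength D).2 - m) → ∃ D' ∈ parts, JustAbove D D' ∧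
      (stripLength D').2 = (stripLength D).2 + 1 ∧ (stripLength D).1 ≤ (stripLength D').1) ∧
    (Odd ((stripLength D).2 - m) → ∃ D' ∈ parts, JustAbove D' D ∧
      (stripLength D').2 + 1 = (stripLength D).2 ∧ (stripLength D').1 ≤ (stripLength D).1)

/-- A filling of the region `R` by ballot strips that obeys Rule 0 and Rule II. -/
structure IsConfII (N m : ℕ) {R : Finset (ℤ × ℤ)} (c : Finpartition R) : Prop where
  strips : ∀ D ∈ c.parts, ∃ l l' : ℕ, IsBallotStrip l l' D
  rule0 : ∀ D ∈ c.parts, Rule0 N D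
  ruleIIa : RuleIIa N c.parts
  ruleIIb : RuleIIb m c.parts

/-- The weight of a ballot strip of length `(l, l')` in Case B, for Rule II (`σ = -1`). -/
noncomputable def stripWeight (m l l' : ℕ) : Coef :=
  if l' < m then (-1) ^ l' * T (2 * l + 2 * l' : ℤ)
  else if Even (l' - m) then T (m + l' + 2 * l : ℤ)
  else T (m + l' + 2 * l - 1 : ℤ)

open Classical in
/-- The generating function `Q^{B,II,-}_{α,β}` (for `α ≤ β`) of the fillings of
`λ⁻(β) / λ⁻(α)` by ballot strips that obey Rule 0 and Rule II. -/
noncomputable def genQII {N : ℕ} (m : ℕ) (α β : Str N) : Coef :=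
  ∑ c : Finpartition (skew α β) with IsConfII N m c,
    ∏ D ∈ c.parts, stripWeight m (stripLength D).1 (stripLength D).2

/-! ### Link patterns and flips -/

/-- The letters at positions `i < j` of `β` form a `21` pair: `β_i = 2`, `β_j = 1`, and they are
matched when the letters `2` and `1` are read as opening and closing parentheses, i.e. the path
returns after the step `j`, for the first time, to its height before the step `i`. -/
def IsPair21 {N : ℕ} (β : Str N) (i j : Fin N) : Prop :=
  i < j ∧ β i = two ∧ β j = one ∧ height β (j + 1) = height β i ∧
    ∀ k : ℕ, (i : ℕ) < k → k ≤ (j : ℕ) → height β i < height β k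

/-- The letter at position `i` is unpaired, i.e. not in a `21` pair. -/
def IsUnpaired {N : ℕ} (β : Str N) (i : Fin N) : Prop :=
  ∀ j, ¬ IsPair21 β i j ∧ ¬ IsPair21 β j i

/-- The letter at position `i` is an unpaired `2`. -/
def IsUnpaired2 {N : ℕ} (β : Str N) (i : Fin N) : Prop := β i = two ∧ IsUnpaired β i

open Classical in
/-- The letter at position `i` is the `j`-th unpaired `2` from the right (`j = 1, 2, …`). -/
def IsNthUnpaired2 {N : ℕ} (β : Str N) (j : ℕ) (i : Fin N) : Prop :=
  IsUnpaired2 β i ∧ (Finset.univ.filter fun k : Fin N => i ≤ k ∧ IsUnpaired2 β k).card = j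

/-- The letter at position `i` is an unpaired `2` that carries the integer `p`: it is the
`j`-th unpaired `2` from the right with `1 ≤ j ≤ m`, and `p = m + 1 - j`. -/
def HasLabel {N : ℕ} (m : ℕ) (β : Str N) (p : ℕ) (i : Fin N) : Prop :=
  ∃ j, 1 ≤ j ∧ j ≤ m ∧ p = m + 1 - j ∧ IsNthUnpaired2 β j i

/-- The letters at positions `i < i'` form a `22` pair: they are the `(j+1)`-th and the `j`-th
unpaired `2` from the right, with `j ≥ m + 1` and `j - m + 1` even. -/
def IsPair22 {N : ℕ} (m : ℕ) (β : Str N) (i i' : Fin N) : Prop :=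
  ∃ j, m + 1 ≤ j ∧ Even (j - m + 1) ∧ IsNthUnpaired2 β (j + 1) i ∧ IsNthUnpaired2 β j i'

/-- `α ∈ F^B(β)`: `α ≤ β` is obtained from `β` by flipping some `21` pairs (`21` becomes `12`),
some `22` pairs (`22` becomes `11`) and some unpaired `2`s that carry an integer (`2` becomes
`1`); every other letter is unchanged. -/
structure IsFlip {N : ℕ} (m : ℕ) (α β : Str N) : Prop where
  le : pathLE α β
  pair21 : ∀ i j, IsPair21 β i j →
    (α i = two ∧ α j = one) ∨ (α i = one ∧ α j = two)
  pair22 : ∀ i j, IsPair22 m β i j →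
    (α i = two ∧ α j = two) ∨ (α i = one ∧ α j = one)
  other : ∀ i, IsUnpaired β i → (∀ p, ¬ HasLabel m β p i) →
    (∀ j, ¬ IsPair22 m β i j ∧ ¬ IsPair22 m β j i) → α i = β i

open Classical in
/-- `d^B(α, β)`: the number of flipped `21` pairs and `22` pairs. -/
noncomputable def dPairs {N : ℕ} (m : ℕ) (α β : Str N) : ℕ :=
  (Finset.univ.filter fun q : Fin N × Fin N =>
    IsPair21 β q.1 q.2 ∧ α q.1 = one ∧ α q.2 = two).card +
  (Finset.univ.filter fun q : Fin N × Fin N =>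
    IsPair22 m β q.1 q.2 ∧ α q.1 = one ∧ α q.2 = one).card

open Classical in
/-- `d^B_p(α, β)`: the number of flipped unpaired `2`s that carry the integer `p`. -/
noncomputable def dLabel {N : ℕ} (m p : ℕ) (α β : Str N) : ℕ :=
  (Finset.univ.filter fun i : Fin N => HasLabel m β p i ∧ α i = one).card

/-- `σ' = ∑_{p=1}^m (m - p) d^B_p(α, β)`. -/
noncomputable def signExp {N : ℕ} (m : ℕ) (α β : Str N) : ℕ :=
  ∑ p ∈ Finset.Icc 1 m, (m - p) * dLabel m p α β

/-- `d = d^B(α, β) + ∑_{p=1}^m p d^B_p(α, β)`. -/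
noncomputable def degExp {N : ℕ} (m : ℕ) (α β : Str N) : ℕ :=
  dPairs m α β + ∑ p ∈ Finset.Icc 1 m, p * dLabel m p α β

end BallotKL

/-! Both polynomials are computed independently and compared with one explicit family of
coefficients, `flipCoeff`.

Kazhdan–Lusztig side. The module is a tensor power of the span of `m_1`, `m_2`, and each `T_i +
t_i⁻¹` is a contraction (`cap` or `capLast`) followed by the insertion of a fixed tensor
(`heckeT_add`), as in a one-boundary Temperley–Lieb algebra. The candidate for `C_β` is a product of
tensors read off the link pattern of `β`: `m_2 ⊗ m_1 + t⁻¹ m_1 ⊗ m_2` for a 21 pair, `m_2 ⊗ m_2 +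
t⁻¹ m_1 ⊗ m_1` for a 22 pair, `m_2 + (-1)^(m+p) t^(-p) m_1` for a letter labelled `p`, and the
letter itself elsewhere. Its coefficients are `flipCoeff`; they are visibly unitriangular with
off-diagonal terms in `t⁻¹ℤ[t⁻¹]`. By `IsUnitri.isKLBasis`, bar invariance reduces to showing that
`(T_i + t_i⁻¹) C_β` is a combination of the candidates with bar-invariant coefficients. Such
combinations form `Lat`. The delicate point is the last letter: contracting it lowers the largest
label from `m` to `m - 1`, so `Lat` carries the largest label `p` as a parameter, and `Lat.cap`,
`Lat.shift` and `Lat.capLast` are proved for varying `p`. The bar involution and the basis are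
unique (`IsBar.unique`, `IsKLBasis.unique`), so the candidates are the Kazhdan–Lusztig basis.

Combinatorial side. Measure the depth of a box below the path of `β`. Rule II (a) forces
neighbouring boxes of equal depth into one strip (`IsConfII.link`), so the strips are the maximal
rows of constant depth, one starting on the right of each `2` of `β` that is a `1` of `α`. There is
thus at most one filling, `rowPartition`. It obeys all the rules exactly when `α` is a flip of `β`
(`IsConfII.isFlip`, `IsFlip.isConfII`). The weight of a row, divided by the power of `t` counting
its boxes, is the coefficient of the flipped `2` where it starts (`IsGoodRow.weight`).

Hence both polynomials equal `T (wlen m β - wlen m α) * flipCoeff m α β` (`klP_eq`, `genQII_eq`),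
and `flipProd_eq` evaluates the product as a signed monomial. -/

namespace BallotKL

open LaurentPolynomial

/-! ### Letters, insertion and deletion -/

/-- The letter at position `k`, with the junk value `1` outside the string. -/
def letter {N : ℕ} (α : Str N) (k : ℕ) : Bool := if h : k < N then α ⟨k, h⟩ else false

theorem letter_val {N : ℕ} (α : Str N) (i : Fin N) : letter α i = α i := by
  simp [letter]

theorem Str.ext_letter {N : ℕ} {α β : Str N} (h : ∀ k < N, letter α k = letter β k) : α = β := by
  funext i
  simpa [letter_val] using h i i.2

theorem letter_mk {N : ℕ} (g : ℕ → Bool) {k : ℕ} (hk : k < N) :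
    letter (fun i : Fin N => g i) k = g k := by
  simp [letter, hk]

/-- Insertion of the letters `a b` at the positions `i`, `i + 1`. -/
def insertTwo {N K : ℕ} (i : ℕ) (α : Str N) (a b : Bool) : Str K := fun k =>
  if (k : ℕ) < i then letter α k else if (k : ℕ) = i then a
    else if (k : ℕ) = i + 1 then b else letter α (k - 2)

/-- Deletion of the letters at the positions `i`, `i + 1`. -/
def deleteTwo {N K : ℕ} (i : ℕ) (γ : Str N) : Str K := fun k =>
  if (k : ℕ) < i then letter γ k else letter γ (k + 2)

/-- The first letters of a string. -/
def restrict {N K : ℕ} (γ : Str N) : Str K := fun k => letter γ k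

/-- The string `α d`. -/
def snoc {N K : ℕ} (α : Str N) (d : Bool) : Str K := fun k => if (k : ℕ) < N then letter α k else d

theorem letter_insertTwo {N K : ℕ} (i : ℕ) (α : Str N) (a b : Bool) {k : ℕ} (hk : k < K) :
    letter (insertTwo i α a b : Str K) k = if k < i then letter α k else if k = i then a
    else if k = i + 1 then b else letter α (k - 2) :=
  letter_mk (fun k => if k < i then letter α k else if k = i then a
    else if k = i + 1 then b else letter α (k - 2)) hk

theorem letter_deleteTwo {N K : ℕ} (i : ℕ) (γ : Str N) {k : ℕ} (hk : k < K) :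
    letter (deleteTwo i γ : Str K) k = if k < i then letter γ k else letter γ (k + 2) :=
  letter_mk (fun k => if k < i then letter γ k else letter γ (k + 2)) hk

theorem letter_restrict {N K : ℕ} (γ : Str N) {k : ℕ} (hk : k < K) :
    letter (restrict γ : Str K) k = letter γ k := letter_mk _ hk

theorem letter_snoc {N K : ℕ} (α : Str N) (d : Bool) {k : ℕ} (hk : k < K) :
    letter (snoc α d : Str K) k = if k < N then letter α k else d :=
  letter_mk (fun k => if k < N then letter α k else d) hk

theorem insertTwo_deleteTwo {N K : ℕ} (i : ℕ) (hK : K = N + 2) (hi : i ≤ N) (γ : Str K) :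
    insertTwo i (deleteTwo i γ : Str N) (letter γ i) (letter γ (i + 1)) = γ := by
  subst hK
  apply Str.ext_letter
  intro k hk
  rw [letter_insertTwo _ _ _ _ hk]
  split_ifs with h1 h2 h3
  · rw [letter_deleteTwo _ _ (by omega), if_pos h1]
  · rw [h2]
  · rw [h3]
  · rw [letter_deleteTwo _ _ (by omega), if_neg (by omega)]
    congr 1; omega

theorem deleteTwo_insertTwo {N K : ℕ} (i : ℕ) (hK : K = N + 2) (α : Str N) (a b : Bool) :
    deleteTwo i (insertTwo i α a b : Str K) = α := by
  subst hK
  apply Str.ext_letter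
  intro k hk
  rw [letter_deleteTwo _ _ hk]
  split_ifs with h1
  · rw [letter_insertTwo _ _ _ _ (by omega), if_pos h1]
  · rw [letter_insertTwo _ _ _ _ (by omega), if_neg (by omega), if_neg (by omega),
      if_neg (by omega)]
    congr 1

theorem letter_insertTwo_left {N K : ℕ} (i : ℕ) (hi : i < K) (α : Str N) (a b : Bool) :
    letter (insertTwo i α a b : Str K) i = a := by
  rw [letter_insertTwo _ _ _ _ hi]; simp

theorem letter_insertTwo_right {N K : ℕ} (i : ℕ) (hi : i + 1 < K) (α : Str N) (a b : Bool) :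
    letter (insertTwo i α a b : Str K) (i + 1) = b := by
  rw [letter_insertTwo _ _ _ _ hi]; simp

theorem exists_eq_insertTwo {N K : ℕ} (i : ℕ) (hK : K = N + 2) (hi : i ≤ N) (γ : Str K) :
    ∃ (α : Str N) (a b : Bool), γ = insertTwo i α a b :=
  ⟨_, _, _, (insertTwo_deleteTwo i hK hi γ).symm⟩

theorem exists_eq_snoc {N K : ℕ} (hK : K = N + 1) (γ : Str K) :
    ∃ (α : Str N) (d : Bool), γ = snoc α d := by
  subst hK
  refine ⟨restrict γ, letter γ N, Str.ext_letter fun k hk => ?_⟩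
  rw [letter_snoc _ _ hk]
  split_ifs with h
  · rw [letter_restrict _ h]
  · congr 1; omega

theorem restrict_snoc {N K : ℕ} (hK : K = N + 1) (α : Str N) (d : Bool) :
    restrict (snoc α d : Str K) = α := by
  subst hK
  apply Str.ext_letter
  intro k hk
  rw [letter_restrict _ hk, letter_snoc _ _ (by omega), if_pos hk]

theorem letter_snoc_last {N K : ℕ} (hK : K = N + 1) (α : Str N) (d : Bool) :
    letter (snoc α d : Str K) N = d := by
  rw [letter_snoc _ _ (by omega)]; simp

/-! ### Vectors and operators -/

/-- Vectors of `𝓜⁻` as families of coefficients. -/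
abbrev Vec (N : ℕ) : Type := Str N → Coef

/-- Insertion at the positions `i`, `i + 1` of the tensor `∑ M a b • m_a ⊗ m_b`. -/
noncomputable def insertPair {N K : ℕ} (M : Bool → Bool → Coef) (i : ℕ) (f : Vec N) : Vec K :=
  fun γ => M (letter γ i) (letter γ (i + 1)) * f (deleteTwo i γ)

/-- Tensor product with `∑ u d • m_d` on the right. -/
noncomputable def append {N K : ℕ} (u : Bool → Coef) (f : Vec N) : Vec K :=
  fun γ => f (restrict γ) * u (letter γ N)

/-- The contraction of the positions `i`, `i + 1`. -/
noncomputable def cap {N K : ℕ} (i : ℕ) (f : Vec K) : Vec N :=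
  fun α => f (insertTwo i α one two) + T 1 * f (insertTwo i α two one)

/-- The contraction of the last letter. -/
noncomputable def capLast {N K : ℕ} (m : ℕ) (f : Vec K) : Vec N :=
  fun α => f (snoc α one) + T (m : ℤ) * f (snoc α two)

/-- The tensor `m_2 ⊗ m_1 + t⁻¹ m_1 ⊗ m_2`. -/
noncomputable def cupW : Bool → Bool → Coef
  | true, false => 1
  | false, true => T (-1)
  | _, _ => 0

/-- The tensor `m_2 ⊗ m_2 + t⁻¹ m_1 ⊗ m_1`. -/
noncomputable def pairW : Bool → Bool → Coef
  | true, true => 1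
  | false, false => T (-1)
  | _, _ => 0

/-- The vector `m_2`. -/
noncomputable def twoW : Bool → Coef
  | true => 1
  | false => 0

/-- The vector `m_2 + (-1)^(m+p) t^(-p) m_1`. -/
noncomputable def labelW (m p : ℕ) : Bool → Coef
  | true => 1
  | false => (-1) ^ (m + p) * T (-(p : ℤ))

/-- The vector `m_2 + (-1)^(m+p) t^(p-1) m_1`. -/
noncomputable def shiftW (m p : ℕ) : Bool → Coef
  | true => 1
  | false => (-1) ^ (m + p) * T ((p : ℤ) - 1)

open Classical in
/-- The vector `m_{1…1}`. -/
noncomputable def onesVec (N : ℕ) : Vec N := fun α => if ∀ k < N, letter α k = one then 1 else 0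

theorem insertPair_insertTwo {N K : ℕ} (M : Bool → Bool → Coef) (i : ℕ) (hK : K = N + 2)
    (hi : i ≤ N) (f : Vec N) (α : Str N) (a b : Bool) :
    insertPair M i f (insertTwo i α a b : Str K) = M a b * f α := by
  rw [insertPair, letter_insertTwo_left i (by omega), letter_insertTwo_right i (by omega),
    deleteTwo_insertTwo i hK]

theorem append_snoc {N K : ℕ} (u : Bool → Coef) (hK : K = N + 1) (f : Vec N) (α : Str N)
    (d : Bool) : append u f (snoc α d : Str K) = f α * u d := by
  rw [append, restrict_snoc hK, letter_snoc_last hK]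

/-- The insertion at `i` pushes every position `≥ i` two places to the right, which accounts for the
index `j + 2`. -/
theorem insertTwo_insertTwo {N K L : ℕ} {i j : ℕ} (hK : K = N + 2) (hL : L = K + 2) (hij : i ≤ j)
    (hj : j ≤ N) (α : Str N) (a b c d : Bool) :
    (insertTwo (j + 2) (insertTwo i α a b : Str K) c d : Str L) =
      insertTwo i (insertTwo j α c d : Str K) a b := by
  subst hK; subst hL
  apply Str.ext_letter
  intro k hk
  have h2 : k - 2 < N + 2 := by omega
  simp only [letter_insertTwo _ _ _ _ hk, letter_insertTwo _ _ _ _ h2]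
  by_cases h1 : k < N + 2
  · simp only [letter_insertTwo _ _ _ _ h1]
    split_ifs <;> first | rfl | omega
  · rw [if_neg (by omega : ¬ k < i)]
    split_ifs <;> first | rfl | omega

theorem insertTwo_snoc {N K L M : ℕ} {i : ℕ} (hK : K = N + 1) (hL : L = N + 2) (hM : M = N + 3)
    (hi : i ≤ N) (α : Str N) (a b d : Bool) :
    (insertTwo i (snoc α d : Str K) a b : Str M) = snoc (insertTwo i α a b : Str L) d := by
  subst hK; subst hL; subst hM
  apply Str.ext_letter
  intro k hk
  rw [letter_insertTwo _ _ _ _ hk, letter_snoc _ _ hk]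
  have h2 : k - 2 < N + 1 := by omega
  rw [letter_snoc _ _ h2]
  by_cases h1 : k < N + 2
  · rw [letter_insertTwo _ _ _ _ h1]
    by_cases h3 : k < i
    · rw [letter_snoc _ _ (by omega)]; split_ifs <;> first | rfl | omega
    · split_ifs <;> first | rfl | omega
  · split_ifs <;> first | rfl | omega

theorem insertTwo_eq_snoc {N K : ℕ} {L : ℕ} (hL : L = N + 2) (hK : K = N + 1) (α : Str N)
    (a b : Bool) : (insertTwo N α a b : Str L) = snoc (snoc α a : Str K) b := by
  subst hL; subst hK
  apply Str.ext_letter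
  intro k hk
  rw [letter_insertTwo _ _ _ _ hk, letter_snoc _ _ hk]
  by_cases h1 : k < N + 1
  · rw [letter_snoc _ _ h1]; split_ifs <;> first | rfl | omega
  · split_ifs <;> first | rfl | omega

/-- The first inserted letter duplicates the letter at `i`, so the deletion may remove `b` and the
original instead. This is the combinatorial form of the zigzag identity. -/
theorem deleteTwo_succ_insertTwo {N K : ℕ} {i : ℕ} (hK : K = N + 2) (α : Str N) (b : Bool) :
    (deleteTwo (i + 1) (insertTwo i α (letter α i) b : Str K) : Str N) = α := by
  subst hK
  apply Str.ext_letter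
  intro k hk
  rw [letter_deleteTwo _ _ hk, letter_insertTwo _ _ _ _ (by omega),
    letter_insertTwo _ _ _ _ (by omega)]
  split_ifs <;> first | rfl | omega | (congr 1; omega)

theorem deleteTwo_insertTwo_succ {N K : ℕ} {i : ℕ} (hK : K = N + 2) (α : Str N) (a : Bool) :
    (deleteTwo i (insertTwo (i + 1) α a (letter α i) : Str K) : Str N) = α := by
  subst hK
  apply Str.ext_letter
  intro k hk
  rw [letter_deleteTwo _ _ hk, letter_insertTwo _ _ _ _ (by omega),
    letter_insertTwo _ _ _ _ (by omega)]
  split_ifs <;> first | rfl | omega | (congr 1; omega)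

/-! ### Relations between the operators -/

theorem cap_insertPair_right {N K L M : ℕ} {W : Bool → Bool → Coef} {i j : ℕ} (hK : K = N + 2)
    (hL : L = N + 4) (hM : M = N + 2) (hij : i ≤ j) (hj : j ≤ N) (f : Vec K) :
    (cap i (insertPair W (j + 2) f : Vec L) : Vec M) = insertPair W j (cap i f : Vec N) := by
  funext γ
  obtain ⟨α, a, b, rfl⟩ := exists_eq_insertTwo j hM hj γ
  rw [insertPair_insertTwo _ _ hM hj, cap, cap,
    ← insertTwo_insertTwo hM (by omega) hij hj, ← insertTwo_insertTwo hM (by omega) hij hj]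
  subst hK; subst hM
  rw [insertPair_insertTwo _ _ hL (by omega), insertPair_insertTwo _ _ hL (by omega)]
  ring

theorem cap_insertPair_left {N K L M : ℕ} {W : Bool → Bool → Coef} {i j : ℕ} (hK : K = N + 2)
    (hL : L = N + 4) (hM : M = N + 2) (hij : i ≤ j) (hj : j ≤ N) (f : Vec K) :
    (cap (j + 2) (insertPair W i f : Vec L) : Vec M) = insertPair W i (cap j f : Vec N) := by
  funext γ
  obtain ⟨α, a, b, rfl⟩ := exists_eq_insertTwo i hM (by omega) γ
  rw [insertPair_insertTwo _ _ hM (by omega), cap, cap,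
    insertTwo_insertTwo hM (by omega) hij hj, insertTwo_insertTwo hM (by omega) hij hj]
  subst hK; subst hM
  rw [insertPair_insertTwo _ _ hL (by omega), insertPair_insertTwo _ _ hL (by omega)]
  ring

/-- The value of a closed loop. -/
theorem cap_insertPair_self {N K : ℕ} (i : ℕ) (hK : K = N + 2) (hi : i ≤ N) (f : Vec N) :
    (cap i (insertPair cupW i f : Vec K) : Vec N) = (T 1 + T (-1) : Coef) • f := by
  funext α
  rw [cap, insertPair_insertTwo _ _ hK hi, insertPair_insertTwo _ _ hK hi]
  simp only [cupW, Pi.smul_apply, smul_eq_mul]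
  ring

theorem T_one_mul_neg : (T 1 * T (-1) : Coef) = 1 := by rw [← T_add]; simp

/-- Zigzag: a contraction that overlaps an inserted pair in one letter straightens to the identity.
-/
theorem cap_insertPair_succ {N K L : ℕ} {i : ℕ} (hK : K = N + 1) (hL : L = N + 3) (hi : i ≤ N)
    (f : Vec K) : (cap i (insertPair cupW (i + 1) f : Vec L) : Vec K) = f := by
  funext α
  have h : ∀ a b, letter (insertTwo i α a b : Str L) (i + 1 + 1) = letter α i := by
    intro a b
    rw [letter_insertTwo _ _ _ _ (by omega), if_neg (by omega), if_neg (by omega),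
      if_neg (by omega)]
    rfl
  rw [cap, insertPair, insertPair, h, h, letter_insertTwo_right _ (by omega),
    letter_insertTwo_right _ (by omega)]
  cases hl : letter α i
  · have := deleteTwo_succ_insertTwo (i := i) (show L = K + 2 by omega) α two
    rw [hl] at this
    simp [cupW, this]
  · have := deleteTwo_succ_insertTwo (i := i) (show L = K + 2 by omega) α one
    rw [hl] at this
    simp [cupW, this, ← mul_assoc]

theorem cap_succ_insertPair {N K L : ℕ} {i : ℕ} (hK : K = N + 1) (hL : L = N + 3) (hi : i ≤ N)
    (f : Vec K) : (cap (i + 1) (insertPair cupW i f : Vec L) : Vec K) = f := by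
  funext α
  have h : ∀ a b, letter (insertTwo (i + 1) α a b : Str L) i = letter α i := by
    intro a b
    rw [letter_insertTwo _ _ _ _ (by omega), if_pos (by omega)]
  rw [cap, insertPair, insertPair, h, h, letter_insertTwo_left _ (by omega),
    letter_insertTwo_left _ (by omega)]
  cases hl : letter α i
  · have := deleteTwo_insertTwo_succ (i := i) (show L = K + 2 by omega) α two
    rw [hl] at this
    simp [cupW, this, ← mul_assoc]
  · have := deleteTwo_insertTwo_succ (i := i) (show L = K + 2 by omega) α one
    rw [hl] at this
    simp [cupW, this]

theorem insertPair_append {N K L M : ℕ} {W : Bool → Bool → Coef} {u : Bool → Coef} {i : ℕ}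
    (hK : K = N + 1) (hL : L = N + 2) (hM : M = N + 3) (hi : i ≤ N) (f : Vec N) :
    (insertPair W i (append u f : Vec K) : Vec M) = append u (insertPair W i f : Vec L) := by
  funext γ
  obtain ⟨α, a, b, rfl⟩ := exists_eq_insertTwo i (show M = K + 2 by omega) (by omega) γ
  obtain ⟨δ, d, rfl⟩ := exists_eq_snoc hK α
  rw [insertPair_insertTwo _ _ (by omega) (by omega), insertTwo_snoc hK hL hM hi,
    append_snoc _ (by omega), append_snoc _ (by omega), insertPair_insertTwo _ _ hL hi]
  ring

theorem cap_append {N K L M : ℕ} {u : Bool → Coef} {i : ℕ}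
    (hK : K = N + 1) (hL : L = N + 2) (hM : M = N + 3) (hi : i ≤ N) (f : Vec L) :
    (cap i (append u f : Vec M) : Vec K) = append u (cap i f : Vec N) := by
  funext γ
  obtain ⟨δ, d, rfl⟩ := exists_eq_snoc hK γ
  rw [cap, insertTwo_snoc hK hL hM hi, insertTwo_snoc hK hL hM hi, append_snoc _ (by omega),
    append_snoc _ (by omega), append_snoc _ (by omega), cap]
  ring

theorem cap_append_append {N K L : ℕ} {u v : Bool → Coef} (hK : K = N + 1) (hL : L = N + 2)
    (f : Vec N) : (cap N (append v (append u f : Vec K) : Vec L) : Vec N) =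
      (u one * v two + T 1 * (u two * v one)) • f := by
  funext γ
  rw [cap, insertTwo_eq_snoc hL hK, insertTwo_eq_snoc hL hK, append_snoc _ (by omega),
    append_snoc _ (by omega), append_snoc _ (by omega), append_snoc _ (by omega)]
  simp only [Pi.smul_apply, smul_eq_mul]
  ring

/-- The contraction joins the right factor of `W` to the appended letter, and only the left factor
of `W` survives. The next two lemmas are the analogues for a pair on the right and for two pairs. -/
theorem cap_append_insertPair {N K L M : ℕ} {u : Bool → Coef} (hK : K = N + 1)
    (hL : L = N + 2) (hM : M = N + 3) (W : Bool → Bool → Coef) (f : Vec N) :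
    (cap (N + 1) (append u (insertPair W N f : Vec L) : Vec M) : Vec K) =
      append (fun a => W a one * u two + T 1 * (W a two * u one)) f := by
  funext γ
  obtain ⟨δ, d, rfl⟩ := exists_eq_snoc hK γ
  subst hK hM
  rw [cap, insertTwo_eq_snoc rfl (K := L) (by omega), insertTwo_eq_snoc rfl (K := L) (by omega),
    append_snoc _ (by omega), append_snoc _ (by omega), append_snoc _ (by omega),
    ← insertTwo_eq_snoc hL rfl, ← insertTwo_eq_snoc hL rfl, insertPair_insertTwo _ _ hL le_rfl,
    insertPair_insertTwo _ _ hL le_rfl]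
  ring

theorem cap_insertPair_append {N K L M : ℕ} {u : Bool → Coef} (hK : K = N + 1)
    (hL : L = N + 2) (hM : M = N + 3) (W : Bool → Bool → Coef) (f : Vec N) :
    (cap N (insertPair W (N + 1) (append u f : Vec K) : Vec M) : Vec K) =
      append (fun d => u one * W two d + T 1 * (u two * W one d)) f := by
  funext γ
  obtain ⟨δ, d, rfl⟩ := exists_eq_snoc hK γ
  have h : ∀ a b, (insertTwo N (snoc δ d : Str K) a b : Str M) =
      insertTwo (N + 1) (snoc δ a : Str K) b d := by
    intro a b
    rw [insertTwo_snoc hK hL hM le_rfl, insertTwo_eq_snoc hL hK]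
    subst hK
    rw [insertTwo_eq_snoc (by omega) (by omega)]
  rw [cap, h, h, insertPair_insertTwo _ _ (by omega) (by omega),
    insertPair_insertTwo _ _ (by omega) (by omega), append_snoc _ (by omega),
    append_snoc _ (by omega), append_snoc _ (by omega)]
  ring

theorem cap_insertPair_insertPair {N K L : ℕ} (hK : K = N + 2)
    (hL : L = N + 4) (V W : Bool → Bool → Coef) (f : Vec N) :
    (cap (N + 1) (insertPair W (N + 2) (insertPair V N f : Vec K) : Vec L) : Vec K) =
      insertPair (fun a d => V a one * W two d + T 1 * (V a two * W one d)) N f := by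
  funext γ
  obtain ⟨δ, a, d, rfl⟩ := exists_eq_insertTwo N hK le_rfl γ
  have h : ∀ b c, (insertTwo (N + 1) (insertTwo N δ a d : Str K) b c : Str L) =
      insertTwo (N + 2) (insertTwo N δ a b : Str K) c d := by
    intro b c
    rw [insertTwo_eq_snoc (N := N) hK rfl, insertTwo_snoc (N := N + 1) (L := N + 3) hK rfl
      (by omega) le_rfl, insertTwo_eq_snoc (N := N + 1) rfl hK, insertTwo_eq_snoc (N := N) hK rfl]
    subst hK
    rw [insertTwo_eq_snoc (N := N + 2) (by omega) rfl]
  rw [cap, h, h]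
  subst hK
  rw [insertPair_insertTwo _ _ hL (by omega), insertPair_insertTwo _ _ hL (by omega),
    insertPair_insertTwo _ _ rfl (by omega), insertPair_insertTwo _ _ rfl (by omega),
    insertPair_insertTwo _ _ rfl (by omega)]
  ring

theorem append_append {N K L : ℕ} {u v : Bool → Coef} (hK : K = N + 1) (hL : L = N + 2)
    (f : Vec N) : (append v (append u f : Vec K) : Vec L) =
      insertPair (fun a b => u a * v b) N f := by
  funext γ
  obtain ⟨δ, a, d, rfl⟩ := exists_eq_insertTwo N hL le_rfl γ
  rw [insertPair_insertTwo _ _ hL le_rfl, insertTwo_eq_snoc hL hK, append_snoc _ (by omega),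
    append_snoc _ (by omega)]
  ring

theorem capLast_append {N K : ℕ} (m : ℕ) {u : Bool → Coef} (hK : K = N + 1) (f : Vec N) :
    (capLast m (append u f : Vec K) : Vec N) = (u one + T (m : ℤ) * u two) • f := by
  funext γ
  rw [capLast, append_snoc _ hK, append_snoc _ hK]
  simp only [Pi.smul_apply, smul_eq_mul]
  ring

theorem capLast_insertPair {N K L M : ℕ} (m : ℕ) {W : Bool → Bool → Coef} {i : ℕ}
    (hK : K = N + 1) (hL : L = N + 2) (hM : M = N + 3) (hi : i ≤ N) (f : Vec K) :
    (capLast m (insertPair W i f : Vec M) : Vec L) = insertPair W i (capLast m f : Vec N) := by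
  funext γ
  obtain ⟨δ, a, b, rfl⟩ := exists_eq_insertTwo i hL hi γ
  rw [insertPair_insertTwo _ _ hL hi, capLast, ← insertTwo_snoc hK hL hM hi,
    ← insertTwo_snoc hK hL hM hi, insertPair_insertTwo _ _ (by omega) (by omega),
    insertPair_insertTwo _ _ (by omega) (by omega), capLast]
  ring

theorem capLast_insertPair_last {N K L : ℕ} (m : ℕ) {W : Bool → Bool → Coef}
    (hK : K = N + 1) (hL : L = N + 2) (f : Vec N) :
    (capLast m (insertPair W N f : Vec L) : Vec K) =
      append (fun a => W a one + T (m : ℤ) * W a two) f := by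
  funext γ
  obtain ⟨δ, a, rfl⟩ := exists_eq_snoc hK γ
  rw [append_snoc _ hK, capLast, ← insertTwo_eq_snoc hL hK, ← insertTwo_eq_snoc hL hK,
    insertPair_insertTwo _ _ hL le_rfl, insertPair_insertTwo _ _ hL le_rfl]
  ring

theorem insertPair_comm {N K L : ℕ} {V W : Bool → Bool → Coef} {i j : ℕ} (hK : K = N + 2)
    (hL : L = N + 4) (hij : i ≤ j) (hj : j ≤ N) (f : Vec N) :
    (insertPair W (j + 2) (insertPair V i f : Vec K) : Vec L) =
      insertPair V i (insertPair W j f : Vec K) := by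
  funext γ
  obtain ⟨δ, a, b, rfl⟩ := exists_eq_insertTwo i (show L = K + 2 by omega) (by omega) γ
  obtain ⟨ε, c, d, rfl⟩ := exists_eq_insertTwo j hK hj δ
  rw [insertPair_insertTwo _ _ (by omega) (by omega), insertPair_insertTwo _ _ hK hj,
    ← insertTwo_insertTwo hK (by omega) hij hj]
  subst hK
  rw [insertPair_insertTwo _ _ hL (by omega), insertPair_insertTwo _ _ rfl (by omega)]
  ring

/-! ### The lattice spanned by the Kazhdan–Lusztig basis -/

/-! ### Linearity of insertions and contractions -/

section linearity

variable {N K : ℕ}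

theorem insertPair_zero (M : Bool → Bool → Coef) (i : ℕ) :
    (insertPair M i (0 : Vec N) : Vec K) = 0 := by
  funext γ; simp [insertPair]

theorem insertPair_add (M : Bool → Bool → Coef) (i : ℕ) (f g : Vec N) :
    (insertPair M i (f + g) : Vec K) = insertPair M i f + insertPair M i g := by
  funext γ; simp [insertPair, mul_add]

theorem insertPair_smul (M : Bool → Bool → Coef) (i : ℕ) (r : Coef) (f : Vec N) :
    (insertPair M i (r • f) : Vec K) = r • insertPair M i f := by
  funext γ; simp [insertPair, mul_left_comm]

theorem append_zero (u : Bool → Coef) : (append u (0 : Vec N) : Vec K) = 0 := by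
  funext γ; simp [append]

theorem append_add (u : Bool → Coef) (f g : Vec N) :
    (append u (f + g) : Vec K) = append u f + append u g := by
  funext γ; simp [append, add_mul]

theorem append_smul (u : Bool → Coef) (r : Coef) (f : Vec N) :
    (append u (r • f) : Vec K) = r • append u f := by
  funext γ; simp [append, mul_assoc]

theorem cap_zero (i : ℕ) : (cap i (0 : Vec K) : Vec N) = 0 := by
  funext γ; simp [cap]

theorem cap_add (i : ℕ) (f g : Vec K) : (cap i (f + g) : Vec N) = cap i f + cap i g := by
  funext γ; simp only [cap, Pi.add_apply]; ring

theorem cap_smul (i : ℕ) (r : Coef) (f : Vec K) : (cap i (r • f) : Vec N) = r • cap i f := by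
  funext γ; simp only [cap, Pi.smul_apply, smul_eq_mul]; ring

theorem capLast_zero (m : ℕ) : (capLast m (0 : Vec K) : Vec N) = 0 := by
  funext γ; simp [capLast]

theorem capLast_add (m : ℕ) (f g : Vec K) :
    (capLast m (f + g) : Vec N) = capLast m f + capLast m g := by
  funext γ; simp only [capLast, Pi.add_apply]; ring

theorem capLast_smul (m : ℕ) (r : Coef) (f : Vec K) :
    (capLast m (r • f) : Vec N) = r • capLast m f := by
  funext γ; simp only [capLast, Pi.smul_apply, smul_eq_mul]; ring

end linearity

/-- The vector `m_1`. -/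
noncomputable def oneW : Bool → Coef
  | true => 0
  | false => 1

/-- Exhibits the last `1` as an appended factor, so that the contraction rules for appended letters
apply next to the initial `1`s as well. -/
theorem onesVec_eq_append {N K : ℕ} (hK : K = N + 1) : onesVec K = append oneW (onesVec N) := by
  classical
  funext γ
  obtain ⟨α, d, rfl⟩ := exists_eq_snoc hK γ
  rw [append_snoc _ hK, onesVec, onesVec]
  by_cases h : ∀ k < N, letter α k = one
  · cases d
    · rw [if_pos h, if_pos]
      · simp [oneW]
      · intro k hk
        rw [letter_snoc _ _ hk]
        split_ifs with h1
        · exact h k h1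
        · rfl
    · rw [if_neg]
      · simp [oneW]
      · intro h'
        have := h' N (by omega)
        rw [letter_snoc_last hK] at this
        simp at this
  · rw [if_neg h, if_neg, zero_mul]
    intro h'
    refine h fun k hk => ?_
    have := h' k (by omega)
    rwa [letter_snoc _ _ (by omega), if_pos hk] at this

theorem cap_onesVec {N K i : ℕ} (hK : K = N + 2) (hi : i ≤ N) :
    (cap i (onesVec K) : Vec N) = 0 := by
  funext α
  rw [cap, onesVec, onesVec, if_neg, if_neg]
  · simp
  · intro h
    have := h i (by omega)
    rw [letter_insertTwo_left _ (by omega)] at this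
    simp at this
  · intro h
    have := h (i + 1) (by omega)
    rw [letter_insertTwo_right _ (by omega)] at this
    simp at this

/-- The Kazhdan–Lusztig vectors of the strings `1…12…2`, for the largest label `p`. -/
inductive Base (m : ℕ) : ℕ → (N : ℕ) → Vec N → Prop
  | ones (p N : ℕ) : Base m p N (onesVec N)
  | leftover {N K : ℕ} (hK : K = N + 1) : Base m 0 K (append twoW (onesVec N))
  | label {p q N K : ℕ} {f : Vec N} (hq : q = p + 1) (hK : K = N + 1) (hf : Base m p N f) :
      Base m q K (append (labelW m q) f)
  | pair {N K : ℕ} {f : Vec N} (hK : K = N + 2) (hf : Base m 0 N f) :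
      Base m 0 K (insertPair pairW N f)

/-- The combinations, with bar-invariant coefficients, of the Kazhdan–Lusztig vectors for the
largest label `p`. -/
inductive Lat (m p : ℕ) : (N : ℕ) → Vec N → Prop
  | zero (N : ℕ) : Lat m p N 0
  | add {N : ℕ} {f g : Vec N} (hf : Lat m p N f) (hg : Lat m p N g) : Lat m p N (f + g)
  | smul {N : ℕ} {f : Vec N} (r : Coef) (hr : invert r = r) (hf : Lat m p N f) :
      Lat m p N (r • f)
  | base {N : ℕ} {f : Vec N} (hf : Base m p N f) : Lat m p N f
  | cup {N K : ℕ} {f : Vec N} (i : ℕ) (hK : K = N + 2) (hi : i ≤ N) (hf : Lat m p N f) :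
      Lat m p K (insertPair cupW i f)

/-- Inserting a 21 pair commutes with appending a letter, so it suffices to append to base vectors.
-/
theorem Lat.label {m p N : ℕ} {f : Vec N} (hf : Lat m p N f) :
    ∀ {q K : ℕ}, q = p + 1 → K = N + 1 → Lat m q K (append (labelW m q) f) := by
  induction hf with
  | zero N => intro q K _ _; rw [append_zero]; exact Lat.zero _
  | add _ _ ih1 ih2 => intro q K h1 h2; rw [append_add]; exact (ih1 h1 h2).add (ih2 h1 h2)
  | smul r hr _ ih => intro q K h1 h2; rw [append_smul]; exact (ih h1 h2).smul r hr
  | base hf => intro q K h1 h2; exact Lat.base (hf.label h1 h2)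
  | cup i hK hi _ ih =>
    intro q K h1 h2
    rw [← insertPair_append rfl hK (by omega) hi]
    exact (ih h1 rfl).cup i (by omega) (by omega)

theorem Lat.pair {m p N : ℕ} {f : Vec N} (hf : Lat m p N f) :
    ∀ {K : ℕ}, p = 0 → K = N + 2 → Lat m 0 K (insertPair pairW N f) := by
  induction hf with
  | zero N => intro K _ _; rw [insertPair_zero]; exact Lat.zero _
  | add _ _ ih1 ih2 => intro K h1 h2; rw [insertPair_add]; exact (ih1 h1 h2).add (ih2 h1 h2)
  | smul r hr _ ih => intro K h1 h2; rw [insertPair_smul]; exact (ih h1 h2).smul r hr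
  | base hf => intro K h1 h2; subst h1; exact Lat.base (hf.pair h2)
  | @cup N K f i hK hi _ ih =>
    intro L h1 h2
    subst hK
    rw [insertPair_comm rfl (by omega) hi le_rfl]
    exact (ih h1 rfl).cup i (by omega) (by omega)

theorem neg_one_pow_mul_self (n : ℕ) : ((-1) ^ n * (-1) ^ n : Coef) = 1 := by
  rw [← mul_pow]; simp

theorem invert_neg_one_pow (n : ℕ) : invert ((-1) ^ n : Coef) = (-1) ^ n := by simp

/-- A contraction inside the initial `1`s, inside a 22 pair or between two labels vanishes. At any
other junction of factors it gives, up to sign, a shorter base vector or, between two 22 pairs, a 21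
pair. A contraction that avoids the last factor is handled by induction. The `ones` are allowed for
every `p` because labels may run out at the initial `1`s. -/
theorem Base.cap {m p K : ℕ} {f : Vec K} (hf : Base m p K f) :
    ∀ {N i : ℕ}, K = N + 2 → i ≤ N → Lat m p N (cap i f) := by
  induction hf with
  | ones p N => intro N i hN hi; rw [cap_onesVec hN hi]; exact Lat.zero _
  | @leftover M K hK =>
    intro N i hN hi
    obtain rfl | h : i = N ∨ i < N := by omega
    · obtain rfl : M = i + 1 := by omega
      rw [onesVec_eq_append rfl, cap_append_append rfl hN]
      simpa [oneW, twoW] using Lat.base (Base.ones 0 i)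
    · obtain ⟨n, rfl⟩ : ∃ n, N = n + 1 := ⟨N - 1, by omega⟩
      rw [cap_append rfl (by omega : M = n + 2) (by omega) (by omega),
        cap_onesVec (by omega) (by omega), append_zero]
      exact Lat.zero _
  | @label p q M K f hq hK hf ih =>
    intro N i hN hi
    obtain rfl | h : i = N ∨ i < N := by omega
    · cases hf with
      | ones =>
        rw [onesVec_eq_append (N := i) (by omega), cap_append_append (by omega) hN]
        simpa [oneW, labelW] using Lat.base (Base.ones q i)
      | @leftover M' _ hM' =>
        obtain rfl : M' = i := by omega
        rw [cap_append_append hM' hN]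
        have : (twoW one * labelW m q two + T 1 * (twoW two * labelW m q one) : Coef) =
            (-1) ^ (m + 1) := by
          subst hq
          simp only [twoW, labelW, Nat.cast_one, Nat.zero_add]
          linear_combination (-1) ^ (m + 1) * T_one_mul_neg
        rw [this]
        exact (Lat.base (Base.ones _ _)).smul _ (invert_neg_one_pow _)
      | @label p' _ M' _ f' hq' hM' hf' =>
        obtain rfl : M' = i := by omega
        rw [cap_append_append hM' hN]
        -- Consecutive labels differ by one, so both terms are the same power of `t`; the
        -- alternating sign of the labels makes them cancel.
        have : (labelW m p one * labelW m q two + T 1 * (labelW m p two * labelW m q one) : Coef) =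
            0 := by
          subst hq
          have h : (T (-(p : ℤ)) : Coef) = T 1 * T (-((p + 1 : ℕ) : ℤ)) := by
            rw [← T_add]; congr 1; push_cast; ring
          simp only [labelW, h]; ring
        rw [this, zero_smul]
        exact Lat.zero _
      | @pair M' _ f' hM' hf' =>
        obtain rfl : i = M' + 1 := by omega
        rw [cap_append_insertPair rfl hM' (by omega)]
        have : (fun a => pairW a one * labelW m q two + T 1 * (pairW a two * labelW m q one)) =
            (-1 : Coef) ^ (m + 1) • labelW m 1 := by
          subst hq
          funext a
          cases a
          · simp [pairW, labelW, ← mul_assoc, neg_one_pow_mul_self]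
          · simp only [pairW, labelW, Nat.cast_one, Nat.zero_add, Pi.smul_apply, smul_eq_mul]
            linear_combination (-1) ^ (m + 1) * T_one_mul_neg
        have h2 : (append ((-1 : Coef) ^ (m + 1) • labelW m 1) f' : Vec (M' + 1)) =
            (-1 : Coef) ^ (m + 1) • append (labelW m 1) f' := by
          funext γ; simp [append, mul_left_comm]
        rw [this, h2, hq]
        exact (Lat.base (hf'.label rfl rfl)).smul _ (invert_neg_one_pow _)
    · obtain ⟨n, rfl⟩ : ∃ n, N = n + 1 := ⟨N - 1, by omega⟩
      rw [cap_append rfl (by omega : M = n + 2) (by omega) (by omega)]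
      exact (ih (by omega) (by omega)).label hq rfl
  | @pair M K f hK hf ih =>
    intro N i hN hi
    obtain rfl : M = N := by omega
    obtain rfl | rfl | h : i = M ∨ M = i + 1 ∨ i + 2 ≤ M := by omega
    · have : (BallotKL.cap i (insertPair pairW i f : Vec K) : Vec i) = 0 := by
        funext α
        rw [BallotKL.cap, insertPair_insertTwo _ _ hK hi, insertPair_insertTwo _ _ hK hi]
        simp [pairW]
      rw [this]
      exact Lat.zero _
    · cases hf with
      | ones =>
        rw [onesVec_eq_append rfl, cap_insertPair_append rfl rfl hK]
        have : (fun d => oneW one * pairW two d + T 1 * (oneW two * pairW one d)) = twoW := by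
          funext d; cases d <;> simp [oneW, pairW, twoW]
        rw [this]
        exact Lat.base (Base.leftover rfl)
      | @leftover M' _ hM' =>
        obtain rfl : M' = i := by omega
        rw [cap_insertPair_append rfl rfl hK]
        have : (fun d => twoW one * pairW two d + T 1 * (twoW two * pairW one d)) = oneW := by
          funext d
          cases d <;> simp only [oneW, pairW, twoW, T_one_mul_neg, mul_zero, zero_mul, one_mul, add_zero,
            zero_add]
        rw [this, ← onesVec_eq_append rfl]
        exact Lat.base (Base.ones _ _)
      | label hq => omega
      | @pair M' _ f' hM' hf' =>
        obtain rfl : i = M' + 1 := by omega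
        rw [cap_insertPair_insertPair rfl hK]
        -- Joining the inner ends of two 22 pairs turns their outer ends into a 21 pair.
        have : (fun a d => pairW a one * pairW two d + T 1 * (pairW a two * pairW one d)) =
            cupW := by
          funext a d
          cases a <;> cases d <;> simp only [pairW, cupW, T_one_mul_neg, mul_zero, zero_mul, one_mul,
            mul_one, add_zero, zero_add]
        rw [this]
        exact (Lat.base hf').cup _ rfl le_rfl
    · obtain ⟨n, rfl⟩ : ∃ n, M = n + 2 := ⟨M - 2, by omega⟩
      rw [cap_insertPair_right rfl hK rfl (by omega) le_rfl]
      exact (ih rfl (by omega)).pair rfl rfl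

theorem invert_T_add_T_neg (n : ℤ) : invert (T n + T (-n) : Coef) = T n + T (-n) := by
  simp [add_comm]

/-- Against an inserted pair the contraction gives a loop, with the bar-invariant value `t + t⁻¹`, a
zigzag, or a distant pair with which it commutes. -/
theorem Lat.cap {m p K : ℕ} {f : Vec K} (hf : Lat m p K f) :
    ∀ {N i : ℕ}, K = N + 2 → i ≤ N → Lat m p N (cap i f) := by
  induction hf with
  | zero N => intro N i _ _; rw [cap_zero]; exact Lat.zero _
  | add _ _ ih1 ih2 => intro N i h1 h2; rw [cap_add]; exact (ih1 h1 h2).add (ih2 h1 h2)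
  | smul r hr _ ih => intro N i h1 h2; rw [cap_smul]; exact (ih h1 h2).smul r hr
  | base hf => intro N i h1 h2; exact hf.cap h1 h2
  | @cup M K f j hK hj hf ih =>
    intro N i hN hi
    obtain rfl : M = N := by omega
    obtain rfl | rfl | rfl | h | h : i = j ∨ i = j + 1 ∨ j = i + 1 ∨ i + 2 ≤ j ∨ j + 2 ≤ i := by
      omega
    · rw [cap_insertPair_self _ hK hi]
      exact hf.smul _ (invert_T_add_T_neg 1)
    · rw [cap_succ_insertPair (N := M - 1) (by omega) (by omega) (by omega)]
      exact hf
    · rw [cap_insertPair_succ (N := M - 1) (by omega) (by omega) (by omega)]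
      exact hf
    · obtain ⟨n, rfl⟩ : ∃ n, M = n + 2 := ⟨M - 2, by omega⟩
      obtain ⟨j, rfl⟩ : ∃ k, j = k + 2 := ⟨j - 2, by omega⟩
      rw [cap_insertPair_right rfl hK rfl (by omega) (by omega)]
      exact (ih rfl (by omega)).cup _ rfl (by omega)
    · obtain ⟨n, rfl⟩ : ∃ n, M = n + 2 := ⟨M - 2, by omega⟩
      obtain ⟨i, rfl⟩ : ∃ k, i = k + 2 := ⟨i - 2, by omega⟩
      rw [cap_insertPair_left rfl hK rfl (by omega) (by omega)]
      exact (ih rfl (by omega)).cup _ rfl (by omega)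

theorem append_onesVec_shiftW_one {m N K : ℕ} (hK : K = N + 1) :
    (append (shiftW m 1) (onesVec N) : Vec K) =
      append twoW (onesVec N) + (-1 : Coef) ^ (m + 1) • onesVec K := by
  rw [onesVec_eq_append hK]
  funext γ
  simp only [append, Pi.add_apply, Pi.smul_apply, smul_eq_mul]
  cases letter γ N <;> simp [shiftW, twoW, oneW, mul_comm]

/-- The coefficients of `m_1` in `shiftW m (q + 1)` and `labelW m q` are `t^q` and `t^(-q)` with
opposite signs, so their difference is bar-invariant. -/
theorem append_onesVec_shiftW {m q N K : ℕ} (hK : K = N + 1) :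
    (append (shiftW m (q + 1)) (onesVec N) : Vec K) =
      append (labelW m q) (onesVec N) +
        ((-1 : Coef) ^ (m + q + 1) * (T (q : ℤ) + T (-(q : ℤ)))) • onesVec K := by
  rw [onesVec_eq_append hK]
  funext γ
  simp only [append, Pi.add_apply, Pi.smul_apply, smul_eq_mul]
  cases letter γ N
  · simp only [shiftW, labelW, oneW]
    push_cast
    rw [add_sub_cancel_right]
    ring
  · simp [shiftW, labelW, oneW]

theorem append_shiftW_labelW_one {m N K L : ℕ} (hK : K = N + 1) (hL : L = N + 2) (f : Vec N) :
    (append (shiftW m 1) (append (labelW m 1) f : Vec K) : Vec L) =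
      insertPair pairW N f + (-1 : Coef) ^ (m + 1) • insertPair cupW N f := by
  rw [append_append hK hL]
  funext γ
  simp only [insertPair, Pi.add_apply, Pi.smul_apply, smul_eq_mul]
  cases letter γ N <;> cases letter γ (N + 1) <;> simp [shiftW, labelW, pairW, cupW]
  · rw [mul_right_comm _ _ ((-1 : Coef) ^ (m + 1)), neg_one_pow_mul_self, one_mul, mul_comm]
  · ring

/-- The exchange relation that moves `shiftW` to the left of a label: both parameters drop by one,
at the cost of a bar-invariant multiple of a 21 pair. -/
theorem append_shiftW_labelW {m q N K L : ℕ} (hK : K = N + 1) (hL : L = N + 2) (f : Vec N) :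
    (append (shiftW m (q + 1)) (append (labelW m (q + 1)) f : Vec K) : Vec L) =
      append (labelW m q) (append (shiftW m q) f : Vec K) +
      ((-1 : Coef) ^ (m + q + 1) * (T (q : ℤ) + T (-(q : ℤ)))) • insertPair cupW N f := by
  rw [append_append hK hL, append_append hK hL]
  funext γ
  simp only [insertPair, Pi.add_apply, Pi.smul_apply, smul_eq_mul]
  have e1 : (T (q : ℤ) : Coef) * T (-1) = T ((q : ℤ) - 1) := by rw [← T_add]; rfl
  have e2 : (T (-(q : ℤ)) : Coef) * T (-1) = T (-((q + 1 : ℕ) : ℤ)) := by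
    rw [← T_add]; congr 1; push_cast; ring
  have e3 : (T (((q + 1 : ℕ) : ℤ) - 1) : Coef) = T q := by congr 1; push_cast; ring
  have e4 : (T (-((q + 1 : ℕ) : ℤ)) : Coef) * T q = T (-1) := by
    rw [← T_add]; congr 1; push_cast; ring
  have e5 : (T ((q : ℤ) - 1) : Coef) * T (-(q : ℤ)) = T (-1) := by
    rw [← T_add]; congr 1; ring
  have s : ((-1) ^ (m + q + 1) : Coef) = -(-1) ^ (m + q) := by rw [pow_succ]; ring
  have s2 := neg_one_pow_mul_self (m + q)
  cases letter γ N <;> cases letter γ (N + 1) <;>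
    simp only [shiftW, labelW, cupW, ← add_assoc, s, e3]
  · linear_combination f (deleteTwo N γ) * (e4 - e5) * ((-1) ^ (m + q) * (-1) ^ (m + q))
  · rw [← e2]; linear_combination f (deleteTwo N γ) * (-1) ^ (m + q) * e1
  · ring
  · ring

/-- The factor `shiftW` travels left and lowers every label it passes, until it merges with the
label `1` into a 22 pair or reaches the initial `1`s. All correction terms have bar-invariant
coefficients. -/
theorem Base.shift {m p N : ℕ} {f : Vec N} (hf : Base m p N f) :
    ∀ {q K : ℕ}, p = q + 1 → K = N + 1 → Lat m q K (append (shiftW m p) f) := by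
  have inv : ∀ q : ℕ, invert ((-1 : Coef) ^ (m + q + 1) * (T (q : ℤ) + T (-(q : ℤ)))) =
      (-1 : Coef) ^ (m + q + 1) * (T (q : ℤ) + T (-(q : ℤ))) := by
    intro q; rw [map_mul, invert_T_add_T_neg, invert_neg_one_pow]
  induction hf with
  | ones p N =>
    intro q K hp hK
    subst hp
    cases q with
    | zero =>
      rw [append_onesVec_shiftW_one hK]
      exact (Lat.base (Base.leftover hK)).add
        ((Lat.base (Base.ones _ _)).smul _ (invert_neg_one_pow _))
    | succ q =>
      rw [append_onesVec_shiftW hK]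
      exact (Lat.base ((Base.ones q N).label rfl hK)).add
        ((Lat.base (Base.ones _ _)).smul _ (inv _))
  | leftover => intro q K hp; omega
  | pair => intro q K hp; omega
  | @label p p' N M f hp' hM hf ih =>
    intro q K hp hK
    subst hp
    obtain rfl : p = q := by omega
    cases p with
    | zero =>
      rw [append_shiftW_labelW_one hM (by omega)]
      exact (Lat.base (hf.pair (by omega))).add
        (((Lat.base hf).cup N (by omega) le_rfl).smul _ (invert_neg_one_pow _))
    | succ p =>
      rw [append_shiftW_labelW hM (by omega)]
      exact ((ih rfl hM).label rfl (by omega)).add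
        (((Lat.base hf).cup N (by omega) le_rfl).smul _ (inv _))

theorem Lat.shift {m p N : ℕ} {f : Vec N} (hf : Lat m p N f) :
    ∀ {q K : ℕ}, p = q + 1 → K = N + 1 → Lat m q K (append (shiftW m p) f) := by
  induction hf with
  | zero N => intro q K _ _; rw [append_zero]; exact Lat.zero _
  | add _ _ ih1 ih2 => intro q K h1 h2; rw [append_add]; exact (ih1 h1 h2).add (ih2 h1 h2)
  | smul r hr _ ih => intro q K h1 h2; rw [append_smul]; exact (ih h1 h2).smul r hr
  | base hf => intro q K h1 h2; exact hf.shift h1 h2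
  | cup i hK hi _ ih =>
    intro q K h1 h2
    rw [← insertPair_append rfl hK (by omega) hi]
    exact (ih h1 rfl).cup i (by omega) (by omega)

/-- Only here is the largest label tied to the parameter `t^m` of `T_N`: contracting the letter
labelled `m` yields the bar-invariant scalar `t^m + t^(-m)`. The resulting largest label `m - 1`
leaves room for the label `m` that `tlOp` appends. -/
theorem Lat.capLast {m p K : ℕ} {f : Vec K} (hf : Lat m p K f) :
    ∀ {q N : ℕ}, p = m → m = q + 1 → K = N + 1 → Lat m q N (capLast m f) := by
  induction hf with
  | zero N => intro q N _ _ _; rw [capLast_zero]; exact Lat.zero _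
  | add _ _ ih1 ih2 =>
    intro q N h1 h2 h3; rw [capLast_add]; exact (ih1 h1 h2 h3).add (ih2 h1 h2 h3)
  | smul r hr _ ih => intro q N h1 h2 h3; rw [capLast_smul]; exact (ih h1 h2 h3).smul r hr
  | base hf =>
    intro q N h1 h2 h3
    cases hf with
    | ones =>
      rw [onesVec_eq_append h3, capLast_append _ h3]
      simpa [oneW] using Lat.base (Base.ones q N)
    | leftover => omega
    | pair => omega
    | @label p' _ M _ f hq hK hf =>
      obtain rfl : M = N := by omega
      obtain rfl : p' = q := by omega
      rw [capLast_append _ h3]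
      have : labelW m p one + T (m : ℤ) * labelW m p two = T (m : ℤ) + T (-(m : ℤ)) := by
        subst h1
        simp only [labelW]
        rw [pow_add, neg_one_pow_mul_self]; ring
      rw [this]
      exact (Lat.base hf).smul _ (invert_T_add_T_neg _)
  | @cup M K f i hK hi hf ih =>
    intro q N h1 h2 h3
    obtain rfl | h : i = M ∨ i < M := by omega
    · rw [capLast_insertPair_last m (by omega) hK]
      -- For a 21 pair ending at the last letter, contracting its right end leaves `m_2 + t^(m-1)
      -- m_1` in place of its left end.
      have : (fun a => cupW a one + T (m : ℤ) * cupW a two) = shiftW m p := by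
        subst h1
        funext a
        cases a
        · simp only [cupW, shiftW]
          rw [pow_add, neg_one_pow_mul_self, ← T_add]; simp [sub_eq_add_neg]
        · simp [cupW, shiftW]
      rw [this]
      exact hf.shift (by omega) (by omega)
    · obtain ⟨n, rfl⟩ : ∃ n, M = n + 1 := ⟨M - 1, by omega⟩
      rw [capLast_insertPair m rfl (by omega : N = n + 2) (by omega) (by omega)]
      exact (ih h1 h2 rfl).cup i (by omega) (by omega)

/-! ### The Hecke operators as contractions followed by insertions -/

/-- The exponent of `t` in the parameter of `T_i`. -/
def parExp {N : ℕ} (m : ℕ) (i : Fin N) : ℤ := if (i : ℕ) + 1 < N then 1 else m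

/-- The operator `T_i + t_i⁻¹`. -/
noncomputable def tlOp {N : ℕ} (m : ℕ) (i : Fin N) (f : Vec N) : Vec N :=
  if (i : ℕ) + 1 < N then insertPair cupW i (cap i f : Vec (N - 2))
  else append (labelW m m) (capLast m f : Vec (N - 1))

theorem insertTwo_injective {N K : ℕ} {i : ℕ} (hK : K = N + 2) (hi : i ≤ N) {α α' : Str N}
    {a b a' b' : Bool} (h : (insertTwo i α a b : Str K) = insertTwo i α' a' b') :
    α = α' ∧ a = a' ∧ b = b' := by
  refine ⟨?_, ?_, ?_⟩
  · rw [← deleteTwo_insertTwo i hK α a b, h, deleteTwo_insertTwo i hK]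
  · rw [← letter_insertTwo_left (K := K) i (by omega) α a b, h,
      letter_insertTwo_left i (by omega)]
  · rw [← letter_insertTwo_right (K := K) i (by omega) α a b, h,
      letter_insertTwo_right i (by omega)]

theorem snoc_injective {N K : ℕ} (hK : K = N + 1) {α α' : Str N} {d d' : Bool}
    (h : (snoc α d : Str K) = snoc α' d') : α = α' ∧ d = d' := by
  refine ⟨?_, ?_⟩
  · rw [← restrict_snoc hK α d, h, restrict_snoc hK]
  · rw [← letter_snoc_last hK α d, h, letter_snoc_last hK]

theorem insertTwo_comp_swap {N K : ℕ} {i i' : Fin K} (h : (i' : ℕ) = i + 1)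
    (α : Str N) (a b : Bool) :
    (insertTwo i α a b : Str K) ∘ Equiv.swap i i' = insertTwo i α b a := by
  funext k
  simp only [Function.comp]
  have hne : i ≠ i' := fun e => by rw [← e] at h; omega
  by_cases h1 : k = i
  · subst h1; rw [Equiv.swap_apply_left]; simp [insertTwo, h]
  · by_cases h2 : k = i'
    · subst h2; rw [Equiv.swap_apply_right]; simp [insertTwo, h]
    · rw [Equiv.swap_apply_of_ne_of_ne h1 h2]
      have h1' : (k : ℕ) ≠ i := fun e => h1 (Fin.ext e)
      have h2' : (k : ℕ) ≠ i + 1 := fun e => h2 (Fin.ext (by omega))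
      simp [insertTwo, h1', h2']

theorem update_snoc {N K : ℕ} (hK : K = N + 1) {i : Fin K} (h : (i : ℕ) = N) (α : Str N)
    (a b : Bool) : Function.update (snoc α a : Str K) i b = snoc α b := by
  funext k
  by_cases h1 : k = i
  · subst h1; simp [snoc, h]
  · have h1' : (k : ℕ) < N := by
      have := k.2
      have : (k : ℕ) ≠ i := fun e => h1 (Fin.ext e)
      omega
    simp [Function.update_of_ne h1, snoc, h1']

/-- On two letters, `T_i + t⁻¹` kills `11` and `22`, sends `12` to the tensor `cupW` and `21` to `t`
times it. On the last letter, `T_N + t^(-m)` sends `m_1` to `m_2 + t^(-m) m_1` and `m_2` to `t^m`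
times it. -/
theorem heckeVec_add {N : ℕ} (m : ℕ) (i : Fin N) (γ : Str N) :
    ⇑(heckeVec m i γ) + (T (-parExp m i) : Coef) • ⇑(mvec γ) = tlOp m i (mvec γ) := by
  classical
  have hN := i.2
  by_cases h : (i : ℕ) + 1 < N
  · obtain ⟨n, hn⟩ : ∃ n, N = n + 2 := ⟨N - 2, by omega⟩
    have hi : (i : ℕ) ≤ n := by omega
    have hn' : n = N - 2 := by omega
    obtain ⟨δ, c, d, rfl⟩ := exists_eq_insertTwo i hn hi γ
    funext α
    obtain ⟨ε, a, b, rfl⟩ := exists_eq_insertTwo i hn hi α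
    have e1 : (insertTwo i δ c d : Str N) i = c := by simp [insertTwo]
    have e2 : (insertTwo i δ c d : Str N) ⟨i + 1, h⟩ = d := by simp [insertTwo]
    have key : ∀ (δ ε : Str (N - 2)) (a b c d : Bool),
        ((insertTwo i δ c d : Str N) = insertTwo i ε a b) ↔ (δ = ε ∧ c = a ∧ d = b) := by
      subst hn'
      exact fun δ ε a b c d => ⟨fun h => insertTwo_injective hn hi h, by rintro ⟨rfl, rfl, rfl⟩; rfl⟩
    rw [tlOp, if_pos h, parExp, if_pos h, heckeVec, dif_pos h]
    subst hn'
    rw [insertPair_insertTwo _ _ hn hi, cap]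
    simp only [e1, e2, insertTwo_comp_swap (i := i) (i' := ⟨i + 1, h⟩) rfl]
    have hlt : ¬ (true < false) := by decide
    have hT : (T (-1) * T 1 : Coef) = 1 := by rw [← T_add]; simp
    by_cases hδ : δ = ε
    · cases a <;> cases b <;> cases c <;> cases d <;>
        simp [key, hδ, cupW, hlt, hT, one, two, -T_mul]
    · cases c <;> cases d <;> simp [key, hδ, hlt]
  · obtain ⟨n, hn⟩ : ∃ n, N = n + 1 := ⟨N - 1, by omega⟩
    have hn' : n = N - 1 := by omega
    obtain ⟨δ, d, rfl⟩ := exists_eq_snoc hn γ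
    funext α
    obtain ⟨ε, a, rfl⟩ := exists_eq_snoc hn α
    have hi : (i : ℕ) = n := by omega
    have e1 : (snoc δ d : Str N) i = d := by simp [snoc, hi]
    have key : ∀ (δ ε : Str (N - 1)) (d a : Bool),
        ((snoc δ d : Str N) = snoc ε a) ↔ (δ = ε ∧ d = a) := by
      subst hn'
      exact fun δ ε d a => ⟨fun h => snoc_injective hn h, by rintro ⟨rfl, rfl⟩; rfl⟩
    rw [tlOp, if_neg h, parExp, if_neg h, heckeVec, dif_neg h]
    subst hn'
    rw [append_snoc _ hn, capLast]
    simp only [e1, update_snoc hn hi]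
    have hm : ((-1 : Coef) ^ (m + m)) = 1 := by rw [pow_add, neg_one_pow_mul_self]
    have hT : (T (m : ℤ) * T (-(m : ℤ)) : Coef) = 1 := by rw [← T_add]; simp
    by_cases hδ : δ = ε
    · cases a <;> cases d <;> simp [key, hδ, labelW, hm, hT, one, two]
    · cases d <;> simp [key, hδ]

theorem tlOp_zero {N : ℕ} (m : ℕ) (i : Fin N) : tlOp m i 0 = 0 := by
  unfold tlOp; split_ifs
  · rw [cap_zero, insertPair_zero]
  · rw [capLast_zero, append_zero]

theorem tlOp_add {N : ℕ} (m : ℕ) (i : Fin N) (f g : Vec N) :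
    tlOp m i (f + g) = tlOp m i f + tlOp m i g := by
  unfold tlOp; split_ifs
  · rw [cap_add, insertPair_add]
  · rw [capLast_add, append_add]

theorem tlOp_smul {N : ℕ} (m : ℕ) (i : Fin N) (r : Coef) (f : Vec N) :
    tlOp m i (r • f) = r • tlOp m i f := by
  unfold tlOp; split_ifs
  · rw [cap_smul, insertPair_smul]
  · rw [capLast_smul, append_smul]

theorem tlOp_tlOp {N : ℕ} (m : ℕ) (i : Fin N) (f : Vec N) :
    tlOp m i (tlOp m i f) = (T (parExp m i) + T (-parExp m i) : Coef) • tlOp m i f := by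
  have hN := i.2
  unfold tlOp parExp; split_ifs with h
  · rw [cap_insertPair_self _ (by omega) (by omega), insertPair_smul]
  · rw [capLast_append _ (by omega), append_smul]
    congr 1
    simp only [labelW]
    rw [pow_add, neg_one_pow_mul_self]; ring

theorem heckeT_add {N : ℕ} (m : ℕ) (i : Fin N) (v : Mod N) :
    ⇑(heckeT m i v) + (T (-parExp m i) : Coef) • ⇑v = tlOp m i v := by
  induction v using Finsupp.induction_linear with
  | zero => simp [tlOp_zero]
  | add v w hv hw =>
    rw [map_add, Finsupp.coe_add, Finsupp.coe_add, tlOp_add, ← hv, ← hw, smul_add]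
    abel
  | single γ r =>
    have : (Finsupp.single γ r : Mod N) = r • mvec γ := by simp
    rw [this, map_smul, Finsupp.coe_smul, Finsupp.coe_smul, tlOp_smul, ← heckeVec_add, smul_add,
      smul_comm r, heckeT, Finsupp.linearCombination_single, one_smul]

/-- The quadratic relation `u² = (t_i + t_i⁻¹) u` for `u = T_i + t_i⁻¹`, rewritten for `T_i`. -/
theorem heckeT_heckeT {N : ℕ} (m : ℕ) (i : Fin N) (v : Mod N) :
    heckeT m i (heckeT m i v) =
      v + (T (parExp m i) - T (-parExp m i) : Coef) • heckeT m i v := by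
  have h1 := heckeT_add m i v
  have h2 := heckeT_add m i (heckeT m i v)
  have h3 := tlOp_tlOp m i v
  rw [← h1, tlOp_add, tlOp_smul, ← h2, ← h1] at h3
  have hT : (T (-parExp m i) * T (parExp m i) : Coef) = 1 := by rw [← T_add]; simp
  ext1 α
  have h4 := congrFun h3 α
  simp only [Pi.add_apply, Pi.smul_apply, smul_eq_mul, Finsupp.add_apply, Finsupp.smul_apply] at h4 ⊢
  linear_combination h4 + v α * hT

theorem Lat.tlOp {m N : ℕ} (hm : 1 ≤ m) (i : Fin N) {f : Vec N} (hf : Lat m m N f) :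
    Lat m m N (tlOp m i f) := by
  have hN := i.2
  unfold BallotKL.tlOp; split_ifs with h
  · exact (hf.cap (by omega) (by omega)).cup _ (by omega) (by omega)
  · obtain ⟨q, rfl⟩ : ∃ q, m = q + 1 := ⟨m - 1, by omega⟩
    exact (hf.capLast rfl rfl (by omega)).label rfl (by omega)

/-! ### Heights and the Bruhat order -/

/-- The step of a letter. -/
def sgn (b : Bool) : ℤ := if b = two then 1 else -1

theorem height_zero {N : ℕ} (α : Str N) : height α 0 = 0 := by simp [height]

theorem height_succ {N : ℕ} (α : Str N) {x : ℕ} (hx : x < N) :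
    height α (x + 1) = height α x + sgn (letter α x) := by
  have : height α (x + 1) - height α x = sgn (letter α x) := by
    rw [height, height, ← Finset.sum_sub_distrib, Finset.sum_eq_single (⟨x, hx⟩ : Fin N)]
    · simp [sgn, letter, hx]
    · intro b _ hb
      have : (b : ℕ) ≠ x := fun e => hb (Fin.ext e)
      by_cases h : (b : ℕ) < x
      · rw [if_pos (by omega), if_pos h, sub_self]
      · rw [if_neg (by omega), if_neg h, sub_self]
    · simp
  omega

theorem sgn_eq (b : Bool) : (b = true ∧ sgn b = 1) ∨ (b = false ∧ sgn b = -1) := by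
  cases b <;> simp [sgn]

theorem pathLE_refl {N : ℕ} (α : Str N) : pathLE α α := fun _ _ => le_rfl

theorem pathLE.trans {N : ℕ} {α β γ : Str N} (h : pathLE α β) (h' : pathLE β γ) : pathLE α γ :=
  fun x hx => (h x hx).trans (h' x hx)

theorem pathLE.antisymm {N : ℕ} {α β : Str N} (h : pathLE α β) (h' : pathLE β α) : α = β := by
  apply Str.ext_letter
  intro k hk
  have h1 := h k (by omega)
  have h2 := h' k (by omega)
  have h3 := h (k + 1) (by omega)
  have h4 := h' (k + 1) (by omega)
  rw [height_succ _ hk, height_succ _ hk] at h3 h4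
  rcases sgn_eq (letter α k) with ⟨e, e'⟩ | ⟨e, e'⟩ <;>
    rcases sgn_eq (letter β k) with ⟨f, f'⟩ | ⟨f, f'⟩ <;> first | omega | (rw [e, f])

/-- The strict Bruhat order. -/
def pathLT {N : ℕ} (α β : Str N) : Prop := pathLE α β ∧ α ≠ β

theorem pathLT.trans {N : ℕ} {α β γ : Str N} (h : pathLT α β) (h' : pathLT β γ) : pathLT α γ :=
  ⟨h.1.trans h'.1, by rintro rfl; exact h.2 (h.1.antisymm h'.1)⟩

theorem wellFounded_pathLT (N : ℕ) : WellFounded (pathLT (N := N)) := by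
  have : IsTrans (Str N) pathLT := ⟨fun _ _ _ h h' => h.trans h'⟩
  have : Std.Irrefl (pathLT (N := N)) := ⟨fun _ h => h.2 rfl⟩
  exact Finite.wellFounded_of_trans_of_irrefl _

theorem wellFounded_pathLT_swap (N : ℕ) : WellFounded (fun α β : Str N => pathLT β α) := by
  have : IsTrans (Str N) (fun α β : Str N => pathLT β α) := ⟨fun _ _ _ h h' => h'.trans h⟩
  have : Std.Irrefl (fun α β : Str N => pathLT β α) := ⟨fun _ h => h.2 rfl⟩
  exact Finite.wellFounded_of_trans_of_irrefl _

/-! ### Unitriangular families -/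

/-- The part of the definition of the Kazhdan–Lusztig basis that does not involve the bar
involution. -/
structure IsUnitri {N : ℕ} (C : Str N → Mod N) : Prop where
  coeff_self : ∀ β, C β β = 1
  coeff_mem : ∀ α β, pathLE α β → α ≠ β → C β α ∈ ZGammaNeg
  coeff_eq_zero : ∀ α β, ¬ pathLE α β → C β α = 0

theorem IsKLBasis.isUnitri {N m : ℕ} {C : Str N → Mod N} (h : IsKLBasis m C) : IsUnitri C :=
  ⟨h.coeff_self, h.coeff_mem, h.coeff_eq_zero⟩

/-- The linear map that sends `m_β` to `C_β`. -/
noncomputable def basisMap {N : ℕ} (C : Str N → Mod N) : Mod N →ₗ[Coef] Mod N :=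
  Finsupp.linearCombination Coef C

theorem basisMap_single {N : ℕ} (C : Str N → Mod N) (β : Str N) (r : Coef) :
    basisMap C (Finsupp.single β r) = r • C β := Finsupp.linearCombination_single _ _ _

theorem eq_sum_mvec {N : ℕ} (v : Mod N) : v = ∑ α, v α • mvec α := by
  ext1 β
  simp

/-- Back substitution in a unitriangular system, by induction along the Bruhat order. -/
theorem IsUnitri.surjective {N : ℕ} {C : Str N → Mod N} (h : IsUnitri C) :
    Function.Surjective (basisMap C) := by
  rw [← LinearMap.range_eq_top, eq_top_iff]
  have key : ∀ β, mvec β ∈ LinearMap.range (basisMap C) := by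
    intro β
    induction β using (wellFounded_pathLT N).induction with
    | _ β ih =>
      have h1 : mvec β = C β - ∑ α ∈ Finset.univ.erase β, C β α • mvec α := by
        rw [eq_sub_iff_add_eq]
        conv_rhs => rw [eq_sum_mvec (C β), ← Finset.add_sum_erase _ _ (Finset.mem_univ β),
          h.coeff_self, one_smul]
      rw [h1]
      refine Submodule.sub_mem _ ⟨mvec β, by rw [basisMap_single, one_smul]⟩
        (Submodule.sum_mem _ fun α hα => ?_)
      by_cases hle : pathLE α β
      · exact Submodule.smul_mem _ _ (ih α ⟨hle, Finset.ne_of_mem_erase hα⟩)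
      · rw [h.coeff_eq_zero α β hle, zero_smul]; exact Submodule.zero_mem _
  intro v _
  rw [eq_sum_mvec v]
  exact Submodule.sum_mem _ fun α _ => Submodule.smul_mem _ _ (key α)

theorem IsUnitri.bijective {N : ℕ} {C : Str N → Mod N} (h : IsUnitri C) :
    Function.Bijective (basisMap C) :=
  -- A surjective endomorphism of a finitely generated module over a commutative ring is injective.
  OrzechProperty.bijective_of_surjective_endomorphism _ h.surjective

/-- The semilinear involution that fixes the vectors `m_α`. -/
noncomputable def conj (N : ℕ) : Mod N →+ Mod N :=
  Finsupp.mapRange.addMonoidHom (invert : Coef ≃ₐ[ℂ] Coef).toAlgHom.toRingHom.toAddMonoidHom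

theorem conj_apply {N : ℕ} (v : Mod N) (α : Str N) : conj N v α = invert (v α) := rfl

theorem conj_smul {N : ℕ} (r : Coef) (v : Mod N) : conj N (r • v) = (invert r : Coef) • conj N v := by
  ext1 α
  simp [conj_apply]

theorem conj_single {N : ℕ} (r : Coef) (α : Str N) :
    conj N (Finsupp.single α r) = Finsupp.single α (invert r) :=
  Finsupp.mapRange_single (hf := map_zero _)

/-- The semilinear involution that fixes the vectors `C_β`. -/
noncomputable def barOf {N : ℕ} {C : Str N → Mod N} (h : IsUnitri C) : Mod N →+ Mod N :=
  (basisMap C).toAddMonoidHom.comp ((conj N).comp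
    (LinearEquiv.ofBijective _ h.bijective).symm.toLinearMap.toAddMonoidHom)

theorem barOf_basisMap {N : ℕ} {C : Str N → Mod N} (h : IsUnitri C) (v : Mod N) :
    barOf h (basisMap C v) = basisMap C (conj N v) := by
  have : (LinearEquiv.ofBijective _ h.bijective).symm (basisMap C v) = v :=
    (LinearEquiv.ofBijective _ h.bijective).symm_apply_apply v
  change basisMap C (conj N ((LinearEquiv.ofBijective _ h.bijective).symm (basisMap C v))) = _
  rw [this]

theorem barOf_smul {N : ℕ} {C : Str N → Mod N} (h : IsUnitri C) (r : Coef) (v : Mod N) :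
    barOf h (r • v) = (invert r : Coef) • barOf h v := by
  obtain ⟨w, rfl⟩ := h.surjective v
  rw [← map_smul, barOf_basisMap, barOf_basisMap, conj_smul, map_smul]

theorem barOf_self {N : ℕ} {C : Str N → Mod N} (h : IsUnitri C) (β : Str N) :
    barOf h (C β) = C β := by
  have : C β = basisMap C (Finsupp.single β 1) := by rw [basisMap_single, one_smul]
  rw [this, barOf_basisMap, conj_single, map_one]

/-- The bar-invariant combinations of the vectors `C_β`. -/
noncomputable def barSpan {N : ℕ} (C : Str N → Mod N) : AddSubgroup (Mod N) :=
  AddSubgroup.closure {v | ∃ (r : Coef) (β : Str N), invert r = r ∧ v = r • C β}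

theorem barOf_of_mem {N : ℕ} {C : Str N → Mod N} (h : IsUnitri C) {v : Mod N}
    (hv : v ∈ barSpan C) : barOf h v = v := by
  induction hv using AddSubgroup.closure_induction with
  | mem v hv =>
    obtain ⟨r, β, hr, rfl⟩ := hv
    rw [barOf_smul, barOf_self, hr]
  | zero => exact map_zero _
  | add v w _ _ hv hw => rw [map_add, hv, hw]
  | neg v _ hv => rw [map_neg, hv]

theorem invert_T_neg (n : ℤ) : invert (T (-n) : Coef) = T n := by simp

/-- The semilinear map `ψ` fixing every `C_β` is the bar involution: invariance of `T_i C_β + t_i⁻¹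
C_β` means `ψ (T_i C_β) = T_i C_β - (t_i - t_i⁻¹) C_β`, and the right side is `T_i⁻¹ C_β` by the
quadratic relation. -/
theorem IsUnitri.isKLBasis {N m : ℕ} {C : Str N → Mod N} (h : IsUnitri C)
    (h1 : C (fun _ => one) = mvec fun _ => one)
    (hT : ∀ i β, heckeT m i (C β) + (T (-parExp m i) : Coef) • C β ∈ barSpan C) :
    IsKLBasis m C where
  bar_invariant := by
    refine ⟨barOf h, ⟨barOf_smul h, ?_, ?_⟩, barOf_self h⟩
    · rw [← h1, barOf_self]
    · intro i v
      obtain ⟨w, rfl⟩ := h.surjective v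
      induction w using Finsupp.induction_linear with
      | zero => simp
      | add v w hv hw => rw [map_add, map_add, map_add, map_add, hv, hw, map_add]
      | single β r =>
        have e1 := barOf_of_mem h (hT i β)
        rw [map_add, barOf_smul, barOf_self, invert_T_neg] at e1
        have e2 : barOf h (heckeT m i (C β)) = heckeT m i (C β) -
            (T (parExp m i) - T (-parExp m i) : Coef) • C β := by
          rw [sub_smul, ← sub_eq_zero, ← sub_eq_zero.2 e1]; abel
        rw [basisMap_single, map_smul, barOf_smul, map_smul, e2, map_sub, heckeT_heckeT, map_smul,
          barOf_smul, barOf_self, add_sub_cancel_right]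
  coeff_self := h.coeff_self
  coeff_mem := h.coeff_mem
  coeff_eq_zero := h.coeff_eq_zero

/-! ### Uniqueness of the bar involution and of the Kazhdan–Lusztig basis -/

theorem heckeT_injective {N : ℕ} (m : ℕ) (i : Fin N) : Function.Injective (heckeT m i) := by
  intro v w hvw
  have h1 := heckeT_heckeT m i v
  rw [hvw, heckeT_heckeT] at h1
  exact (add_right_cancel h1).symm

/-- Take the rightmost `2` of `α`: either it is the last letter and `γ` turns it into a `1`, or it
is followed by a `1` and `γ` exchanges the two. Both changes lower the string lexicographically. -/
theorem exists_heckeVec {N : ℕ} (m : ℕ) (α : Str N) (hα : α ≠ fun _ => one) :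
    ∃ (i : Fin N) (γ : Str N), toLex γ < toLex α ∧ heckeVec m i γ = mvec α := by
  have hne : (Finset.univ.filter fun i => α i = two).Nonempty := by
    by_contra hcon
    rw [Finset.not_nonempty_iff_eq_empty, Finset.filter_eq_empty_iff] at hcon
    exact hα (funext fun i => by simpa using hcon (Finset.mem_univ i))
  set i := (Finset.univ.filter fun i => α i = two).max' hne with hi
  have hi2 : α i = two := (Finset.mem_filter.1 (Finset.max'_mem _ hne)).2
  have hmax : ∀ j, i < j → α j = one := by
    intro j hj
    by_contra hcon
    have : j ≤ i := Finset.le_max' _ j (Finset.mem_filter.2 ⟨Finset.mem_univ _, by simpa using hcon⟩)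
    exact absurd this (not_le.2 hj)
  by_cases h : (i : ℕ) + 1 < N
  · have hii : i < ⟨i + 1, h⟩ := by rw [Fin.lt_def]; simp
    refine ⟨i, α ∘ Equiv.swap i ⟨i + 1, h⟩, ⟨i, fun j hj => ?_, ?_⟩, ?_⟩
    · change (α ∘ Equiv.swap i ⟨i + 1, h⟩) j = α j
      rw [Function.comp, Equiv.swap_apply_of_ne_of_ne hj.ne (hj.trans hii).ne]
    · change (α ∘ Equiv.swap i ⟨i + 1, h⟩) i < α i
      rw [Function.comp, Equiv.swap_apply_left, hmax _ hii, hi2]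
      decide
    · rw [heckeVec, dif_pos h]
      simp only [Function.comp, Equiv.swap_apply_left, Equiv.swap_apply_right, hmax _ hii, hi2]
      rw [if_neg (by decide), if_pos (by decide)]
      congr 1
      funext k
      simp
  · refine ⟨i, Function.update α i one, ⟨i, fun j hj => ?_, ?_⟩, ?_⟩
    · change Function.update α i one j = α j
      rw [Function.update_of_ne hj.ne]
    · change Function.update α i one i < α i
      rw [Function.update_self, hi2]; decide
    · rw [heckeVec, dif_neg h, Function.update_self, if_pos rfl]
      congr 1
      rw [Function.update_idem, ← hi2, Function.update_eq_self]

/-- All basis vectors are reached from `m_{1…1}` by operators `T_i`, and `T_i (ψ (T_i m_γ)) = ψ m_γ`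
determines `ψ (T_i m_γ)` because `T_i` is injective. -/
theorem IsBar.unique {N m : ℕ} {ψ ψ' : Mod N →+ Mod N} (h : IsBar m ψ) (h' : IsBar m ψ') :
    ψ = ψ' := by
  have key : ∀ x : Lex (Str N), ψ (mvec (ofLex x)) = ψ' (mvec (ofLex x)) := by
    intro x
    induction x using WellFoundedLT.induction with
    | _ x ih =>
      by_cases hx : ofLex x = fun _ => one
      · rw [hx, h.map_base, h'.map_base]
      · obtain ⟨i, γ, hγ, he⟩ := exists_heckeVec m (ofLex x) hx
        have h1 : heckeT m i (mvec γ) = mvec (ofLex x) := by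
          rw [heckeT, Finsupp.linearCombination_single, one_smul, he]
        apply heckeT_injective m i
        rw [← h1, h.map_hecke, h'.map_hecke]
        exact ih (toLex γ) hγ
  refine AddMonoidHom.ext fun v => ?_
  induction v using Finsupp.induction_linear with
  | zero => simp
  | add v w hv hw => rw [map_add, map_add, hv, hw]
  | single γ r =>
    have : (Finsupp.single γ r : Mod N) = r • mvec γ := by simp
    rw [this, h.map_smul, h'.map_smul]
    exact congrArg _ (key (toLex γ))

theorem coeff_of_mem_ZGammaNeg {r : Coef} (hr : r ∈ ZGammaNeg) :
    ∀ n : ℤ, 0 ≤ n → r.coeff n = 0 := by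
  induction hr using AddSubgroup.closure_induction with
  | mem r hr =>
    obtain ⟨k, hk, rfl⟩ := hr
    intro n hn
    rw [T_apply, if_neg (by omega)]
  | zero => intro n _; rfl
  | add a b _ _ ha hb =>
    intro n hn
    rw [AddMonoidAlgebra.coeff_add, Finsupp.add_apply, ha n hn, hb n hn, add_zero]
  | neg a _ ha =>
    intro n hn
    rw [AddMonoidAlgebra.coeff_neg, Finsupp.neg_apply, ha n hn, neg_zero]

theorem eq_zero_of_mem_ZGammaNeg {r : Coef} (hr : r ∈ ZGammaNeg) (hi : invert r = r) : r = 0 := by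
  apply LaurentPolynomial.ext
  intro n
  by_cases hn : 0 ≤ n
  · exact coeff_of_mem_ZGammaNeg hr n hn
  · rw [← hi, invert_apply]
    exact coeff_of_mem_ZGammaNeg hr _ (by omega)

/-- Expanded in the basis `C`, the invariant vector `C'_β - C_β` has bar-invariant coefficients. A
leading one would lie in the span of negative powers of `t`, where only zero is bar-invariant. -/
theorem IsKLBasis.unique {N m : ℕ} {C C' : Str N → Mod N} (h : IsKLBasis m C)
    (h' : IsKLBasis m C') : C = C' := by
  obtain ⟨ψ, hψ, hC⟩ := h.bar_invariant
  obtain ⟨ψ', hψ', hC'⟩ := h'.bar_invariant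
  obtain rfl := hψ.unique hψ'
  funext β
  have hb := h.isUnitri.bijective
  obtain ⟨a, ha⟩ := hb.2 (C' β - C β)
  have hψa : ∀ a, ψ (basisMap C a) = basisMap C (conj N a) := by
    intro a
    induction a using Finsupp.induction_linear with
    | zero => simp
    | add v w hv hw => rw [map_add, map_add, map_add, map_add, hv, hw]
    | single γ r => rw [basisMap_single, hψ.map_smul, hC, conj_single, basisMap_single]
  have hinv : conj N a = a := by
    apply hb.1
    rw [← hψa, ha, map_sub, hC, hC']
  have hzero : a = 0 := by
    by_contra hne
    obtain ⟨γ₀, hγ₀⟩ : ∃ γ, a γ ≠ 0 := by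
      by_contra hcon
      push Not at hcon
      exact hne (Finsupp.ext hcon)
    -- At a Bruhat-maximal element `γ` of the support, no other `C_δ` in the expansion contributes
    -- to the coefficient of `m_γ`.
    obtain ⟨γ, hγ, hmax⟩ := (wellFounded_pathLT_swap N).has_min {γ | a γ ≠ 0} ⟨γ₀, hγ₀⟩
    have h1 : basisMap C a γ = a γ := by
      rw [basisMap, Finsupp.linearCombination_apply, Finsupp.sum_fintype _ _ (by simp),
        Finsupp.finsetSum_apply, Finset.sum_eq_single γ]
      · rw [Finsupp.smul_apply, h.coeff_self, smul_eq_mul, mul_one]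
      · intro δ _ hδ
        rw [Finsupp.smul_apply]
        by_cases hle : pathLE γ δ
        · have : a δ = 0 := by
            by_contra hcon
            exact hmax δ hcon ⟨hle, hδ.symm⟩
          rw [this, zero_smul]
        · rw [h.coeff_eq_zero _ _ hle, smul_zero]
      · simp
    have h2 : a γ ∈ ZGammaNeg := by
      rw [← h1, ha, Finsupp.sub_apply]
      by_cases hγβ : γ = β
      · rw [hγβ, h.coeff_self, h'.coeff_self, sub_self]; exact zero_mem _
      · by_cases hle : pathLE γ β
        · exact sub_mem (h'.coeff_mem _ _ hle hγβ) (h.coeff_mem _ _ hle hγβ)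
        · rw [h.coeff_eq_zero _ _ hle, h'.coeff_eq_zero _ _ hle, sub_self]; exact zero_mem _
    refine hγ (eq_zero_of_mem_ZGammaNeg h2 ?_)
    conv_rhs => rw [← hinv]
    rfl
  rw [hzero, map_zero] at ha
  exact (sub_eq_zero.1 ha.symm).symm

theorem IsKLBasis.klBasis_eq {N m : ℕ} {C : Str N → Mod N} (h : IsKLBasis m C) :
    klBasis m = C := by
  have hex : ∃ C : Str N → Mod N, IsKLBasis m C := ⟨C, h⟩
  rw [klBasis, dif_pos hex]
  exact hex.choose_spec.unique h

/-! ### Matched pairs and unpaired letters -/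

theorem height_succ_two {N : ℕ} {β : Str N} {i : Fin N} (h : β i = two) :
    height β (i + 1) = height β i + 1 := by
  rw [height_succ β i.2, letter_val, h]; simp [sgn]

theorem height_succ_one {N : ℕ} {β : Str N} {i : Fin N} (h : β i = one) :
    height β (i + 1) = height β i - 1 := by
  rw [height_succ β i.2, letter_val, h]; simp [sgn, sub_eq_add_neg]

theorem eq_two_of_height_lt {N : ℕ} {β : Str N} {i : Fin N}
    (h : height β i < height β (i + 1)) : β i = two := by
  by_contra hcon
  have h1 : β i = one := by simpa using hcon
  rw [height_succ_one h1] at h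
  omega

theorem eq_one_of_height_lt {N : ℕ} {β : Str N} {i : Fin N}
    (h : height β (i + 1) < height β i) : β i = one := by
  by_contra hcon
  have h1 : β i = two := by simpa using hcon
  rw [height_succ_two h1] at h
  omega

/-- The matching `1` is the step by which the path first returns to its height before position `i`.
-/
theorem exists_pair21_right {N : ℕ} {β : Str N} {i : Fin N} {y : ℕ} (hi : β i = two)
    (hy : (i : ℕ) < y) (hyN : y ≤ N) (h : height β y ≤ height β i) :
    ∃ j, IsPair21 β i j ∧ (j : ℕ) < y := by
  classical
  have hex : ∃ y, (i : ℕ) < y ∧ height β y ≤ height β i := ⟨y, hy, h⟩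
  set z := Nat.find hex with hz
  obtain ⟨h1, h2⟩ := Nat.find_spec hex
  have hzy : z ≤ y := Nat.find_min' hex ⟨hy, h⟩
  have hmin : ∀ k : ℕ, (i : ℕ) < k → k < z → height β i < height β k := by
    intro k hk hkz
    by_contra hcon
    exact Nat.find_min hex hkz ⟨hk, not_lt.1 hcon⟩
  rw [← hz] at h1 h2
  have hup := height_succ_two hi
  have hne : z ≠ i + 1 := by intro e; rw [e, hup] at h2; omega
  have hlt : z - 1 < N := by omega
  have hz1 : z - 1 + 1 = z := by omega
  have h3 := hmin (z - 1) (by omega) (by omega)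
  have h4 : β ⟨z - 1, hlt⟩ = one := by
    apply eq_one_of_height_lt
    change height β (z - 1 + 1) < height β (z - 1)
    rw [hz1]; omega
  have h5 := height_succ_one h4
  change height β (z - 1 + 1) = height β (z - 1) - 1 at h5
  rw [hz1] at h5
  refine ⟨⟨z - 1, hlt⟩, ⟨?_, hi, h4, ?_, ?_⟩, ?_⟩
  · rw [Fin.lt_def]; change (i : ℕ) < z - 1; omega
  · change height β (z - 1 + 1) = height β i; rw [hz1]; omega
  · intro k hk hk'
    exact hmin k hk (by change k ≤ z - 1 at hk'; omega)
  · change z - 1 < y; omega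

/-- The matching `2` starts at the last earlier abscissa where the path is no higher than after the
step `j`. -/
theorem exists_pair21_left {N : ℕ} {β : Str N} {j : Fin N} {y : ℕ} (hj : β j = one)
    (hy : y ≤ (j : ℕ)) (h : height β y ≤ height β (j + 1)) :
    ∃ i, IsPair21 β i j ∧ y ≤ (i : ℕ) := by
  classical
  set z := Nat.findGreatest (fun y => height β y ≤ height β (j + 1)) j with hz
  have h1 : height β z ≤ height β (j + 1) :=
    Nat.findGreatest_spec (P := fun y => height β y ≤ height β (j + 1)) hy h
  have hyz : y ≤ z := Nat.le_findGreatest hy h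
  have hzj : z ≤ j := Nat.findGreatest_le _
  have hmax : ∀ k, z < k → k ≤ (j : ℕ) → height β (j + 1) < height β k := by
    intro k hk hkj
    by_contra hcon
    exact Nat.findGreatest_is_greatest hk hkj (not_lt.1 hcon)
  have hdown := height_succ_one hj
  have hne : z ≠ j := by intro e; rw [e] at h1; omega
  have hlt : z < N := by have := j.2; omega
  have h3 := hmax (z + 1) (by omega) (by omega)
  have h4 : β ⟨z, hlt⟩ = two := by
    apply eq_two_of_height_lt
    change height β z < height β (z + 1)
    omega
  have h5 := height_succ_two h4
  change height β (z + 1) = height β z + 1 at h5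
  refine ⟨⟨z, hlt⟩, ⟨?_, h4, hj, ?_, ?_⟩, hyz⟩
  · rw [Fin.lt_def]; change z < (j : ℕ); omega
  · change height β (j + 1) = height β z; omega
  · intro k hk hk'
    have := hmax k hk hk'
    change height β z < height β k
    omega

theorem IsPair21.right_unique {N : ℕ} {β : Str N} {i j j' : Fin N} (h : IsPair21 β i j)
    (h' : IsPair21 β i j') : j = j' := by
  obtain ⟨h1, -, -, h2, h3⟩ := h
  obtain ⟨h1', -, -, h2', h3'⟩ := h'
  rw [Fin.lt_def] at h1 h1'
  rcases lt_trichotomy (j : ℕ) j' with hlt | heq | hlt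
  · have := h3' (j + 1) (by omega) (by omega); omega
  · exact Fin.ext heq
  · have := h3 (j' + 1) (by omega) (by omega); omega

theorem IsPair21.left_unique {N : ℕ} {β : Str N} {i i' j : Fin N} (h : IsPair21 β i j)
    (h' : IsPair21 β i' j) : i = i' := by
  obtain ⟨h1, -, -, h2, h3⟩ := h
  obtain ⟨h1', -, -, h2', h3'⟩ := h'
  rw [Fin.lt_def] at h1 h1'
  rcases lt_trichotomy (i : ℕ) i' with hlt | heq | hlt
  · have := h3 i' (by omega) (by omega); omega
  · exact Fin.ext heq
  · have := h3' i (by omega) (by omega); omega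

theorem IsPair21.not_unpaired2 {N : ℕ} {β : Str N} {i j : Fin N} (h : IsPair21 β i j) :
    ¬ IsUnpaired2 β i := fun h' => (h'.2 j).1 h

theorem IsUnpaired2.height_lt {N : ℕ} {β : Str N} {i : Fin N} (h : IsUnpaired2 β i) {y : ℕ}
    (hy : (i : ℕ) < y) (hyN : y ≤ N) : height β i < height β y := by
  by_contra hcon
  obtain ⟨j, hj, -⟩ := exists_pair21_right h.1 hy hyN (not_lt.1 hcon)
  exact (h.2 j).1 hj

theorem isUnpaired2_of_height {N : ℕ} {β : Str N} {i : Fin N} (hi : β i = two)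
    (h : ∀ y : ℕ, (i : ℕ) < y → y ≤ N → height β i < height β y) : IsUnpaired2 β i := by
  refine ⟨hi, fun j => ⟨fun hp => ?_, fun hp => ?_⟩⟩
  · have h1 := h (j + 1) (by have := hp.1; rw [Fin.lt_def] at this; omega) (by have := j.2; omega)
    have := hp.2.2.2.1
    omega
  · have := hp.2.2.1
    rw [hi] at this
    simp at this

theorem exists_pair21_of_not_unpaired2 {N : ℕ} {β : Str N} {i : Fin N} (hi : β i = two)
    (h : ¬ IsUnpaired2 β i) : ∃ j, IsPair21 β i j := by
  by_contra hcon
  push Not at hcon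
  refine h ⟨hi, fun j => ⟨hcon j, fun hp => ?_⟩⟩
  have := hp.2.2.1
  rw [hi] at this
  simp at this

open Classical in
/-- The number of unpaired `2`s at the positions `≥ x`. -/
noncomputable def rankFrom {N : ℕ} (β : Str N) (x : ℕ) : ℕ :=
  (Finset.univ.filter fun k : Fin N => x ≤ (k : ℕ) ∧ IsUnpaired2 β k).card

theorem rankFrom_of_unpaired2 {N : ℕ} {β : Str N} {i : Fin N} (h : IsUnpaired2 β i) :
    rankFrom β i = rankFrom β (i + 1) + 1 := by
  classical
  rw [rankFrom, rankFrom, ← Finset.card_insert_of_notMem (a := i)]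
  · congr 1
    ext k
    simp only [Finset.mem_filter, Finset.mem_univ, true_and, Finset.mem_insert]
    constructor
    · rintro ⟨h1, h2⟩
      by_cases hk : k = i
      · exact Or.inl hk
      · have : (k : ℕ) ≠ i := fun e => hk (Fin.ext e)
        exact Or.inr ⟨by omega, h2⟩
    · rintro (rfl | ⟨h1, h2⟩)
      · exact ⟨le_rfl, h⟩
      · exact ⟨by omega, h2⟩
  · simp

theorem rankFrom_eq_of_forall {N : ℕ} {β : Str N} {x y : ℕ} (hxy : x ≤ y)
    (h : ∀ k : Fin N, x ≤ (k : ℕ) → (k : ℕ) < y → ¬ IsUnpaired2 β k) :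
    rankFrom β x = rankFrom β y := by
  classical
  rw [rankFrom, rankFrom]
  congr 1
  ext k
  simp only [Finset.mem_filter, Finset.mem_univ, true_and]
  constructor
  · rintro ⟨h1, h2⟩
    exact ⟨by by_contra hcon; exact h k h1 (by omega) h2, h2⟩
  · rintro ⟨h1, h2⟩
    exact ⟨by omega, h2⟩

/-- The first letter from `x` on must be a `2`. If it is unpaired it contributes one to both sides;
if it is matched, its block returns to the height at `x`, contains no unpaired `2`, and may be
skipped. -/
theorem rankFrom_eq_height {N : ℕ} {β : Str N} {x : ℕ} (hx : x ≤ N)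
    (h : ∀ y, x ≤ y → y ≤ N → height β x ≤ height β y) :
    (rankFrom β x : ℤ) = height β N - height β x := by
  classical
  induction hn : N - x using Nat.strong_induction_on generalizing x with
  | _ n ih =>
    subst hn
    obtain rfl | hlt : x = N ∨ x < N := by omega
    · have : rankFrom β x = 0 := by
        rw [rankFrom, Finset.card_eq_zero, Finset.filter_eq_empty_iff]
        rintro k - ⟨h1, -⟩
        have := k.2; omega
      rw [this]; simp
    · have h2 : β ⟨x, hlt⟩ = two := by
        apply Classical.byContradiction
        intro hcon
        have h1 : β ⟨x, hlt⟩ = one := by simpa using hcon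
        have h3 := height_succ_one h1
        change height β (x + 1) = height β x - 1 at h3
        have := h (x + 1) (by omega) (by omega)
        omega
      by_cases hu : IsUnpaired2 β ⟨x, hlt⟩
      · have h3 := rankFrom_of_unpaired2 hu
        have h4 := height_succ_two h2
        change rankFrom β x = rankFrom β (x + 1) + 1 at h3
        change height β (x + 1) = height β x + 1 at h4
        rw [h3]
        have h5 := ih (N - (x + 1)) (by omega) (x := x + 1) (by omega) (fun y hy hyN => by
          have : height β x < height β y := hu.height_lt (show x < y by omega) hyN
          omega) rfl
        push_cast
        omega
      · obtain ⟨j, hj⟩ := exists_pair21_of_not_unpaired2 h2 hu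
        have hxj : x < (j : ℕ) := hj.1
        have hjx : height β (j + 1) = height β x := hj.2.2.2.1
        have h5 := ih (N - (j + 1)) (by omega) (x := j + 1) (by have := j.2; omega)
          (fun y hy hyN => by rw [hjx]; exact h y (by omega) hyN) rfl
        rw [rankFrom_eq_of_forall (y := j + 1) (by omega), h5, hjx]
        intro k hk hkj hku
        have h6 := hku.height_lt (show (k : ℕ) < j + 1 by omega) (by have := j.2; omega)
        have h7 := h k hk (by have := k.2; omega)
        omega

/-- The number of unpaired `2`s on the right of the position `i`. -/
noncomputable def rank {N : ℕ} (β : Str N) (i : Fin N) : ℕ := rankFrom β (i + 1)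

theorem rank_eq_height {N : ℕ} {β : Str N} {i : Fin N} (h : IsUnpaired2 β i) :
    (rank β i : ℤ) = height β N - height β (i + 1) := by
  refine rankFrom_eq_height i.2 fun y hy hyN => ?_
  have := h.height_lt (show (i : ℕ) < y by omega) hyN
  have := height_succ_two h.1
  omega

theorem rank_lt_rank {N : ℕ} {β : Str N} {i i' : Fin N} (hi' : IsUnpaired2 β i')
    (h : i < i') : rank β i' < rank β i := by
  classical
  rw [Fin.lt_def] at h
  have h1 := rankFrom_of_unpaired2 hi'
  have h2 : rankFrom β i' ≤ rankFrom β (i + 1) := by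
    apply Finset.card_le_card
    intro k
    simp only [Finset.mem_filter, Finset.mem_univ, true_and]
    rintro ⟨h3, h4⟩
    exact ⟨by omega, h4⟩
  rw [rank, rank]
  omega

theorem rank_injective {N : ℕ} {β : Str N} {i i' : Fin N} (hi : IsUnpaired2 β i)
    (hi' : IsUnpaired2 β i') (h : rank β i = rank β i') : i = i' := by
  rcases lt_trichotomy i i' with hlt | heq | hlt
  · have := rank_lt_rank hi' hlt; omega
  · exact heq
  · have := rank_lt_rank hi hlt; omega

theorem lt_of_rank_lt {N : ℕ} {β : Str N} {i i' : Fin N} (hi : IsUnpaired2 β i)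
    (h : rank β i' < rank β i) : i < i' := by
  rcases lt_trichotomy i i' with hlt | heq | hlt
  · exact hlt
  · rw [heq] at h; omega
  · have := rank_lt_rank hi hlt; omega

theorem exists_rank_eq {N : ℕ} {β : Str N} {i : Fin N} (h : 0 < rank β i) :
    ∃ k, IsUnpaired2 β k ∧ rank β i = rank β k + 1 := by
  classical
  have hne : (Finset.univ.filter fun k : Fin N => (i : ℕ) + 1 ≤ k ∧ IsUnpaired2 β k).Nonempty := by
    rw [rank, rankFrom] at h
    exact Finset.card_pos.1 h
  set z := Finset.min' _ hne with hz
  have hzm := Finset.min'_mem _ hne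
  rw [← hz, Finset.mem_filter] at hzm
  refine ⟨z, hzm.2.2, ?_⟩
  rw [rank, rank, ← rankFrom_of_unpaired2 hzm.2.2]
  refine rankFrom_eq_of_forall hzm.2.1 fun l hl hlz hlu => ?_
  have : z ≤ l := Finset.min'_le _ l (Finset.mem_filter.2 ⟨Finset.mem_univ _, hl, hlu⟩)
  rw [Fin.le_def] at this
  omega

theorem isNthUnpaired2_iff {N : ℕ} {β : Str N} {j : ℕ} {i : Fin N} :
    IsNthUnpaired2 β j i ↔ IsUnpaired2 β i ∧ j = rank β i + 1 := by
  classical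
  unfold IsNthUnpaired2
  refine and_congr_right fun h => ?_
  have h1 := rankFrom_of_unpaired2 h
  have h2 : (Finset.univ.filter fun k : Fin N => i ≤ k ∧ IsUnpaired2 β k).card =
      rankFrom β i := by
    rw [rankFrom]
    congr 1
  rw [rank, ← h1, ← h2, eq_comm]

theorem hasLabel_iff {N m : ℕ} {β : Str N} {p : ℕ} {i : Fin N} :
    HasLabel m β p i ↔ IsUnpaired2 β i ∧ rank β i < m ∧ p = m - rank β i := by
  unfold HasLabel
  simp only [isNthUnpaired2_iff]
  constructor
  · rintro ⟨j, h1, h2, h3, h4, h5⟩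
    exact ⟨h4, by omega, by omega⟩
  · rintro ⟨h1, h2, h3⟩
    exact ⟨rank β i + 1, by omega, by omega, by omega, h1, rfl⟩

/-- The `j`-th unpaired `2` from the right has rank `j - 1`, which turns the parity condition on `j`
into one on the rank of the right letter. -/
theorem isPair22_iff {N m : ℕ} {β : Str N} {i i' : Fin N} :
    IsPair22 m β i i' ↔ IsUnpaired2 β i ∧ IsUnpaired2 β i' ∧ rank β i = rank β i' + 1 ∧
      m ≤ rank β i' ∧ Even (rank β i' - m) := by
  unfold IsPair22
  simp only [isNthUnpaired2_iff]
  constructor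
  · rintro ⟨j, h1, h2, ⟨h3, h4⟩, h5, h6⟩
    refine ⟨h3, h5, by omega, by omega, ?_⟩
    rw [Nat.even_iff] at h2 ⊢
    omega
  · rintro ⟨h1, h2, h3, h4, h5⟩
    refine ⟨rank β i' + 1, by omega, ?_, ⟨h1, by omega⟩, h2, rfl⟩
    rw [Nat.even_iff] at h5 ⊢
    omega

theorem not_isUnpaired2_of_one {N : ℕ} {β : Str N} {i : Fin N} (h : β i = one) :
    ¬ IsUnpaired2 β i := fun h' => by have := h'.1; rw [h] at this; simp at this

/-! ### The Kazhdan–Lusztig coefficients -/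

/-- The coefficient of a flipped unpaired `2` with `r` unpaired `2`s on its right. -/
noncomputable def rankW (m r : ℕ) : Coef :=
  if r < m then (-1) ^ r * T ((r : ℤ) - m) else if Even (r - m) then 1 else T (-1)

open Classical in
/-- The coefficient of a `2` that is flipped. -/
noncomputable def flipW {N : ℕ} (m : ℕ) (β : Str N) (i : Fin N) : Coef :=
  if IsUnpaired2 β i then rankW m (rank β i) else T (-1)

/-- The letter at position `i` is a `2` of `β` and a `1` of `α`. -/
def IsDown {N : ℕ} (α β : Str N) (i : Fin N) : Prop := β i = two ∧ α i = one

instance {N : ℕ} (α β : Str N) : DecidablePred (IsDown α β) := fun _ => instDecidableAnd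

/-- The product of the coefficients of the `2`s that are flipped. -/
noncomputable def flipProd {N : ℕ} (m : ℕ) (α β : Str N) : Coef :=
  ∏ i : Fin N, if IsDown α β i then flipW m β i else 1

open Classical in
/-- The coefficient of `m_α` in the Kazhdan–Lusztig vector of `β`. -/
noncomputable def flipCoeff {N : ℕ} (m : ℕ) (α β : Str N) : Coef :=
  if IsFlip m α β then flipProd m α β else 0

open Classical in
/-- The exponent of the sign of `flipW`. -/
noncomputable def flipSign {N : ℕ} (m : ℕ) (β : Str N) (i : Fin N) : ℕ :=
  if IsUnpaired2 β i ∧ rank β i < m then rank β i else 0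

open Classical in
/-- The exponent of `t⁻¹` in `flipW`. -/
noncomputable def flipDeg {N : ℕ} (m : ℕ) (β : Str N) (i : Fin N) : ℕ :=
  (if ¬ IsUnpaired2 β i then 1 else 0) +
  (if IsUnpaired2 β i ∧ m ≤ rank β i ∧ Odd (rank β i - m) then 1 else 0) +
  (if IsUnpaired2 β i ∧ rank β i < m then m - rank β i else 0)

theorem flipW_eq {N : ℕ} (m : ℕ) (β : Str N) (i : Fin N) :
    flipW m β i = (-1) ^ flipSign m β i * T (-(flipDeg m β i : ℤ)) := by
  unfold flipW flipSign flipDeg rankW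
  by_cases h : IsUnpaired2 β i
  · by_cases h1 : rank β i < m
    · have h2 : ¬ m ≤ rank β i := by omega
      simp only [h, h1, h2, if_true, if_false, not_true, true_and, false_and]
      congr 2
      push_cast [h1.le]
      ring
    · have h2 : m ≤ rank β i := by omega
      by_cases h3 : Even (rank β i - m)
      · have h4 : ¬ Odd (rank β i - m) := by simpa using h3
        simp [h, h1, h3, h4]
      · have h4 : Odd (rank β i - m) := by simpa using h3
        simp [h, h1, h2, h3, h4]
  · simp [h]

/-- An unpaired `2` of rank less than `m` carries the single label `m - rank`, so a sum over labels
becomes a sum over positions. It serves for both `signExp` and `degExp`. -/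
theorem sum_mul_dLabel {N m : ℕ} {α β : Str N} (g : ℕ → ℕ) :
    ∑ p ∈ Finset.Icc 1 m, g p * dLabel m p α β =
      ∑ i : Fin N, if IsDown α β i then
        (open Classical in if IsUnpaired2 β i ∧ rank β i < m then g (m - rank β i) else 0) else 0 := by
  classical
  have h1 : ∀ p, g p * dLabel m p α β =
      ∑ i : Fin N, if HasLabel m β p i ∧ α i = one then g p else 0 := by
    intro p
    rw [dLabel, Finset.card_filter, Finset.mul_sum]
    refine Finset.sum_congr rfl fun i _ => ?_
    split_ifs <;> simp
  simp only [h1]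
  rw [Finset.sum_comm]
  refine Finset.sum_congr rfl fun i _ => ?_
  simp only [hasLabel_iff]
  by_cases hi : IsUnpaired2 β i ∧ rank β i < m
  · by_cases ha : α i = one
    · have hd : IsDown α β i := ⟨hi.1.1, ha⟩
      rw [Finset.sum_eq_single (m - rank β i)]
      · simp [hi, ha, hd]
      · intro p _ hp
        rw [if_neg]; tauto
      · intro hp
        exact absurd (Finset.mem_Icc.2 ⟨by omega, by omega⟩) hp
    · have hd : ¬ IsDown α β i := fun h => ha h.2
      rw [if_neg hd]
      exact Finset.sum_eq_zero fun p _ => if_neg (by tauto)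
  · rw [if_neg hi]
    simp only [ite_self]
    exact Finset.sum_eq_zero fun p _ => if_neg (by tauto)

theorem signExp_eq {N m : ℕ} {α β : Str N} :
    signExp m α β = ∑ i : Fin N, if IsDown α β i then flipSign m β i else 0 := by
  rw [signExp, sum_mul_dLabel fun p => m - p]
  refine Finset.sum_congr rfl fun i _ => ?_
  unfold flipSign
  split_ifs <;> omega

/-- Each flipped pair is counted at its left letter: a matched `2`, or an unpaired `2` of rank `r ≥
m` with `r - m` odd. The flip condition ensures that the partner has changed too. -/
theorem dPairs_eq {N m : ℕ} {α β : Str N} (h : IsFlip m α β) :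
    dPairs m α β = ∑ i : Fin N, if IsDown α β i then
      (open Classical in (if ¬ IsUnpaired2 β i then 1 else 0) +
      (if IsUnpaired2 β i ∧ m ≤ rank β i ∧ Odd (rank β i - m) then 1 else 0)) else 0 := by
  classical
  have h1 : (Finset.univ.filter fun q : Fin N × Fin N =>
      IsPair21 β q.1 q.2 ∧ α q.1 = one ∧ α q.2 = two).card =
      ∑ i : Fin N, if IsDown α β i ∧ ¬ IsUnpaired2 β i then 1 else 0 := by
    rw [← Finset.card_filter]
    refine Finset.card_bij (fun q _ => q.1) ?_ ?_ ?_
    · rintro q hq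
      rw [Finset.mem_filter] at hq ⊢
      exact ⟨Finset.mem_univ _, ⟨hq.2.1.2.1, hq.2.2.1⟩, hq.2.1.not_unpaired2⟩
    · rintro ⟨i, j⟩ hq ⟨i', j'⟩ hq' e
      rw [Finset.mem_filter] at hq hq'
      simp only at e hq hq'
      subst e
      rw [hq.2.1.right_unique hq'.2.1]
    · intro i hi
      rw [Finset.mem_filter] at hi
      obtain ⟨j, hj⟩ := exists_pair21_of_not_unpaired2 hi.2.1.1 hi.2.2
      refine ⟨(i, j), Finset.mem_filter.2 ⟨Finset.mem_univ _, hj, hi.2.1.2, ?_⟩, rfl⟩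
      have := h.pair21 i j hj
      rw [hi.2.1.2] at this
      simpa using this
  have h2 : (Finset.univ.filter fun q : Fin N × Fin N =>
      IsPair22 m β q.1 q.2 ∧ α q.1 = one ∧ α q.2 = one).card =
      ∑ i : Fin N, if IsDown α β i ∧
        (IsUnpaired2 β i ∧ m ≤ rank β i ∧ Odd (rank β i - m)) then 1 else 0 := by
    rw [← Finset.card_filter]
    refine Finset.card_bij (fun q _ => q.1) ?_ ?_ ?_
    · rintro q hq
      rw [Finset.mem_filter] at hq ⊢
      obtain ⟨-, hq, ha, hb⟩ := hq
      rw [isPair22_iff] at hq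
      refine ⟨Finset.mem_univ _, ⟨hq.1.1, ha⟩, hq.1, by omega, ?_⟩
      have := hq.2.2.2.2
      rw [Nat.even_iff] at this
      rw [Nat.odd_iff]
      omega
    · rintro ⟨i, j⟩ hq ⟨i', j'⟩ hq' e
      rw [Finset.mem_filter] at hq hq'
      simp only at e hq hq'
      subst e
      have h3 := isPair22_iff.1 hq.2.1
      have h4 := isPair22_iff.1 hq'.2.1
      rw [rank_injective h3.2.1 h4.2.1 (by omega)]
    · intro i hi
      rw [Finset.mem_filter] at hi
      obtain ⟨-, hd, hu, hm, ho⟩ := hi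
      rw [Nat.odd_iff] at ho
      obtain ⟨j, hj, hr⟩ := exists_rank_eq (β := β) (i := i) (by omega)
      have hp : IsPair22 m β i j :=
        isPair22_iff.2 ⟨hu, hj, hr, by omega, by rw [Nat.even_iff]; omega⟩
      refine ⟨(i, j), Finset.mem_filter.2 ⟨Finset.mem_univ _, hp, hd.2, ?_⟩, rfl⟩
      have := h.pair22 i j hp
      rw [hd.2] at this
      simpa using this
  rw [dPairs, h1, h2, ← Finset.sum_add_distrib]
  refine Finset.sum_congr rfl fun i _ => ?_
  by_cases hd : IsDown α β i
  · simp [hd]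
  · simp [hd]

theorem degExp_eq {N m : ℕ} {α β : Str N} (h : IsFlip m α β) :
    degExp m α β = ∑ i : Fin N, if IsDown α β i then flipDeg m β i else 0 := by
  rw [degExp, sum_mul_dLabel fun p => p, dPairs_eq h, ← Finset.sum_add_distrib]
  refine Finset.sum_congr rfl fun i _ => ?_
  unfold flipDeg
  by_cases hd : IsDown α β i
  · simp [hd]
  · simp [hd]

theorem T_sum {ι : Type*} (s : Finset ι) (g : ι → ℤ) :
    (T (∑ i ∈ s, g i) : Coef) = ∏ i ∈ s, T (g i) := by
  classical
  induction s using Finset.induction_on with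
  | empty => simp
  | insert a s ha ih => rw [Finset.sum_insert ha, Finset.prod_insert ha, T_add, ih]

theorem flipProd_eq {N m : ℕ} {α β : Str N} (h : IsFlip m α β) :
    flipProd m α β = (-1) ^ signExp m α β * T (-(degExp m α β : ℤ)) := by
  rw [signExp_eq, degExp_eq h, ← Finset.prod_pow_eq_pow_sum, Nat.cast_sum,
    ← Finset.sum_neg_distrib, T_sum, ← Finset.prod_mul_distrib, flipProd]
  refine Finset.prod_congr rfl fun i _ => ?_
  by_cases hd : IsDown α β i
  · simp only [hd, if_true]; exact flipW_eq m β i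
  · simp [hd]

theorem isFlip_self {N : ℕ} (m : ℕ) (β : Str N) : IsFlip m β β where
  le := pathLE_refl β
  pair21 _ _ h := Or.inl ⟨h.2.1, h.2.2.1⟩
  pair22 _ _ h := by
    rw [isPair22_iff] at h
    exact Or.inl ⟨h.1.1, h.2.1.1⟩
  other _ _ _ _ := rfl

/-- A letter can change only within a flipped pair or as a labelled `2`, and either contributes at
least one. This puts the off-diagonal coefficients in the span of negative powers of `t`. -/
theorem IsFlip.degExp_pos {N m : ℕ} {α β : Str N} (h : IsFlip m α β) (hne : α ≠ β) :
    0 < degExp m α β := by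
  classical
  obtain ⟨k, hk⟩ := Function.ne_iff.1 hne
  have pos21 : ∀ i j, IsPair21 β i j → α i = one → 0 < degExp m α β := by
    intro i j hij hi
    have hj := h.pair21 i j hij
    rw [hi] at hj
    have : 0 < dPairs m α β := Nat.add_pos_left (Finset.card_pos.2 ⟨(i, j), by
      simpa [hij, hi] using hj⟩) _
    exact Nat.add_pos_left this _
  have pos22 : ∀ i j, IsPair22 m β i j → α i = one → α j = one → 0 < degExp m α β := by
    intro i j hij hi hj
    have : 0 < dPairs m α β := Nat.add_pos_right _ (Finset.card_pos.2 ⟨(i, j), by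
      simp [hij, hi, hj]⟩)
    exact Nat.add_pos_left this _
  by_cases hu : IsUnpaired β k
  · by_cases hl : ∃ p, HasLabel m β p k
    · obtain ⟨p, hp⟩ := hl
      have hp' := hasLabel_iff.1 hp
      have ha : α k = one := by
        have := hp'.1.1
        rw [this] at hk
        simpa using hk
      refine Nat.add_pos_right _ (lt_of_lt_of_le ?_ (Finset.single_le_sum
        (f := fun p => p * dLabel m p α β) (fun _ _ => Nat.zero_le _)
        (Finset.mem_Icc.2 (⟨by omega, by omega⟩ : 1 ≤ p ∧ p ≤ m))))
      exact Nat.mul_pos (by omega) (Finset.card_pos.2 ⟨k, by simp [hp, ha]⟩)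
    · push Not at hl
      by_cases h22 : ∃ j, IsPair22 m β k j ∨ IsPair22 m β j k
      · obtain ⟨j, hj | hj⟩ := h22
        · have hb := (isPair22_iff.1 hj).1.1
          rcases h.pair22 _ _ hj with h1 | h1
          · exact absurd (h1.1.trans hb.symm) hk
          · exact pos22 _ _ hj h1.1 h1.2
        · have hb := (isPair22_iff.1 hj).2.1.1
          rcases h.pair22 _ _ hj with h1 | h1
          · exact absurd (h1.2.trans hb.symm) hk
          · exact pos22 _ _ hj h1.1 h1.2
      · push Not at h22
        exact absurd (h.other k hu hl fun j => h22 j) hk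
  · unfold IsUnpaired at hu
    push Not at hu
    obtain ⟨j, hj⟩ := hu
    by_cases hkj : IsPair21 β k j
    · rcases h.pair21 _ _ hkj with h1 | h1
      · exact absurd (h1.1.trans hkj.2.1.symm) hk
      · exact pos21 _ _ hkj h1.1
    · have hjk := hj hkj
      rcases h.pair21 _ _ hjk with h1 | h1
      · exact absurd (h1.2.trans hjk.2.2.1.symm) hk
      · exact pos21 _ _ hjk h1.1

theorem flipCoeff_self {N : ℕ} (m : ℕ) (β : Str N) : flipCoeff m β β = 1 := by
  rw [flipCoeff, if_pos (isFlip_self m β), flipProd]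
  refine Finset.prod_eq_one fun i _ => if_neg ?_
  rintro ⟨h1, h2⟩
  rw [h1] at h2
  simp at h2

theorem flipCoeff_mem {N m : ℕ} {α β : Str N} (hne : α ≠ β) : flipCoeff m α β ∈ ZGammaNeg := by
  rw [flipCoeff]
  split_ifs with h
  · rw [flipProd_eq h]
    have : (T (-(degExp m α β : ℤ)) : Coef) ∈ ZGammaNeg :=
      AddSubgroup.subset_closure ⟨_, h.degExp_pos hne, rfl⟩
    rcases neg_one_pow_eq_or Coef (signExp m α β) with e | e
    · rw [e, one_mul]; exact this
    · rw [e, neg_one_mul]; exact neg_mem this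
  · exact zero_mem _

/-! ### Insertion of a `21` pair -/

section insertion

variable {N K : ℕ}

/-- The position, after an insertion at `i`, of the letter at position `k`. -/
def skip (i : ℕ) (hK : K = N + 2) (k : Fin N) : Fin K :=
  ⟨if (k : ℕ) < i then k else k + 2, by split_ifs <;> omega⟩

theorem skip_val (i : ℕ) (hK : K = N + 2) (k : Fin N) :
    (skip i hK k : ℕ) = if (k : ℕ) < i then (k : ℕ) else k + 2 := rfl

theorem skip_lt_skip {i : ℕ} {hK : K = N + 2} {k l : Fin N} :
    skip i hK k < skip i hK l ↔ k < l := by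
  rw [Fin.lt_def, Fin.lt_def, skip_val, skip_val]
  split_ifs <;> omega

theorem skip_injective (i : ℕ) (hK : K = N + 2) : Function.Injective (skip i hK) := by
  intro k l h
  have := congrArg Fin.val h
  rw [skip_val, skip_val] at this
  apply Fin.ext
  split_ifs at this <;> omega

theorem insertTwo_skip {i : ℕ} (hK : K = N + 2) (α : Str N) (a b : Bool) (k : Fin N) :
    (insertTwo i α a b : Str K) (skip i hK k) = α k := by
  have h := skip_val i hK k
  rw [insertTwo, h]
  split_ifs <;> first | omega | simp [letter_val]

/-- The position of the first inserted letter. -/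
def insFst (i : ℕ) (hK : K = N + 2) (hi : i ≤ N) : Fin K := ⟨i, by omega⟩

/-- The position of the second inserted letter. -/
def insSnd (i : ℕ) (hK : K = N + 2) (hi : i ≤ N) : Fin K := ⟨i + 1, by omega⟩

theorem eq_insFst_or {i : ℕ} (hK : K = N + 2) (hi : i ≤ N) (k : Fin K) :
    k = insFst i hK hi ∨ k = insSnd i hK hi ∨ ∃ l, k = skip i hK l := by
  have hk := k.2
  rcases lt_or_ge (k : ℕ) i with h | h
  · refine Or.inr (Or.inr ⟨⟨k, by omega⟩, Fin.ext ?_⟩)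
    rw [skip_val, if_pos h]
  · by_cases h1 : (k : ℕ) = i
    · exact Or.inl (Fin.ext h1)
    · by_cases h2 : (k : ℕ) = i + 1
      · exact Or.inr (Or.inl (Fin.ext h2))
      · refine Or.inr (Or.inr ⟨⟨k - 2, by omega⟩, Fin.ext ?_⟩)
        rw [skip_val, if_neg (by simp only; omega)]
        simp only
        omega

theorem insertTwo_insFst {i : ℕ} (hK : K = N + 2) (hi : i ≤ N) (α : Str N) (a b : Bool) :
    (insertTwo i α a b : Str K) (insFst i hK hi) = a := by simp [insertTwo, insFst]

theorem insertTwo_insSnd {i : ℕ} (hK : K = N + 2) (hi : i ≤ N) (α : Str N) (a b : Bool) :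
    (insertTwo i α a b : Str K) (insSnd i hK hi) = b := by simp [insertTwo, insSnd]

theorem univ_eq_insert {i : ℕ} (hK : K = N + 2) (hi : i ≤ N) :
    (Finset.univ : Finset (Fin K)) = insert (insFst i hK hi) (insert (insSnd i hK hi)
      (Finset.univ.map ⟨skip i hK, skip_injective i hK⟩)) := by
  ext k
  simp only [Finset.mem_univ, Finset.mem_insert, Finset.mem_map, true_and, true_iff,
    Function.Embedding.coeFn_mk]
  rcases eq_insFst_or hK hi k with h | h | ⟨l, h⟩
  · exact Or.inl h
  · exact Or.inr (Or.inl h)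
  · exact Or.inr (Or.inr ⟨l, h.symm⟩)

theorem skip_ne {i : ℕ} (hK : K = N + 2) (hi : i ≤ N) (k : Fin N) :
    skip i hK k ≠ insFst i hK hi ∧ skip i hK k ≠ insSnd i hK hi := by
  constructor <;> intro h <;> have := congrArg Fin.val h <;>
    simp only [skip_val, insFst, insSnd] at this <;> split_ifs at this <;> omega

theorem prod_insertion {M : Type*} [CommMonoid M] {i : ℕ} (hK : K = N + 2) (hi : i ≤ N)
    (f : Fin K → M) :
    ∏ k, f k = f (insFst i hK hi) * (f (insSnd i hK hi) * ∏ k : Fin N, f (skip i hK k)) := by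
  rw [univ_eq_insert hK hi, Finset.prod_insert, Finset.prod_insert, Finset.prod_map]
  · rfl
  · simp only [Finset.mem_map, Finset.mem_univ, true_and, not_exists, Function.Embedding.coeFn_mk]
    exact fun k => (skip_ne hK hi k).2
  · simp only [Finset.mem_insert, Finset.mem_map, Finset.mem_univ, true_and, not_or, not_exists,
      Function.Embedding.coeFn_mk]
    exact ⟨by simp [insFst, insSnd], fun k => (skip_ne hK hi k).1⟩

theorem height_insertTwo {i : ℕ} (hK : K = N + 2) (hi : i ≤ N) (α : Str N) (a b : Bool) {x : ℕ}
    (hx : x ≤ K) : height (insertTwo i α a b : Str K) x = if x ≤ i then height α x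
      else if x = i + 1 then height α i + sgn a else height α (x - 2) + sgn a + sgn b := by
  induction x with
  | zero => simp [height_zero]
  | succ x ih =>
    rw [height_succ _ (by omega), ih (by omega), letter_insertTwo _ _ _ _ (by omega)]
    rcases lt_trichotomy x i with h | h | h
    · rw [if_pos (by omega), if_pos h, if_pos (by omega), height_succ _ (by omega)]
    · subst h
      simp
    · by_cases h1 : x = i + 1
      · subst h1; simp
      · simp only [show ¬ x ≤ i by omega, show ¬ x < i by omega, show ¬ x = i by omega, h1,
          show ¬ x + 1 ≤ i by omega, show ¬ x + 1 = i + 1 by omega, if_false]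
        rw [show x + 1 - 2 = x - 2 + 1 by omega, height_succ _ (by omega)]
        ring

theorem height_insertTwo_skip {i : ℕ} (hK : K = N + 2) (hi : i ≤ N) (β : Str N) (k : Fin N) :
    height (insertTwo i β two one : Str K) (skip i hK k) = height β k := by
  rw [height_insertTwo hK hi _ _ _ (by have := (skip i hK k).2; omega), skip_val]
  split_ifs <;> first | rfl | omega | simp [sgn]

theorem height_insertTwo_skip_succ {i : ℕ} (hK : K = N + 2) (hi : i ≤ N) (β : Str N)
    (k : Fin N) : height (insertTwo i β two one : Str K) (skip i hK k + 1) =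
      height β (k + 1) := by
  rw [height_insertTwo hK hi _ _ _ (by have := (skip i hK k).2; omega), skip_val]
  split_ifs <;> first | rfl | omega | simp [sgn]

/-- An inserted `21` is a peak: the only new height lies strictly above its neighbours, so no first
return is created or destroyed. -/
theorem isPair21_insertTwo_skip {i : ℕ} (hK : K = N + 2) (hi : i ≤ N) {β : Str N} {j k : Fin N} :
    IsPair21 (insertTwo i β two one : Str K) (skip i hK j) (skip i hK k) ↔ IsPair21 β j k := by
  unfold IsPair21
  rw [skip_lt_skip, insertTwo_skip, insertTwo_skip, height_insertTwo_skip_succ hK hi,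
    height_insertTwo_skip hK hi]
  refine and_congr_right fun h1 => and_congr_right fun _ => and_congr_right fun _ =>
    and_congr_right fun _ => ?_
  rw [Fin.lt_def] at h1
  have hk := k.2
  constructor
  · intro h y hy hyk
    by_cases hyi : y ≤ i
    · have := h y (by rw [skip_val, if_pos (by omega)]; exact hy)
        (by rw [skip_val]; split_ifs <;> omega)
      rwa [height_insertTwo hK hi _ _ _ (by omega), if_pos hyi] at this
    · have := h (y + 2) (by rw [skip_val]; split_ifs <;> omega)
        (by rw [skip_val, if_neg (by omega)]; omega)
      rw [height_insertTwo hK hi _ _ _ (by omega), if_neg (by omega), if_neg (by omega)] at this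
      simpa [sgn] using this
  · intro h x hx hxk
    have hxK : x ≤ K := by have := (skip i hK k).2; omega
    rw [height_insertTwo hK hi _ _ _ hxK]
    rw [skip_val] at hx hxk
    by_cases hxi : x ≤ i
    · rw [if_pos hxi]
      rw [if_pos (by by_contra hcon; rw [if_neg hcon] at hx; omega)] at hx
      refine h x hx ?_
      split_ifs at hxk <;> omega
    · rw [if_neg hxi]
      by_cases hx1 : x = i + 1
      · rw [if_pos hx1]
        have hji : (j : ℕ) < i := by by_contra hcon; rw [if_neg hcon] at hx; omega
        have hik : i ≤ (k : ℕ) := by by_contra hcon; rw [if_pos (by omega)] at hxk; omega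
        have := h i hji hik
        simp only [sgn, if_true]
        omega
      · rw [if_neg hx1]
        have hik : i ≤ (k : ℕ) := by by_contra hcon; rw [if_pos (by omega)] at hxk; omega
        rw [if_neg (by omega)] at hxk
        have := h (x - 2) (by split_ifs at hx <;> omega) (by omega)
        simpa [sgn] using this

theorem isPair21_insertTwo_self {i : ℕ} (hK : K = N + 2) (hi : i ≤ N) (β : Str N) :
    IsPair21 (insertTwo i β two one : Str K) (insFst i hK hi) (insSnd i hK hi) := by
  refine ⟨by simp [insFst, insSnd, Fin.lt_def], insertTwo_insFst hK hi _ _ _,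
    insertTwo_insSnd hK hi _ _ _, ?_, ?_⟩
  · change height _ (i + 1 + 1) = height _ i
    rw [height_insertTwo hK hi _ _ _ (by omega), height_insertTwo hK hi _ _ _ (by omega)]
    simp [sgn]
  · intro k hk hk'
    change i < k at hk
    change k ≤ i + 1 at hk'
    obtain rfl : k = i + 1 := by omega
    change height _ i < height _ (i + 1)
    rw [height_insertTwo hK hi _ _ _ (by omega), height_insertTwo hK hi _ _ _ (by omega)]
    simp [sgn]

theorem isPair21_insertTwo_iff {i : ℕ} (hK : K = N + 2) (hi : i ≤ N) {β : Str N} {x y : Fin K} :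
    IsPair21 (insertTwo i β two one : Str K) x y ↔
      (x = insFst i hK hi ∧ y = insSnd i hK hi) ∨
      ∃ j k, x = skip i hK j ∧ y = skip i hK k ∧ IsPair21 β j k := by
  have hself := isPair21_insertTwo_self hK hi β
  constructor
  · intro h
    rcases eq_insFst_or hK hi x with rfl | rfl | ⟨j, rfl⟩
    · exact Or.inl ⟨rfl, hself.right_unique h |>.symm⟩
    · have := h.2.1
      rw [insertTwo_insSnd] at this
      simp at this
    · rcases eq_insFst_or hK hi y with rfl | rfl | ⟨k, rfl⟩
      · have := h.2.2.1
        rw [insertTwo_insFst] at this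
        simp at this
      · exact absurd (hself.left_unique h).symm (skip_ne hK hi j).1
      · exact Or.inr ⟨j, k, rfl, rfl, (isPair21_insertTwo_skip hK hi).1 h⟩
  · rintro (⟨rfl, rfl⟩ | ⟨j, k, rfl, rfl, h⟩)
    · exact hself
    · exact (isPair21_insertTwo_skip hK hi).2 h

theorem isUnpaired_insertTwo_skip {i : ℕ} (hK : K = N + 2) (hi : i ≤ N) {β : Str N} {k : Fin N} :
    IsUnpaired (insertTwo i β two one : Str K) (skip i hK k) ↔ IsUnpaired β k := by
  unfold IsUnpaired
  constructor
  · intro h j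
    have := h (skip i hK j)
    rwa [isPair21_insertTwo_skip hK hi, isPair21_insertTwo_skip hK hi] at this
  · intro h y
    rw [isPair21_insertTwo_iff hK hi, isPair21_insertTwo_iff hK hi]
    constructor
    · rintro (⟨h1, -⟩ | ⟨j, l, h1, rfl, h2⟩)
      · exact (skip_ne hK hi k).1 h1
      · rw [skip_injective i hK h1] at h
        exact (h l).1 h2
    · rintro (⟨-, h1⟩ | ⟨j, l, rfl, h1, h2⟩)
      · exact (skip_ne hK hi k).2 h1
      · rw [skip_injective i hK h1] at h
        exact (h j).2 h2

theorem isUnpaired2_insertTwo_skip {i : ℕ} (hK : K = N + 2) (hi : i ≤ N) {β : Str N}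
    {k : Fin N} :
    IsUnpaired2 (insertTwo i β two one : Str K) (skip i hK k) ↔ IsUnpaired2 β k := by
  unfold IsUnpaired2
  rw [insertTwo_skip, isUnpaired_insertTwo_skip hK hi]

theorem not_isUnpaired_insFst {i : ℕ} (hK : K = N + 2) (hi : i ≤ N) (β : Str N) :
    ¬ IsUnpaired (insertTwo i β two one : Str K) (insFst i hK hi) :=
  fun h => (h _).1 (isPair21_insertTwo_self hK hi β)

theorem not_isUnpaired_insSnd {i : ℕ} (hK : K = N + 2) (hi : i ≤ N) (β : Str N) :
    ¬ IsUnpaired (insertTwo i β two one : Str K) (insSnd i hK hi) :=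
  fun h => (h _).2 (isPair21_insertTwo_self hK hi β)

theorem rank_insertTwo_skip {i : ℕ} (hK : K = N + 2) (hi : i ≤ N) (β : Str N) (k : Fin N) :
    rank (insertTwo i β two one : Str K) (skip i hK k) = rank β k := by
  classical
  rw [rank, rank, rankFrom, rankFrom, ← Finset.card_map ⟨skip i hK, skip_injective i hK⟩]
  congr 1
  ext x
  simp only [Finset.mem_filter, Finset.mem_univ, true_and, Finset.mem_map,
    Function.Embedding.coeFn_mk]
  constructor
  · rintro ⟨h1, h2⟩
    rcases eq_insFst_or hK hi x with rfl | rfl | ⟨j, rfl⟩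
    · exact absurd h2.2 (not_isUnpaired_insFst hK hi β)
    · exact absurd h2.2 (not_isUnpaired_insSnd hK hi β)
    · have : skip i hK k < skip i hK j := h1
      rw [skip_lt_skip] at this
      exact ⟨j, ⟨this, (isUnpaired2_insertTwo_skip hK hi).1 h2⟩, rfl⟩
  · rintro ⟨j, ⟨h1, h2⟩, rfl⟩
    have : skip i hK k < skip i hK j := skip_lt_skip.2 h1
    exact ⟨this, (isUnpaired2_insertTwo_skip hK hi).2 h2⟩

theorem hasLabel_insertTwo_skip {i m p : ℕ} (hK : K = N + 2) (hi : i ≤ N) {β : Str N}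
    {k : Fin N} :
    HasLabel m (insertTwo i β two one : Str K) p (skip i hK k) ↔ HasLabel m β p k := by
  rw [hasLabel_iff, hasLabel_iff, isUnpaired2_insertTwo_skip hK hi, rank_insertTwo_skip hK hi]

theorem isPair22_insertTwo_skip {i m : ℕ} (hK : K = N + 2) (hi : i ≤ N) {β : Str N}
    {j k : Fin N} :
    IsPair22 m (insertTwo i β two one : Str K) (skip i hK j) (skip i hK k) ↔
      IsPair22 m β j k := by
  rw [isPair22_iff, isPair22_iff, isUnpaired2_insertTwo_skip hK hi,
    isUnpaired2_insertTwo_skip hK hi, rank_insertTwo_skip hK hi, rank_insertTwo_skip hK hi]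

theorem exists_skip_of_isUnpaired {i : ℕ} (hK : K = N + 2) (hi : i ≤ N) {β : Str N} {x : Fin K}
    (h : IsUnpaired (insertTwo i β two one : Str K) x) : ∃ k, x = skip i hK k := by
  rcases eq_insFst_or hK hi x with rfl | rfl | hj
  · exact absurd h (not_isUnpaired_insFst hK hi β)
  · exact absurd h (not_isUnpaired_insSnd hK hi β)
  · exact hj

theorem pathLE_insertTwo {i : ℕ} (hK : K = N + 2) (hi : i ≤ N) {α β : Str N} {a b : Bool}
    (hab : a ≠ b) :
    pathLE (insertTwo i α a b : Str K) (insertTwo i β two one) ↔ pathLE α β := by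
  have hs : sgn a + sgn b = 0 := by cases a <;> cases b <;> simp_all [sgn]
  have hs' : sgn two + sgn one = 0 := by simp [sgn]
  have hle : sgn a ≤ sgn two := by cases a <;> simp [sgn]
  constructor
  · intro h x hx
    by_cases hxi : x ≤ i
    · have := h x (by omega)
      rwa [height_insertTwo hK hi _ _ _ (by omega), height_insertTwo hK hi _ _ _ (by omega),
        if_pos hxi, if_pos hxi] at this
    · have := h (x + 2) (by omega)
      rw [height_insertTwo hK hi _ _ _ (by omega), height_insertTwo hK hi _ _ _ (by omega),
        if_neg (by omega), if_neg (by omega), if_neg (by omega), if_neg (by omega),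
        Nat.add_sub_cancel] at this
      omega
  · intro h x hx
    rw [height_insertTwo hK hi _ _ _ hx, height_insertTwo hK hi _ _ _ hx]
    split_ifs with h1 h2
    · exact h x (by omega)
    · have := h i hi; omega
    · have := h (x - 2) (by omega); omega

theorem isFlip_insertTwo {i m : ℕ} (hK : K = N + 2) (hi : i ≤ N) {α β : Str N} {a b : Bool} :
    IsFlip m (insertTwo i α a b : Str K) (insertTwo i β two one) ↔ a ≠ b ∧ IsFlip m α β := by
  constructor
  · intro h
    have hab : a ≠ b := by
      have := h.pair21 _ _ (isPair21_insertTwo_self hK hi β)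
      rw [insertTwo_insFst, insertTwo_insSnd] at this
      rintro rfl
      rcases this with ⟨h1, h2⟩ | ⟨h1, h2⟩ <;> rw [h1] at h2 <;> simp at h2
    refine ⟨hab, ⟨(pathLE_insertTwo hK hi hab).1 h.le, ?_, ?_, ?_⟩⟩
    · intro j k hjk
      have := h.pair21 _ _ ((isPair21_insertTwo_skip hK hi).2 hjk)
      rwa [insertTwo_skip, insertTwo_skip] at this
    · intro j k hjk
      have := h.pair22 _ _ ((isPair22_insertTwo_skip hK hi).2 hjk)
      rwa [insertTwo_skip, insertTwo_skip] at this
    · intro k hk hl h22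
      have := h.other (skip i hK k) ((isUnpaired_insertTwo_skip hK hi).2 hk)
        (fun p => by rw [hasLabel_insertTwo_skip hK hi]; exact hl p) (fun y => by
          constructor
          · intro hy
            obtain ⟨l, rfl⟩ := exists_skip_of_isUnpaired hK hi (isPair22_iff.1 hy).2.1.2
            exact (h22 l).1 ((isPair22_insertTwo_skip hK hi).1 hy)
          · intro hy
            obtain ⟨l, rfl⟩ := exists_skip_of_isUnpaired hK hi (isPair22_iff.1 hy).1.2
            exact (h22 l).2 ((isPair22_insertTwo_skip hK hi).1 hy))
      rwa [insertTwo_skip, insertTwo_skip] at this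
  · rintro ⟨hab, h⟩
    refine ⟨(pathLE_insertTwo hK hi hab).2 h.le, ?_, ?_, ?_⟩
    · intro x y hxy
      rcases (isPair21_insertTwo_iff hK hi).1 hxy with ⟨rfl, rfl⟩ | ⟨j, k, rfl, rfl, hjk⟩
      · rw [insertTwo_insFst, insertTwo_insSnd]
        cases a <;> cases b <;> simp_all
      · rw [insertTwo_skip, insertTwo_skip]; exact h.pair21 j k hjk
    · intro x y hxy
      obtain ⟨j, rfl⟩ := exists_skip_of_isUnpaired hK hi (isPair22_iff.1 hxy).1.2
      obtain ⟨k, rfl⟩ := exists_skip_of_isUnpaired hK hi (isPair22_iff.1 hxy).2.1.2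
      rw [insertTwo_skip, insertTwo_skip]
      exact h.pair22 j k ((isPair22_insertTwo_skip hK hi).1 hxy)
    · intro x hx hl h22
      obtain ⟨k, rfl⟩ := exists_skip_of_isUnpaired hK hi hx
      rw [insertTwo_skip, insertTwo_skip]
      refine h.other k ((isUnpaired_insertTwo_skip hK hi).1 hx)
        (fun p hp => hl p ((hasLabel_insertTwo_skip hK hi).2 hp)) fun j => ?_
      exact ⟨fun hj => (h22 _).1 ((isPair22_insertTwo_skip hK hi).2 hj),
        fun hj => (h22 _).2 ((isPair22_insertTwo_skip hK hi).2 hj)⟩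

theorem flipProd_insertTwo {i m : ℕ} (hK : K = N + 2) (hi : i ≤ N) (α β : Str N) (a b : Bool) :
    flipProd m (insertTwo i α a b : Str K) (insertTwo i β two one) =
      (if a = one then T (-1) else 1) * flipProd m α β := by
  rw [flipProd, prod_insertion hK hi]
  have h1 : IsDown (insertTwo i α a b : Str K) (insertTwo i β two one) (insFst i hK hi) ↔
      a = one := by
    unfold IsDown
    rw [insertTwo_insFst, insertTwo_insFst]
    simp
  have h2 : ¬ IsDown (insertTwo i α a b : Str K) (insertTwo i β two one) (insSnd i hK hi) := by
    unfold IsDown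
    rw [insertTwo_insSnd]
    simp
  have h3 : flipW m (insertTwo i β two one : Str K) (insFst i hK hi) = T (-1) := by
    rw [flipW, if_neg fun h => not_isUnpaired_insFst hK hi β h.2]
  rw [if_neg h2, one_mul, h3]
  simp only [h1]
  congr 1
  refine Finset.prod_congr rfl fun k _ => ?_
  have h4 : IsDown (insertTwo i α a b : Str K) (insertTwo i β two one) (skip i hK k) ↔
      IsDown α β k := by
    unfold IsDown
    rw [insertTwo_skip, insertTwo_skip]
  have h5 : flipW m (insertTwo i β two one : Str K) (skip i hK k) = flipW m β k := by
    classical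
    unfold flipW
    rw [rank_insertTwo_skip hK hi]
    simp only [isUnpaired2_insertTwo_skip hK hi]
  simp only [h4, h5]

/-- The old letters keep their partners, ranks and hence weights, while the new pair must be kept
with weight `1` or flipped with weight `t⁻¹`. This is the induction step for the product form of the
Kazhdan–Lusztig vectors. -/
theorem flipCoeff_insertTwo {i m : ℕ} (hK : K = N + 2) (hi : i ≤ N) (β : Str N) :
    (fun γ : Str K => flipCoeff m γ (insertTwo i β two one)) =
      insertPair cupW i fun α => flipCoeff m α β := by
  classical
  funext γ
  obtain ⟨α, a, b, rfl⟩ := exists_eq_insertTwo i hK hi γ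
  rw [insertPair_insertTwo _ _ hK hi, flipCoeff, flipCoeff, isFlip_insertTwo hK hi,
    flipProd_insertTwo hK hi]
  by_cases h : IsFlip m α β
  · cases a <;> cases b <;> simp [h, cupW]
  · simp [h]

end insertion

/-! ### The strings `1…12…2` -/

/-- The string of length `N` with `a` letters `1` followed by letters `2`. -/
def monoStr (N a : ℕ) : Str N := fun k => decide (a ≤ (k : ℕ))

theorem monoStr_eq_two {N a : ℕ} {k : Fin N} : monoStr N a k = two ↔ a ≤ (k : ℕ) := by
  simp [monoStr]

theorem not_isPair21_monoStr {N a : ℕ} {i j : Fin N} : ¬ IsPair21 (monoStr N a) i j := by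
  intro h
  have h1 := monoStr_eq_two.1 h.2.1
  have h2 := h.1
  rw [Fin.lt_def] at h2
  have h3 : monoStr N a j = two := monoStr_eq_two.2 (by omega)
  rw [h.2.2.1] at h3
  simp at h3

theorem isUnpaired_monoStr {N a : ℕ} (i : Fin N) : IsUnpaired (monoStr N a) i :=
  fun _ => ⟨not_isPair21_monoStr, not_isPair21_monoStr⟩

theorem isUnpaired2_monoStr {N a : ℕ} {i : Fin N} :
    IsUnpaired2 (monoStr N a) i ↔ a ≤ (i : ℕ) :=
  ⟨fun h => monoStr_eq_two.1 h.1, fun h => ⟨monoStr_eq_two.2 h, isUnpaired_monoStr i⟩⟩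

theorem rank_monoStr {N a : ℕ} {i : Fin N} (h : a ≤ (i : ℕ)) :
    rank (monoStr N a) i = N - 1 - i := by
  classical
  rw [rank, rankFrom, ← Fin.card_Ioi]
  congr 1
  ext k
  simp only [Finset.mem_filter, Finset.mem_univ, true_and, Finset.mem_Ioi, Fin.lt_def,
    isUnpaired2_monoStr]
  omega

/-- A string without an adjacent `21` is weakly increasing. This yields the induction on `N` in
`lat_flipBasis`. -/
theorem exists_insertTwo_or_monoStr {N : ℕ} (β : Str N) :
    (∃ (n i : ℕ) (β' : Str n), N = n + 2 ∧ i ≤ n ∧ β = insertTwo i β' two one) ∨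
      ∃ a ≤ N, β = monoStr N a := by
  classical
  by_cases h : ∃ i, i + 1 < N ∧ letter β i = two ∧ letter β (i + 1) = one
  · obtain ⟨i, hi, h1, h2⟩ := h
    left
    obtain ⟨n, hn⟩ : ∃ n, N = n + 2 := ⟨N - 2, by omega⟩
    refine ⟨n, i, deleteTwo i β, hn, by omega, ?_⟩
    rw [← h1, ← h2, insertTwo_deleteTwo i hn (by omega)]
  · right
    push Not at h
    -- The least such `a` is the position of the first `2`, or `N` if there is none.
    have hex : ∃ a, N ≤ a ∨ letter β a = two := ⟨N, Or.inl le_rfl⟩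
    set a := Nat.find hex with ha
    refine ⟨a, Nat.find_min' hex (Or.inl le_rfl), ?_⟩
    apply Str.ext_letter
    intro k hk
    have hm : letter (monoStr N a) k = decide (a ≤ k) := letter_mk (fun k => decide (a ≤ k)) hk
    rw [hm]
    by_cases hak : a ≤ k
    · have : ∀ k, a ≤ k → k < N → letter β k = two := by
        intro k hak
        induction k, hak using Nat.le_induction with
        | base =>
          intro haN
          rcases Nat.find_spec hex with h1 | h1
          · omega
          · exact h1
        | succ k hak ih =>
          intro hkN
          simpa using h k hkN (ih (by omega))
      rw [this k hak hk]
      simp [hak]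
    · have := Nat.find_min hex (not_le.1 hak)
      push Not at this
      simpa [hak] using this.2

/-! ### Product formula for the base vectors -/

/-- The coefficient of a flipped `2` at distance `r` from the end of `1…12…2`. -/
noncomputable def baseW (m p r : ℕ) : Coef :=
  if r < p then (-1) ^ (m + p + r) * T ((r : ℤ) - p) else if Even (r - p) then 1 else T (-1)

/-- The letters that occur in the vector `baseVec m p a N`. -/
def BaseCond {N : ℕ} (p a : ℕ) (α : Str N) : Prop :=
  (∀ k < a, letter α k = one) ∧
    ∀ k < N, a ≤ k → p ≤ N - 1 - k → Even (N - 1 - k - p) →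
      if k = a then letter α k = two else letter α (k - 1) = letter α k

open Classical in
/-- The Kazhdan–Lusztig vector of `1…12…2`, for the largest label `p`. -/
noncomputable def baseVec (m p a N : ℕ) : Vec N := fun α =>
  if BaseCond p a α then
    ∏ k ∈ Finset.range N, if a ≤ k ∧ letter α k = one then baseW m p (N - 1 - k) else 1
  else 0

theorem baseVec_self (m p N : ℕ) : baseVec m p N N = onesVec N := by
  classical
  funext α
  rw [baseVec, onesVec]
  have : BaseCond p N α ↔ ∀ k < N, letter α k = one :=
    ⟨fun h => h.1, fun h => ⟨h, fun k hk hk' => by omega⟩⟩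
  rw [Finset.prod_eq_one fun k hk => if_neg (by rw [Finset.mem_range] at hk; omega)]
  simp only [this]

theorem letter_snoc_of_lt {N K : ℕ} (hK : K = N + 1) (α : Str N) (d : Bool) {k : ℕ} (hk : k < N) :
    letter (snoc α d : Str K) k = letter α k := by
  rw [letter_snoc _ _ (by omega), if_pos hk]

theorem baseCond_snoc {N K p a : ℕ} (hK : K = N + 1) (ha : a ≤ N) (α : Str N) (d : Bool) :
    BaseCond (p + 1) a (snoc α d : Str K) ↔ BaseCond p a α := by
  subst hK
  unfold BaseCond
  refine and_congr (forall₂_congr fun k hk => ?_) ?_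
  · rw [letter_snoc_of_lt rfl _ _ (by omega)]
  · constructor
    · intro h k hk hak hp he
      have := h k (by omega) hak (by omega)
        (by rwa [show N + 1 - 1 - k - (p + 1) = N - 1 - k - p by omega])
      rwa [letter_snoc_of_lt rfl _ _ hk, letter_snoc_of_lt rfl _ _ (by omega)] at this
    · intro h k hk hak hp he
      have := h k (by omega) hak (by omega)
        (by rwa [show N - 1 - k - p = N + 1 - 1 - k - (p + 1) by omega])
      rwa [letter_snoc_of_lt rfl _ _ (by omega), letter_snoc_of_lt rfl _ _ (by omega)]

/-- Removing the last letter lowers the largest label and the distance to the end together; the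
exponent of the sign changes by two. -/
theorem baseW_succ (m p r : ℕ) : baseW m (p + 1) (r + 1) = baseW m p r := by
  unfold baseW
  have h1 : ((-1 : Coef) ^ (m + (p + 1) + (r + 1))) = (-1) ^ (m + p + r) := by
    rw [show m + (p + 1) + (r + 1) = m + p + r + 2 by ring, pow_add]; simp
  have h2 : ((r + 1 : ℕ) : ℤ) - ((p + 1 : ℕ) : ℤ) = (r : ℤ) - p := by push_cast; ring
  rw [h1, h2, Nat.add_sub_add_right]
  simp only [Nat.add_lt_add_iff_right]

theorem baseVec_succ {m p a N K : ℕ} (hK : K = N + 1) (ha : a ≤ N) :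
    baseVec m (p + 1) a K = append (labelW m (p + 1)) (baseVec m p a N) := by
  classical
  funext γ
  obtain ⟨α, d, rfl⟩ := exists_eq_snoc hK γ
  rw [append_snoc _ hK, baseVec, baseVec]
  simp only [baseCond_snoc hK ha]
  by_cases h : BaseCond p a α
  · rw [if_pos h, if_pos h, hK, Finset.prod_range_succ]
    congr 1
    · refine Finset.prod_congr rfl fun k hk => ?_
      rw [Finset.mem_range] at hk
      rw [← hK, letter_snoc_of_lt hK _ _ hk, hK, show N + 1 - 1 - k = N - 1 - k + 1 by omega,
        baseW_succ]
    · rw [← hK, letter_snoc_last hK, hK]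
      cases d
      · simp [ha, baseW, labelW]
      · simp [labelW]
  · rw [if_neg h, if_neg h, zero_mul]

theorem baseVec_zero_one {m a K : ℕ} (hK : K = a + 1) :
    baseVec m 0 a K = append twoW (onesVec a) := by
  classical
  funext γ
  obtain ⟨α, d, rfl⟩ := exists_eq_snoc hK γ
  rw [append_snoc _ hK, baseVec, onesVec]
  have hc : BaseCond 0 a (snoc α d : Str K) ↔ (∀ k < a, letter α k = one) ∧ d = two := by
    unfold BaseCond
    refine and_congr (forall₂_congr fun k hk => ?_) ?_
    · rw [letter_snoc_of_lt hK _ _ hk]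
    · constructor
      · intro h
        have := h a (by omega) le_rfl (Nat.zero_le _) (by rw [hK]; simp)
        rwa [if_pos rfl, letter_snoc_last hK] at this
      · intro h k hk hak _ _
        obtain rfl : k = a := by omega
        rw [if_pos rfl, letter_snoc_last hK, h]
  simp only [hc]
  by_cases h : (∀ k < a, letter α k = one) ∧ d = two
  · rw [if_pos h, if_pos h.1, h.2, Finset.prod_eq_one]
    · simp [twoW]
    · intro k hk
      rw [Finset.mem_range] at hk
      refine if_neg ?_
      rintro ⟨hak, hk1⟩
      obtain rfl : k = a := by omega
      rw [letter_snoc_last hK] at hk1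
      simp at hk1
  · rw [if_neg h]
    split_ifs with h1
    · have : d = one := by
        by_contra hcon
        exact h ⟨h1, by simpa using hcon⟩
      simp [this, twoW]
    · simp

theorem baseVec_zero_pair {m a N K : ℕ} (hK : K = N + 2) (ha : a ≤ N) :
    baseVec m 0 a K = insertPair pairW N (baseVec m 0 a N) := by
  classical
  funext γ
  obtain ⟨α, c, d, rfl⟩ := exists_eq_insertTwo N hK le_rfl γ
  rw [insertPair_insertTwo _ _ hK le_rfl, insertTwo_eq_snoc hK rfl]
  have l1 : ∀ k < N, letter (snoc (snoc α c : Str (N + 1)) d : Str K) k = letter α k := by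
    intro k hk
    rw [letter_snoc_of_lt (by omega) _ _ (by omega), letter_snoc_of_lt rfl _ _ hk]
  have l2 : letter (snoc (snoc α c : Str (N + 1)) d : Str K) N = c := by
    rw [letter_snoc_of_lt (by omega) _ _ (by omega), letter_snoc_last rfl]
  have l3 : letter (snoc (snoc α c : Str (N + 1)) d : Str K) (N + 1) = d :=
    letter_snoc_last (by omega) _ _
  have hc : BaseCond 0 a (snoc (snoc α c : Str (N + 1)) d : Str K) ↔ BaseCond 0 a α ∧ c = d := by
    unfold BaseCond
    rw [and_assoc]
    refine and_congr (forall₂_congr fun k hk => by rw [l1 _ (by omega)]) ?_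
    constructor
    · intro h
      refine ⟨fun k hk hak _ he => ?_, ?_⟩
      · have := h k (by omega) hak (Nat.zero_le _) (by rw [Nat.even_iff] at he ⊢; omega)
        rwa [l1 _ hk, l1 _ (by omega)] at this
      · have := h (N + 1) (by omega) (by omega) (Nat.zero_le _) (by rw [Nat.even_iff]; omega)
        rwa [if_neg (by omega), Nat.add_sub_cancel, l2, l3] at this
    · rintro ⟨h, h'⟩ k hk hak _ he
      rcases lt_trichotomy k N with hkN | hkN | hkN
      · rw [l1 _ hkN, l1 _ (by omega)]
        exact h k hkN hak (Nat.zero_le _) (by rw [Nat.even_iff] at he ⊢; omega)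
      · rw [Nat.even_iff] at he; omega
      · obtain rfl : k = N + 1 := by omega
        rw [if_neg (by omega), Nat.add_sub_cancel, l2, l3, h']
  rw [baseVec, baseVec]
  simp only [hc]
  have hp : (∏ k ∈ Finset.range K,
      if a ≤ k ∧ letter (snoc (snoc α c : Str (N + 1)) d : Str K) k = one then
        baseW m 0 (K - 1 - k) else 1) =
      (∏ k ∈ Finset.range N, if a ≤ k ∧ letter α k = one then baseW m 0 (N - 1 - k) else 1) *
        (if c = one then T (-1) else 1) := by
    rw [show Finset.range K = Finset.range (N + 1 + 1) by rw [hK], Finset.prod_range_succ,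
      Finset.prod_range_succ, l2, l3]
    have e1 : baseW m 0 (K - 1 - N) = T (-1) := by
      rw [show K - 1 - N = 1 by omega]; simp [baseW]
    have e2 : baseW m 0 (K - 1 - (N + 1)) = 1 := by
      rw [show K - 1 - (N + 1) = 0 by omega]; simp [baseW]
    rw [e1, e2, ite_self, mul_one]
    congr 1
    · refine Finset.prod_congr rfl fun k hk => ?_
      rw [Finset.mem_range] at hk
      rw [l1 _ hk]
      have : baseW m 0 (K - 1 - k) = baseW m 0 (N - 1 - k) := by
        rw [show K - 1 - k = N - 1 - k + 2 by omega]
        simp [baseW, Nat.even_add]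
      rw [this]
    · simp [ha]
  rw [hp]
  by_cases h : BaseCond 0 a α
  · cases c <;> cases d <;> simp [h, pairW, mul_comm, -T_mul]
  · simp [h]

/-- Factors are peeled off from the right: labels while `p > 0`, then 22 pairs, then a possible
leftover `2`. -/
theorem base_baseVec (m : ℕ) : ∀ {p a N : ℕ}, a ≤ N → Base m p N (baseVec m p a N) := by
  intro p a N
  induction N using Nat.strong_induction_on generalizing p with
  | _ N ih =>
    intro ha
    obtain rfl | ha : a = N ∨ a < N := by omega
    · rw [baseVec_self]; exact Base.ones _ _
    · cases p with
      | zero =>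
        obtain rfl | ha : N = a + 1 ∨ a + 2 ≤ N := by omega
        · rw [baseVec_zero_one rfl]; exact Base.leftover rfl
        · obtain ⟨n, rfl⟩ : ∃ n, N = n + 2 := ⟨N - 2, by omega⟩
          rw [baseVec_zero_pair rfl (by omega)]
          exact (ih n (by omega) (by omega)).pair rfl
      | succ p =>
        obtain ⟨n, rfl⟩ : ∃ n, N = n + 1 := ⟨N - 1, by omega⟩
        rw [baseVec_succ rfl (by omega)]
        exact (ih n (by omega) (by omega)).label rfl rfl

theorem Base.exists_eq {m p N : ℕ} {f : Vec N} (h : Base m p N f) :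
    ∃ a ≤ N, f = baseVec m p a N := by
  induction h with
  | ones p N => exact ⟨N, le_rfl, (baseVec_self _ _ _).symm⟩
  | @leftover N K hK => exact ⟨N, by omega, (baseVec_zero_one hK).symm⟩
  | label hq hK _ ih =>
    obtain ⟨a, ha, rfl⟩ := ih
    subst hq
    exact ⟨a, by omega, (baseVec_succ hK ha).symm⟩
  | pair hK _ ih =>
    obtain ⟨a, ha, rfl⟩ := ih
    exact ⟨a, by omega, (baseVec_zero_pair hK ha).symm⟩

theorem baseW_self (m r : ℕ) : baseW m m r = rankW m r := by
  unfold baseW rankW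
  rw [pow_add, pow_add, neg_one_pow_mul_self, one_mul]

theorem height_le_of_le {N : ℕ} {α β : Str N} (h : ∀ k < N, letter β k = one → letter α k = one) :
    pathLE α β := by
  intro x hx
  induction x with
  | zero => simp [height_zero]
  | succ x ih =>
    rw [height_succ _ (by omega), height_succ _ (by omega)]
    have h1 := ih (by omega)
    have h2 := h x (by omega)
    rcases sgn_eq (letter α x) with ⟨e, e'⟩ | ⟨e, e'⟩ <;>
      rcases sgn_eq (letter β x) with ⟨f, f'⟩ | ⟨f, f'⟩ <;> first | omega | (simp_all)

/-- All letters of `1…12…2` are unpaired and the `2` at position `k` has rank `N - 1 - k`. The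
parity condition of `BaseCond` singles out the right letters of the 22 pairs and, when `k = a`, the
unlabelled `2` left without a partner. -/
theorem isFlip_monoStr {N m a : ℕ} (ha : a ≤ N) {α : Str N} :
    IsFlip m α (monoStr N a) ↔ BaseCond m a α := by
  have hone : ∀ k : Fin N, ¬ a ≤ (k : ℕ) → monoStr N a k = one := by
    intro k hk
    by_contra hcon
    exact hk (monoStr_eq_two.1 (by simpa using hcon))
  constructor
  · intro h
    refine ⟨fun k hk => ?_, fun k hk hak hm he => ?_⟩
    · have hkN : k < N := by omega
      have h1 := hone ⟨k, hkN⟩ (by simp only; omega)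
      have h2 := h.other ⟨k, hkN⟩ (isUnpaired_monoStr _)
        (fun p hp => not_isUnpaired2_of_one h1 (hasLabel_iff.1 hp).1)
        (fun j => ⟨fun hp => not_isUnpaired2_of_one h1 (isPair22_iff.1 hp).1,
          fun hp => not_isUnpaired2_of_one h1 (isPair22_iff.1 hp).2.1⟩)
      rw [h1] at h2
      rw [← h2]
      exact letter_val α ⟨k, hkN⟩
    · have hu : IsUnpaired2 (monoStr N a) ⟨k, hk⟩ := isUnpaired2_monoStr.2 hak
      have hr : rank (monoStr N a) ⟨k, hk⟩ = N - 1 - k := rank_monoStr hak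
      have l1 : letter α k = α ⟨k, hk⟩ := letter_val α ⟨k, hk⟩
      split_ifs with hka
      · subst hka
        rw [l1, h.other ⟨k, hk⟩ (isUnpaired_monoStr _), hu.1]
        · intro p hp
          have := (hasLabel_iff.1 hp).2.1
          omega
        · intro j
          constructor
          · intro hp
            have h3 := isPair22_iff.1 hp
            have h4 := h3.2.2.1
            have h5 := h3.2.2.2.2
            rw [hr] at h4
            rw [Nat.even_iff] at he h5
            omega
          · intro hp
            have h3 := isPair22_iff.1 hp
            have h4 := lt_of_rank_lt h3.1 (i' := ⟨k, hk⟩) (by omega)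
            have h5 := isUnpaired2_monoStr.1 h3.1
            rw [Fin.lt_def] at h4
            simp only at h4
            omega
      · have hk1 : k - 1 < N := by omega
        have hu' : IsUnpaired2 (monoStr N a) ⟨k - 1, hk1⟩ :=
          isUnpaired2_monoStr.2 (by simp only; omega)
        have hr' : rank (monoStr N a) ⟨k - 1, hk1⟩ = N - 1 - (k - 1) :=
          rank_monoStr (by simp only; omega)
        have l2 : letter α (k - 1) = α ⟨k - 1, hk1⟩ := letter_val α ⟨k - 1, hk1⟩
        have hp : IsPair22 m (monoStr N a) ⟨k - 1, hk1⟩ ⟨k, hk⟩ :=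
          isPair22_iff.2 ⟨hu', hu, by omega, by omega, by rwa [hr]⟩
        rw [l1, l2]
        rcases h.pair22 _ _ hp with ⟨h1, h2⟩ | ⟨h1, h2⟩ <;> rw [h1, h2]
  · rintro ⟨h1, h2⟩
    have h1' : ∀ k : Fin N, monoStr N a k = one → α k = one := by
      intro k hk
      rw [← letter_val α k]
      refine h1 k ?_
      by_contra hcon
      rw [monoStr_eq_two.2 (not_lt.1 hcon)] at hk
      simp at hk
    refine ⟨height_le_of_le fun k hk hk1 => ?_, fun i j h => absurd h not_isPair21_monoStr, ?_, ?_⟩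
    · rw [show letter α k = α ⟨k, hk⟩ from letter_val α ⟨k, hk⟩]
      exact h1' _ (by rwa [← letter_val (monoStr N a) ⟨k, hk⟩])
    · intro i j hij
      obtain ⟨h3, h4, h5, h6, h7⟩ := isPair22_iff.1 hij
      have h8 := isUnpaired2_monoStr.1 h3
      have h9 := isUnpaired2_monoStr.1 h4
      have hi := i.2
      have hj := j.2
      rw [rank_monoStr h8, rank_monoStr h9] at h5
      rw [rank_monoStr h9] at h6 h7
      have := h2 j hj h9 h6 h7
      rw [if_neg (by omega), show (j : ℕ) - 1 = i by omega, letter_val, letter_val] at this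
      rw [this]
      cases α j <;> simp
    · intro i _ hl h22
      by_cases hai : a ≤ (i : ℕ)
      · have hu : IsUnpaired2 (monoStr N a) i := isUnpaired2_monoStr.2 hai
        have hr : rank (monoStr N a) i = N - 1 - i := rank_monoStr hai
        have hm : m ≤ N - 1 - i := by
          by_contra hcon
          exact hl _ (hasLabel_iff.2 ⟨hu, by omega, rfl⟩)
        have hi := i.2
        rw [hu.1]
        by_cases he : Even (N - 1 - i - m)
        · have := h2 i hi hai hm he
          by_cases hia : (i : ℕ) = a
          · rw [if_pos hia, letter_val] at this
            exact this
          · exfalso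
            have hk1 : (i : ℕ) - 1 < N := by omega
            have hr' : rank (monoStr N a) ⟨i - 1, hk1⟩ = N - 1 - (i - 1) :=
              rank_monoStr (by simp only; omega)
            refine (h22 ⟨i - 1, hk1⟩).2 (isPair22_iff.2 ⟨?_, hu, by omega, by omega, by rwa [hr]⟩)
            exact isUnpaired2_monoStr.2 (by simp only; omega)
        · exfalso
          -- An odd difference is at least one, so `i` is not the last position and its partner is
          -- at `i + 1`.
          have hm' : m < N - 1 - i := by
            rw [Nat.even_iff] at he
            omega
          have hk1 : (i : ℕ) + 1 < N := by omega
          have hr' : rank (monoStr N a) ⟨i + 1, hk1⟩ = N - 1 - (i + 1) :=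
            rank_monoStr (by simp only; omega)
          refine (h22 ⟨i + 1, hk1⟩).1 (isPair22_iff.2 ⟨hu, ?_, by omega, by omega, ?_⟩)
          · exact isUnpaired2_monoStr.2 (by simp only; omega)
          · rw [hr']
            rw [Nat.even_iff] at he ⊢
            omega
      · rw [hone i hai]
        exact h1' i (hone i hai)

theorem flipCoeff_monoStr {N m a : ℕ} (ha : a ≤ N) :
    (fun α : Str N => flipCoeff m α (monoStr N a)) = baseVec m m a N := by
  classical
  funext α
  rw [flipCoeff, baseVec]
  simp only [isFlip_monoStr ha]
  congr 1
  rw [flipProd, Finset.prod_range]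
  refine Finset.prod_congr rfl fun i _ => ?_
  rw [letter_val, baseW_self]
  have h1 : IsDown α (monoStr N a) i ↔ a ≤ (i : ℕ) ∧ α i = one := by
    unfold IsDown; rw [monoStr_eq_two]
  simp only [h1]
  by_cases hai : a ≤ (i : ℕ)
  · rw [flipW, if_pos (isUnpaired2_monoStr.2 hai), rank_monoStr hai]
  · simp [hai]

/-! ### The Kazhdan–Lusztig basis -/

/-- The Kazhdan–Lusztig basis. -/
noncomputable def flipBasis {N : ℕ} (m : ℕ) (β : Str N) : Mod N :=
  Finsupp.equivFunOnFinite.symm fun α => flipCoeff m α β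

theorem coe_flipBasis {N : ℕ} (m : ℕ) (β : Str N) :
    ⇑(flipBasis m β) = fun α => flipCoeff m α β := rfl

theorem lat_flipBasis (m : ℕ) {N : ℕ} (β : Str N) : Lat m m N (flipBasis m β) := by
  induction N using Nat.strong_induction_on with
  | _ N ih =>
    rcases exists_insertTwo_or_monoStr β with ⟨n, i, β', hn, hi, rfl⟩ | ⟨a, ha, rfl⟩
    · rw [coe_flipBasis, flipCoeff_insertTwo hn hi]
      exact (ih n (by omega) β').cup i hn hi
    · rw [coe_flipBasis, flipCoeff_monoStr ha]
      exact Lat.base (base_baseVec m ha)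

theorem smul_mem_barSpan {N : ℕ} {C : Str N → Mod N} {v : Mod N} (h : v ∈ barSpan C) {r : Coef}
    (hr : invert r = r) : r • v ∈ barSpan C := by
  induction h using AddSubgroup.closure_induction with
  | mem v hv =>
    obtain ⟨s, β, hs, rfl⟩ := hv
    exact AddSubgroup.subset_closure ⟨r * s, β, by rw [map_mul, hr, hs], smul_smul _ _ _⟩
  | zero => rw [smul_zero]; exact zero_mem _
  | add v w _ _ hv hw => rw [smul_add]; exact add_mem hv hw
  | neg v _ hv => rw [smul_neg]; exact neg_mem hv

theorem insertPair_mem_barSpan {m N K i : ℕ} (hK : K = N + 2) (hi : i ≤ N) {v : Mod N}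
    (h : v ∈ barSpan (flipBasis (N := N) m)) :
    ∀ w : Mod K, ⇑w = insertPair cupW i ⇑v → w ∈ barSpan (flipBasis (N := K) m) := by
  induction h using AddSubgroup.closure_induction with
  | mem v hv =>
    obtain ⟨s, β, hs, rfl⟩ := hv
    intro w hw
    refine AddSubgroup.subset_closure ⟨s, insertTwo i β two one, hs, DFunLike.coe_injective ?_⟩
    rw [hw, Finsupp.coe_smul, Finsupp.coe_smul, insertPair_smul, coe_flipBasis, coe_flipBasis,
      flipCoeff_insertTwo hK hi]
  | zero =>
    intro w hw
    rw [Finsupp.coe_zero, insertPair_zero] at hw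
    rw [DFunLike.coe_injective (hw.trans Finsupp.coe_zero.symm)]
    exact zero_mem _
  | add v w _ _ hv hw =>
    intro x hx
    have : x = Finsupp.equivFunOnFinite.symm (insertPair cupW i ⇑v) +
        Finsupp.equivFunOnFinite.symm (insertPair cupW i ⇑w) := by
      apply DFunLike.coe_injective
      rw [hx, Finsupp.coe_add, insertPair_add]; rfl
    rw [this]
    exact add_mem (hv _ rfl) (hw _ rfl)
  | neg v _ hv =>
    intro x hx
    have : x = -Finsupp.equivFunOnFinite.symm (insertPair cupW i ⇑v) := by
      apply DFunLike.coe_injective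
      rw [hx, Finsupp.coe_neg, ← neg_one_smul Coef, insertPair_smul, neg_one_smul]; rfl
    rw [this]
    exact neg_mem (hv _ rfl)

/-- When the largest label is `m`, base vectors are the candidates of the strings `1…12…2`, and
inserting a 21 pair sends candidates to candidates. Hence everything in `Lat` is a bar-invariant
combination of candidates. -/
theorem mem_barSpan_flipBasis {m N : ℕ} {f : Vec N} (h : Lat m m N f) :
    ∀ v : Mod N, ⇑v = f → v ∈ barSpan (flipBasis (N := N) m) := by
  induction h with
  | zero N =>
    intro v hv
    rw [DFunLike.coe_injective (hv.trans Finsupp.coe_zero.symm)]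
    exact zero_mem _
  | @add N f g _ _ h1 h2 =>
    intro v hv
    have : v = Finsupp.equivFunOnFinite.symm f + Finsupp.equivFunOnFinite.symm g :=
      DFunLike.coe_injective hv
    rw [this]
    exact add_mem (h1 _ rfl) (h2 _ rfl)
  | @smul N f r hr _ h =>
    intro v hv
    have : v = r • Finsupp.equivFunOnFinite.symm f := DFunLike.coe_injective hv
    rw [this]
    exact smul_mem_barSpan (h _ rfl) hr
  | @base N f hf =>
    intro v hv
    obtain ⟨a, ha, rfl⟩ := hf.exists_eq
    rw [← flipCoeff_monoStr ha] at hv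
    refine AddSubgroup.subset_closure ⟨1, monoStr N a, map_one _, ?_⟩
    rw [one_smul]
    exact DFunLike.coe_injective hv
  | @cup N K f i hK hi _ h =>
    intro v hv
    exact insertPair_mem_barSpan hK hi (h (Finsupp.equivFunOnFinite.symm f) rfl) v hv

theorem isKLBasis_flipBasis {N m : ℕ} (hm : 1 ≤ m) : IsKLBasis m (flipBasis (N := N) m) := by
  have hU : IsUnitri (flipBasis (N := N) m) :=
    ⟨flipCoeff_self m, fun _ _ _ hne => flipCoeff_mem hne,
      fun α β h => if_neg fun h' => h h'.le⟩
  refine hU.isKLBasis ?_ fun i β => ?_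
  · apply DFunLike.coe_injective
    have h1 : (fun _ => one : Str N) = monoStr N N := by
      funext k
      simp [monoStr, k.2]
    rw [coe_flipBasis]
    conv_lhs => rw [h1]
    rw [flipCoeff_monoStr le_rfl, baseVec_self]
    funext α
    classical
    rw [onesVec, Finsupp.single_apply]
    congr 1
    rw [eq_iff_iff, eq_comm, funext_iff]
    exact ⟨fun h k => by rw [← letter_val α k]; exact h k k.2,
      fun h k hk => by rw [← h ⟨k, hk⟩]; exact letter_val α ⟨k, hk⟩⟩
  · exact mem_barSpan_flipBasis ((lat_flipBasis m β).tlOp hm i) _ (heckeT_add m i _)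

theorem klBasis_eq_flipBasis {N m : ℕ} (hm : 1 ≤ m) : klBasis m = flipBasis (N := N) m :=
  (isKLBasis_flipBasis hm).klBasis_eq

theorem klP_eq {N m : ℕ} (hm : 1 ≤ m) (α β : Str N) :
    klP m α β = T (wlen m β - wlen m α) * flipCoeff m α β := by
  rw [klP, klBasis_eq_flipBasis hm]; rfl

/-! ### Boxes of the skew diagram -/

theorem height_abs_le {N : ℕ} (α : Str N) {x : ℕ} (hx : x ≤ N) :
    -(x : ℤ) ≤ height α x ∧ height α x ≤ x := by
  induction x with
  | zero => simp [height_zero]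
  | succ x ih =>
    rw [height_succ _ (by omega)]
    have := ih (by omega)
    rcases sgn_eq (letter α x) with ⟨-, e⟩ | ⟨-, e⟩ <;> push_cast <;> omega

theorem height_emod_two {N : ℕ} (α : Str N) {x : ℕ} (hx : x ≤ N) :
    (height α x - x) % 2 = 0 := by
  induction x with
  | zero => simp [height_zero]
  | succ x ih =>
    rw [height_succ _ (by omega)]
    have := ih (by omega)
    rcases sgn_eq (letter α x) with ⟨-, e⟩ | ⟨-, e⟩ <;> push_cast <;> omega

/-- The number of boxes of the skew diagram at abscissa `x`. -/
def gap {N : ℕ} (α β : Str N) (x : ℕ) : ℕ := ((height β x - height α x) / 2).toNat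

theorem two_mul_gap {N : ℕ} {α β : Str N} (h : pathLE α β) {x : ℕ} (hx : x ≤ N) :
    2 * (gap α β x : ℤ) = height β x - height α x := by
  have h1 := h x hx
  have h2 := height_emod_two α hx
  have h3 := height_emod_two β hx
  unfold gap
  omega

theorem gap_zero {N : ℕ} (α β : Str N) : gap α β 0 = 0 := by simp [gap, height_zero]

/-- The letter at position `i` is a `1` of `β` and a `2` of `α`. -/
def IsUp {N : ℕ} (α β : Str N) (i : Fin N) : Prop := β i = one ∧ α i = two

theorem gap_succ {N : ℕ} {α β : Str N} (h : pathLE α β) (i : Fin N) :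
    (IsDown α β i ∧ gap α β (i + 1) = gap α β i + 1) ∨
    (IsUp α β i ∧ gap α β (i + 1) + 1 = gap α β i) ∨
    (α i = β i ∧ gap α β (i + 1) = gap α β i) := by
  have h1 := two_mul_gap h (x := i) (by omega)
  have h2 := two_mul_gap h (x := i + 1) (by omega)
  rw [height_succ _ i.2, height_succ _ i.2, letter_val, letter_val] at h2
  rcases sgn_eq (α i) with ⟨e, e'⟩ | ⟨e, e'⟩ <;> rcases sgn_eq (β i) with ⟨f, f'⟩ | ⟨f, f'⟩
  · exact Or.inr (Or.inr ⟨by rw [e, f], by omega⟩)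
  · exact Or.inr (Or.inl ⟨⟨f, e⟩, by omega⟩)
  · exact Or.inl ⟨⟨f, e⟩, by omega⟩
  · exact Or.inr (Or.inr ⟨by rw [e, f], by omega⟩)

theorem IsDown.gap {N : ℕ} {α β : Str N} (h : pathLE α β) {i : Fin N} (hi : IsDown α β i) :
    gap α β (i + 1) = gap α β i + 1 := by
  rcases gap_succ h i with h1 | h1 | h1
  · exact h1.2
  · have := hi.1; rw [h1.1.1] at this; simp at this
  · have := hi.1; rw [← h1.1, hi.2] at this; simp at this

theorem IsUp.gap {N : ℕ} {α β : Str N} (h : pathLE α β) {i : Fin N} (hi : IsUp α β i) :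
    BallotKL.gap α β (i + 1) + 1 = BallotKL.gap α β i := by
  rcases gap_succ h i with h1 | h1 | h1
  · have := hi.1; rw [h1.1.1] at this; simp at this
  · exact h1.2
  · have := hi.1; rw [← h1.1, hi.2] at this; simp at this

/-- The box at abscissa `x` with `k` boxes between it and the path of `β`. -/
def box {N : ℕ} (β : Str N) (x : ℕ) (k : ℤ) : ℤ × ℤ := (x, height β x - (2 * k + 1))

theorem box_inj {N : ℕ} {β : Str N} {x x' : ℕ} {k k' : ℤ} :
    box β x k = box β x' k' ↔ x = x' ∧ k = k' := by
  constructor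
  · intro h
    have h1 : (x : ℤ) = x' := congrArg Prod.fst h
    have h2 : height β x - (2 * k + 1) = height β x' - (2 * k' + 1) := congrArg Prod.snd h
    have h3 : x = x' := by exact_mod_cast h1
    subst h3
    exact ⟨rfl, by omega⟩
  · rintro ⟨rfl, rfl⟩; rfl

theorem mem_boxes {N : ℕ} {β : Str N} {b : ℤ × ℤ} :
    b ∈ boxes β ↔ (1 ≤ b.1 ∧ b.1 ≤ N) ∧ |b.2| ≤ b.1 ∧ Even (b.1 + b.2 - 1) ∧
      b.2 < height β b.1.toNat := by
  unfold boxes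
  rw [Finset.mem_filter, Finset.mem_product, Finset.mem_Icc, Finset.mem_Icc]
  constructor
  · rintro ⟨⟨h1, -⟩, h2⟩; exact ⟨h1, h2⟩
  · rintro ⟨h1, h2⟩
    have := abs_le.1 h2.1
    exact ⟨⟨h1, by omega, by omega⟩, h2⟩

theorem boxes_subset {N : ℕ} {α β : Str N} (h : pathLE α β) : boxes α ⊆ boxes β := by
  intro b hb
  rw [mem_boxes] at hb ⊢
  exact ⟨hb.1, hb.2.1, hb.2.2.1, hb.2.2.2.trans_le (h _ (by omega))⟩

theorem mem_skew {N : ℕ} {α β : Str N} (h : pathLE α β) {b : ℤ × ℤ} :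
    b ∈ skew α β ↔ ∃ x k : ℕ, 1 ≤ x ∧ x ≤ N ∧ k < gap α β x ∧ b = box β x k := by
  unfold skew
  rw [Finset.mem_sdiff, mem_boxes, mem_boxes]
  constructor
  · rintro ⟨⟨h1, h2, h3, h4⟩, h5⟩
    have h6 : height α b.1.toNat ≤ b.2 := by
      by_contra hcon
      exact h5 ⟨h1, h2, h3, by omega⟩
    have hx : b.1.toNat ≤ N := by omega
    have h7 := two_mul_gap h hx
    have h8 := height_emod_two α hx
    have h9 := height_emod_two β hx
    rw [Int.even_iff] at h3
    -- The depth `k` solves `b.2 = height β x - (2 k + 1)`, which is possible by parity.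
    refine ⟨b.1.toNat, ((height β b.1.toNat - b.2 - 1) / 2).toNat, by omega, hx, by omega, ?_⟩
    unfold box
    ext
    · simp only; omega
    · simp only; omega
  · rintro ⟨x, k, h1, h2, h3, rfl⟩
    have h7 := two_mul_gap h h2
    have h8 := height_emod_two β h2
    have h9 := height_abs_le α h2
    have h10 := height_abs_le β h2
    simp only [box, Int.toNat_natCast, Int.even_iff, abs_le]
    omega

theorem box_mem_skew {N : ℕ} {α β : Str N} (h : pathLE α β) {x : ℕ} {k : ℕ} :
    box β x k ∈ skew α β ↔ 1 ≤ x ∧ x ≤ N ∧ k < gap α β x := by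
  rw [mem_skew h]
  constructor
  · rintro ⟨x', k', h1, h2, h3, h4⟩
    rw [box_inj] at h4
    obtain ⟨rfl, h4⟩ := h4
    have : k = k' := by exact_mod_cast h4
    subst this
    exact ⟨h1, h2, h3⟩
  · rintro ⟨h1, h2, h3⟩
    exact ⟨x, k, h1, h2, h3, rfl⟩

/-- In depth coordinates a covering box is one level nearer to the path of `β`, unless it is the
neighbour along that path on a side where the path is higher; then the depth is unchanged. -/
theorem covers_box {N : ℕ} {β : Str N} {x : ℕ} {k : ℤ} (h1 : 1 ≤ x) (hx : x ≤ N) {c : ℤ × ℤ}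
    (hc : Covers (box β x k) c) (hcN : c.1 ≤ N) :
    ∃ (y : ℕ) (l : ℤ), c = box β y l ∧ y ≤ N ∧ y ≤ x + 1 ∧ x ≤ y + 1 ∧
      (l = k - 1 ∨ (l = k ∧ y + 1 = x ∧ letter β y = one) ∨
        (l = k ∧ y = x + 1 ∧ letter β x = two)) := by
  rcases hc with rfl | rfl | rfl
  · refine ⟨x, k - 1, ?_, hx, by omega, by omega, Or.inl rfl⟩
    simp only [box, Prod.mk.injEq, true_and]; ring
  · obtain ⟨y, rfl⟩ : ∃ y, x = y + 1 := ⟨x - 1, by omega⟩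
    have hs := height_succ β (x := y) (by omega)
    rcases sgn_eq (letter β y) with ⟨e, e'⟩ | ⟨e, e'⟩
    · refine ⟨y, k - 1, ?_, by omega, by omega, by omega, Or.inl rfl⟩
      simp only [box, Prod.mk.injEq]; push_cast; omega
    · refine ⟨y, k, ?_, by omega, by omega, by omega, Or.inr (Or.inl ⟨rfl, rfl, e⟩)⟩
      simp only [box, Prod.mk.injEq]; push_cast; omega
  · have hxN : x + 1 ≤ N := by
      have : ((x : ℤ) + 1) ≤ N := hcN
      omega
    have hs := height_succ β (x := x) (by omega)
    rcases sgn_eq (letter β x) with ⟨e, e'⟩ | ⟨e, e'⟩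
    · refine ⟨x + 1, k, ?_, by omega, by omega, by omega, Or.inr (Or.inr ⟨rfl, rfl, e⟩)⟩
      simp only [box, Prod.mk.injEq]; push_cast; omega
    · refine ⟨x + 1, k - 1, ?_, by omega, by omega, by omega, Or.inl rfl⟩
      simp only [box, Prod.mk.injEq]; push_cast; omega

theorem covers_box_above {N : ℕ} (β : Str N) (x : ℕ) (k : ℤ) :
    Covers (box β x k) (box β x (k - 1)) := by
  left
  simp only [box, Prod.mk.injEq, true_and]; ring

theorem covers_box_right {N : ℕ} {β : Str N} {x : ℕ} {k : ℤ} (hx : x < N)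
    (h : letter β x = two) : Covers (box β x k) (box β (x + 1) k) := by
  have hs := height_succ β hx
  rw [h] at hs
  simp only [sgn, if_true] at hs
  right; right
  simp only [box, Prod.mk.injEq]; push_cast; omega

theorem covers_box_left {N : ℕ} {β : Str N} {x : ℕ} {k : ℤ} (hx : x < N)
    (h : letter β x = one) : Covers (box β (x + 1) k) (box β x k) := by
  have hs := height_succ β hx
  rw [h] at hs
  simp [sgn] at hs
  right; left
  simp only [box, Prod.mk.injEq]; push_cast; omega

theorem IsBallotStrip.eq_of_fst_eq {l l' : ℕ} {D : Finset (ℤ × ℤ)} (h : IsBallotStrip l l' D)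
    {b c : ℤ × ℤ} (hb : b ∈ D) (hc : c ∈ D) (he : b.1 = c.1) : b = c := by
  obtain ⟨x, y, p, -, -, -, -, rfl⟩ := h
  obtain ⟨i, -, rfl⟩ := Finset.mem_image.1 hb
  obtain ⟨j, -, rfl⟩ := Finset.mem_image.1 hc
  have : i = j := by
    have : x + (i : ℤ) = x + j := he
    omega
  rw [this]

/-! ### Strips parallel to the path of `β` -/

/-- The boxes `box β z k` for `x ≤ z ≤ x + L`. -/
def rowSet {N : ℕ} (β : Str N) (x L k : ℕ) : Finset (ℤ × ℤ) :=
  (Finset.range (L + 1)).image fun i : ℕ => box β (x + i) k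

theorem box_mem_rowSet {N : ℕ} {β : Str N} {x L k z k' : ℕ} :
    box β z k' ∈ rowSet β x L k ↔ k' = k ∧ x ≤ z ∧ z ≤ x + L := by
  unfold rowSet
  simp only [Finset.mem_image, Finset.mem_range, box_inj]
  constructor
  · rintro ⟨i, hi, rfl, h⟩
    have : k = k' := by exact_mod_cast h
    exact ⟨this.symm, by omega, by omega⟩
  · rintro ⟨rfl, h1, h2⟩
    exact ⟨z - x, by omega, by omega, rfl⟩

theorem exists_of_mem_rowSet {N : ℕ} {β : Str N} {x L k : ℕ} {b : ℤ × ℤ}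
    (h : b ∈ rowSet β x L k) : ∃ z, x ≤ z ∧ z ≤ x + L ∧ b = box β z k := by
  obtain ⟨i, hi, rfl⟩ := Finset.mem_image.1 h
  rw [Finset.mem_range] at hi
  exact ⟨x + i, by omega, by omega, rfl⟩

theorem isBallotStrip_rowSet {N : ℕ} {β : Str N} {x L k l l' : ℕ} (hx : x + L ≤ N) :
    IsBallotStrip l l' (rowSet β x L k) ↔ L = 2 * l + l' ∧
      height β (x + L) = height β x + l' ∧ ∀ i ≤ L, height β x ≤ height β (x + i) := by
  constructor
  · rintro ⟨X, Y, p, hp0, hpn, -, hpb, hD⟩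
    have key : ∀ i < L + 1, ∃ j < 2 * l + l' + 1, X + (j : ℤ) = ((x + i : ℕ) : ℤ) ∧
        p j = height β (x + i) - (2 * k + 1) := by
      intro i hi
      have : box β (x + i) k ∈ rowSet β x L k := box_mem_rowSet.2 ⟨rfl, by omega, by omega⟩
      rw [hD] at this
      obtain ⟨j, hj, he⟩ := Finset.mem_image.1 this
      exact ⟨j, Finset.mem_range.1 hj, congrArg Prod.fst he, congrArg Prod.snd he⟩
    have key' : ∀ j < 2 * l + l' + 1, ∃ i < L + 1, X + (j : ℤ) = ((x + i : ℕ) : ℤ) := by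
      intro j hj
      have : (X + (j : ℤ), p j) ∈ rowSet β x L k := by
        rw [hD]; exact Finset.mem_image.2 ⟨j, Finset.mem_range.2 hj, rfl⟩
      obtain ⟨z, h1, h2, he⟩ := exists_of_mem_rowSet this
      have he1 : X + (j : ℤ) = (z : ℤ) := congrArg Prod.fst he
      exact ⟨z - x, by omega, by omega⟩
    obtain ⟨a, ha, ha1, ha2⟩ := key 0 (by omega)
    obtain ⟨b, hb, hb1⟩ := key' 0 (by omega)
    have hX : X = x := by push_cast at *; omega
    obtain ⟨c, hc, hc1, hc2⟩ := key L (by omega)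
    obtain ⟨d, hd, hd1⟩ := key' (2 * l + l') (by omega)
    have hL : L = 2 * l + l' := by push_cast at *; omega
    have hp : ∀ i ≤ L, p i = height β (x + i) - (2 * k + 1) := by
      intro i hi
      obtain ⟨j, hj, hj1, hj2⟩ := key i (by omega)
      have : j = i := by push_cast at *; omega
      rw [← this, hj2, this]
    have e0 := hp 0 (by omega)
    have eL := hp L le_rfl
    rw [hp0] at e0
    rw [hL, hpn, ← hL] at eL
    rw [Nat.add_zero] at e0
    refine ⟨hL, by omega, fun i hi => ?_⟩
    have e1 := hpb i (by omega)
    rw [hp i hi] at e1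
    omega
  · rintro ⟨hL, h1, h2⟩
    refine ⟨x, height β x - (2 * k + 1), fun i => height β (x + i) - (2 * k + 1), by simp, ?_, ?_,
      ?_, ?_⟩
    · simp only
      rw [← hL, h1]; ring
    · intro i hi
      have := height_succ β (x := x + i) (by omega)
      rw [Nat.add_assoc] at this
      simp only
      rcases sgn_eq (letter β (x + i)) with ⟨-, e⟩ | ⟨-, e⟩
      · left; omega
      · right; omega
    · intro i hi
      have := h2 i (by omega)
      simp only
      omega
    · rw [rowSet, hL]
      apply Finset.image_congr
      intro i _
      simp [box]

/-- The columns `p + 1, …, q` are those of the row of boxes that starts on the right of the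
position `p`. -/
structure RowEnd {N : ℕ} (α β : Str N) (p : Fin N) (q : ℕ) : Prop where
  lt : (p : ℕ) < q
  le : q ≤ N
  gap_lt : ∀ z, (p : ℕ) < z → z ≤ q → gap α β p < gap α β z
  ends : q = N ∨ gap α β (q + 1) ≤ gap α β p

theorem RowEnd.unique {N : ℕ} {α β : Str N} {p : Fin N} {q q' : ℕ} (h : RowEnd α β p q)
    (h' : RowEnd α β p q') : q = q' := by
  have h1 := h.lt
  have h1' := h'.lt
  have h2 := h.le
  have h2' := h'.le
  rcases lt_trichotomy q q' with hlt | heq | hlt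
  · rcases h.ends with h3 | h3
    · omega
    · have := h'.gap_lt (q + 1) (by omega) (by omega); omega
  · exact heq
  · rcases h'.ends with h3 | h3
    · omega
    · have := h.gap_lt (q' + 1) (by omega) (by omega); omega

theorem exists_rowEnd {N : ℕ} {α β : Str N} (h : pathLE α β) {p : Fin N} (hp : IsDown α β p) :
    ∃ q, RowEnd α β p q := by
  classical
  have hg := hp.gap h
  have hex : ∃ q, (p : ℕ) < q ∧ (q = N ∨ gap α β (q + 1) ≤ gap α β p) := ⟨N, p.2, Or.inl rfl⟩
  obtain ⟨h1, h2⟩ := Nat.find_spec hex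
  refine ⟨Nat.find hex, h1, Nat.find_min' hex ⟨p.2, Or.inl rfl⟩, ?_, h2⟩
  intro z hz hzq
  by_cases hz1 : z = p + 1
  · rw [hz1, hg]; omega
  · have := Nat.find_min hex (m := z - 1) (by omega)
    push Not at this
    have := (this (by omega)).2
    rwa [show z - 1 + 1 = z by omega] at this

/-- A box of a row determines the position where the row starts. -/
theorem row_unique {N : ℕ} {α β : Str N} {p p' : Fin N} {q q' x x' : ℕ} (h : RowEnd α β p q)
    (h' : RowEnd α β p' q') (hg : gap α β p = gap α β p') (hx : (p : ℕ) < x) (hxq : x ≤ q)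
    (hx' : (p' : ℕ) < x') (hxq' : x' ≤ q') (h1 : x ≤ x' + 1) (h2 : x' ≤ x + 1) : p = p' := by
  rcases lt_trichotomy (p : ℕ) p' with hlt | heq | hlt
  · have := h.gap_lt p' hlt (by omega); omega
  · exact Fin.ext heq
  · have := h'.gap_lt p hlt (by omega); omega

/-- The row starts after the last abscissa before `x` where the gap is at most `k`. The gap begins
at `0` and changes by at most one per step, so there it equals `k` and increases. -/
theorem exists_row {N : ℕ} {α β : Str N} (h : pathLE α β) {x k : ℕ}
    (hxN : x ≤ N) (hk : k < gap α β x) :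
    ∃ p, IsDown α β p ∧ gap α β p = k ∧ (p : ℕ) < x ∧
      ∀ z, (p : ℕ) < z → z ≤ x → k < gap α β z := by
  classical
  have h0 : gap α β 0 ≤ k := by rw [gap_zero]; omega
  set y := Nat.findGreatest (fun y => gap α β y ≤ k) x with hy
  have h1 : gap α β y ≤ k :=
    Nat.findGreatest_spec (P := fun y => gap α β y ≤ k) (Nat.zero_le x) h0
  have hyx : y ≤ x := Nat.findGreatest_le _
  have hmax : ∀ z, y < z → z ≤ x → k < gap α β z := fun z hz hzx =>
    not_le.1 (Nat.findGreatest_is_greatest (P := fun y => gap α β y ≤ k) hz hzx)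
  have hne : y ≠ x := by intro e; rw [e] at h1; omega
  have hyN : y < N := by omega
  have h2 := hmax (y + 1) (by omega) (by omega)
  refine ⟨⟨y, hyN⟩, ?_, ?_, by simp only; omega, hmax⟩
  · rcases gap_succ h ⟨y, hyN⟩ with h3 | h3 | h3
    · exact h3.1
    · simp only at h3; omega
    · simp only at h3; omega
  · rcases gap_succ h ⟨y, hyN⟩ with h3 | h3 | h3 <;> simp only at h3 ⊢ <;> omega

theorem exists_rowEnd_of_box {N : ℕ} {α β : Str N} (h : pathLE α β) {x k : ℕ}
    (hxN : x ≤ N) (hk : k < gap α β x) :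
    ∃ p q, IsDown α β p ∧ RowEnd α β p q ∧ gap α β p = k ∧ (p : ℕ) < x ∧ x ≤ q := by
  obtain ⟨p, hp, hpk, hpx, hpz⟩ := exists_row h hxN hk
  obtain ⟨q, hq⟩ := exists_rowEnd h hp
  refine ⟨p, q, hp, hq, hpk, hpx, ?_⟩
  by_contra hcon
  rcases hq.ends with h1 | h1
  · omega
  · have := hpz (q + 1) (by have := hq.lt; omega) (by omega)
    omega

open Classical in
/-- The row of boxes that starts on the right of the position `p`. -/
noncomputable def row {N : ℕ} (α β : Str N) (p : Fin N) : Finset (ℤ × ℤ) :=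
  if h : ∃ q, RowEnd α β p q then rowSet β (p + 1) (h.choose - (p + 1)) (gap α β p) else ∅

theorem row_eq {N : ℕ} {α β : Str N} {p : Fin N} {q : ℕ} (h : RowEnd α β p q) :
    row α β p = rowSet β (p + 1) (q - (p + 1)) (gap α β p) := by
  have hex : ∃ q, RowEnd α β p q := ⟨q, h⟩
  rw [row, dif_pos hex, hex.choose_spec.unique h]

theorem box_mem_row {N : ℕ} {α β : Str N} {p : Fin N} {q : ℕ} (h : RowEnd α β p q) {z k : ℕ} :
    box β z k ∈ row α β p ↔ k = gap α β p ∧ (p : ℕ) < z ∧ z ≤ q := by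
  rw [row_eq h, box_mem_rowSet]
  have := h.lt
  refine and_congr_right fun _ => ?_
  omega

theorem exists_of_mem_row {N : ℕ} {α β : Str N} {p : Fin N} {q : ℕ} (h : RowEnd α β p q)
    {b : ℤ × ℤ} (hb : b ∈ row α β p) :
    ∃ z, (p : ℕ) < z ∧ z ≤ q ∧ b = box β z (gap α β p) := by
  rw [row_eq h] at hb
  obtain ⟨z, h1, h2, h3⟩ := exists_of_mem_rowSet hb
  have := h.lt
  exact ⟨z, by omega, by omega, h3⟩

/-- The set of all the rows. -/
noncomputable def rows {N : ℕ} (α β : Str N) : Finset (Finset (ℤ × ℤ)) :=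
  (Finset.univ.filter fun p => IsDown α β p).image (row α β)

theorem mem_rows {N : ℕ} {α β : Str N} {D : Finset (ℤ × ℤ)} :
    D ∈ rows α β ↔ ∃ p, IsDown α β p ∧ row α β p = D := by
  simp [rows]

theorem row_injective {N : ℕ} {α β : Str N} (h : pathLE α β) {p p' : Fin N}
    (hp : IsDown α β p) (hp' : IsDown α β p') {b : ℤ × ℤ} (hb : b ∈ row α β p)
    (hb' : b ∈ row α β p') : p = p' := by
  obtain ⟨q, hq⟩ := exists_rowEnd h hp
  obtain ⟨q', hq'⟩ := exists_rowEnd h hp'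
  obtain ⟨z, h1, h2, rfl⟩ := exists_of_mem_row hq hb
  obtain ⟨h3, h4, h5⟩ := (box_mem_row hq').1 hb'
  exact row_unique hq hq' h3 h1 h2 h4 h5 (by omega) (by omega)

theorem row_nonempty {N : ℕ} {α β : Str N} (h : pathLE α β) {p : Fin N} (hp : IsDown α β p) :
    (row α β p).Nonempty := by
  obtain ⟨q, hq⟩ := exists_rowEnd h hp
  have := hq.lt
  exact ⟨box β (p + 1) (gap α β p), (box_mem_row hq).2 ⟨rfl, by omega, by omega⟩⟩

/-- The partition of the skew diagram into rows. -/
noncomputable def rowPartition {N : ℕ} {α β : Str N} (h : pathLE α β) :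
    Finpartition (skew α β) :=
  Finpartition.ofExistsUnique (rows α β)
    (by
      intro D hD
      obtain ⟨p, hp, rfl⟩ := mem_rows.1 hD
      obtain ⟨q, hq⟩ := exists_rowEnd h hp
      intro b hb
      obtain ⟨z, h1, h2, rfl⟩ := exists_of_mem_row hq hb
      have := hq.le
      exact (box_mem_skew h).2 ⟨by omega, by omega, hq.gap_lt z h1 h2⟩)
    (by
      intro b hb
      obtain ⟨x, k, -, h2, h3, rfl⟩ := (mem_skew h).1 hb
      obtain ⟨p, q, hp, hq, hpk, hpx, hxq⟩ := exists_rowEnd_of_box h h2 h3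
      have hmem : box β x k ∈ row α β p := (box_mem_row hq).2 ⟨hpk.symm, hpx, hxq⟩
      refine ⟨row α β p, ⟨mem_rows.2 ⟨p, hp, rfl⟩, hmem⟩, ?_⟩
      rintro D ⟨hD, hbD⟩
      obtain ⟨p', hp', rfl⟩ := mem_rows.1 hD
      rw [row_injective h hp hp' hmem hbD])
    (by
      intro hD
      obtain ⟨p, hp, he⟩ := mem_rows.1 hD
      exact (row_nonempty h hp).ne_empty he)

theorem rowPartition_parts {N : ℕ} {α β : Str N} (h : pathLE α β) :
    (rowPartition h).parts = rows α β := rfl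

/-! ### Uniqueness of the filling -/

section filling

variable {N m : ℕ} {α β : Str N} {c : Finpartition (skew α β)}

theorem IsConfII.box_unique (hc : IsConfII N m c) {D : Finset (ℤ × ℤ)} (hD : D ∈ c.parts)
    {x k k' : ℕ} (hb : box β x k ∈ D) (hb' : box β x k' ∈ D) : k = k' := by
  obtain ⟨l, l', hs⟩ := hc.strips D hD
  have := (box_inj.1 (hs.eq_of_fst_eq hb hb' rfl)).2
  exact_mod_cast this

/-- Boxes at the same depth in adjacent columns lie in the same strip. -/
theorem IsConfII.link (h : pathLE α β) (hc : IsConfII N m c) {x k : ℕ} (hx : 1 ≤ x)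
    (hxN : x < N) (hk : k < gap α β x) (hk' : k < gap α β (x + 1)) {D D' : Finset (ℤ × ℤ)}
    (hD : D ∈ c.parts) (hD' : D' ∈ c.parts) (hb : box β x k ∈ D)
    (hb' : box β (x + 1) k ∈ D') : D = D' := by
  induction k generalizing D D' with
  | zero =>
    by_contra hne
    -- Depth `-1` lies above the path of `β`, outside the diagram.
    have hout : ∀ y E, E ∈ c.parts → box β y ((0 : ℕ) - 1 : ℤ) ∉ E := by
      intro y E hE hmem
      obtain ⟨x', k', -, -, -, he⟩ := (mem_skew h).1 (c.le hE hmem)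
      have := (box_inj.1 he).2
      omega
    -- The letter between the two columns tells which box is lower. Rule II (a), applied to the
    -- strip of the lower box, claims the box just above it.
    cases hl : letter β x
    · have h1 := hc.ruleIIa D' hD' D hD (Ne.symm hne) ⟨_, hb', _, hb, covers_box_left hxN hl⟩ _ hb' _
        (covers_box_above β (x + 1) _) (by simp only [box]; omega)
      exact h1.elim (hout _ _ hD') (hout _ _ hD)
    · have h1 := hc.ruleIIa D hD D' hD' hne ⟨_, hb, _, hb', covers_box_right hxN hl⟩ _ hb _
        (covers_box_above β x _) (by simp only [box]; omega)
      exact h1.elim (hout _ _ hD) (hout _ _ hD')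
  | succ k ih =>
    by_contra hne
    have hcast : (((k + 1 : ℕ) : ℤ) - 1) = (k : ℤ) := by push_cast; ring
    -- The box just above the lower one must lie in the other strip. By induction so does its
    -- neighbour of depth `k` in the other column, where that strip already has a box of depth `k +
    -- 1`.
    cases hl : letter β x
    · have h1 := hc.ruleIIa D' hD' D hD (Ne.symm hne) ⟨_, hb', _, hb, covers_box_left hxN hl⟩ _ hb' _
        (covers_box_above β (x + 1) _) (by simp only [box]; omega)
      rw [hcast] at h1
      rcases h1 with h1 | h1
      · have := hc.box_unique hD' h1 hb'; omega
      · obtain ⟨E, hE, hEb⟩ := c.exists_mem ((box_mem_skew h).2 ⟨hx, hxN.le, by omega⟩ :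
          box β x k ∈ skew α β)
        have := ih (by omega) (by omega) hE hD hEb h1
        subst this
        have := hc.box_unique hE hEb hb; omega
    · have h1 := hc.ruleIIa D hD D' hD' hne ⟨_, hb, _, hb', covers_box_right hxN hl⟩ _ hb _
        (covers_box_above β x _) (by simp only [box]; omega)
      rw [hcast] at h1
      rcases h1 with h1 | h1
      · have := hc.box_unique hD h1 hb; omega
      · obtain ⟨E, hE, hEb⟩ := c.exists_mem ((box_mem_skew h).2 ⟨by omega, hxN, by omega⟩ :
          box β (x + 1) k ∈ skew α β)
        have := ih (by omega) (by omega) hD' hE h1 hEb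
        subst this
        have := hc.box_unique hD' hEb hb'; omega

/-- The depths in a column form an initial segment, so one of `k`, `k'` occurs in both columns. If
they differed, `IsConfII.link` would give `D` two boxes in one column. -/
theorem IsConfII.depth_eq (h : pathLE α β) (hc : IsConfII N m c) {D : Finset (ℤ × ℤ)}
    (hD : D ∈ c.parts) {x k k' : ℕ} (hb : box β x k ∈ D) (hb' : box β (x + 1) k' ∈ D) :
    k = k' := by
  obtain ⟨h1, h2, h3⟩ := (box_mem_skew h).1 (c.le hD hb)
  obtain ⟨h1', h2', h3'⟩ := (box_mem_skew h).1 (c.le hD hb')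
  by_cases hk : k < gap α β (x + 1)
  · obtain ⟨E, hE, hEb⟩ := c.exists_mem ((box_mem_skew h).2 ⟨h1', h2', hk⟩)
    have := hc.link h h1 (by omega) h3 hk hD hE hb hEb
    subst this
    exact hc.box_unique hD hEb hb'
  · have hk' : k' < gap α β x := by omega
    obtain ⟨E, hE, hEb⟩ := c.exists_mem ((box_mem_skew h).2 ⟨h1, h2, hk'⟩)
    have := hc.link h h1 (by omega) hk' h3' hE hD hEb hb'
    subst this
    exact hc.box_unique hE hb hEb

theorem IsConfII.exists_eq_rowSet (h : pathLE α β) (hc : IsConfII N m c)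
    {D : Finset (ℤ × ℤ)} (hD : D ∈ c.parts) :
    ∃ x L k, D = rowSet β x L k := by
  obtain ⟨l, l', X, Y, p, -, -, -, -, hDe⟩ := hc.strips D hD
  have hmem : ∀ i ≤ 2 * l + l', (X + (i : ℤ), p i) ∈ D := by
    intro i hi
    rw [hDe]; exact Finset.mem_image.2 ⟨i, Finset.mem_range.2 (by omega), rfl⟩
  obtain ⟨x, k, hx1, hxN, hk, he⟩ := (mem_skew h).1 (c.le hD (hmem 0 (by omega)))
  have hXx : X = x := by have : X + ((0 : ℕ) : ℤ) = x := congrArg Prod.fst he; simpa using this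
  have hi : ∀ i ≤ 2 * l + l', (X + (i : ℤ), p i) = box β (x + i) k := by
    intro i
    induction i with
    | zero => intro _; rw [he]; rfl
    | succ i ih =>
      intro hi
      obtain ⟨x', k', -, -, -, he'⟩ := (mem_skew h).1 (c.le hD (hmem (i + 1) hi))
      have hx' : x' = x + i + 1 := by
        have : X + ((i + 1 : ℕ) : ℤ) = x' := congrArg Prod.fst he'
        push_cast at this; omega
      subst hx'
      have h1 := hmem i (by omega)
      have h2 := hmem (i + 1) hi
      rw [ih (by omega)] at h1
      rw [he'] at h2
      rw [he', hc.depth_eq h hD h1 h2]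
      rfl
  refine ⟨x, 2 * l + l', k, ?_⟩
  rw [hDe, rowSet]
  apply Finset.image_congr
  intro i hir
  have := Finset.mem_range.1 (Finset.mem_coe.1 hir)
  exact hi i (by omega)

/-- A strip of constant depth that stopped short of a whole row would absorb the next box of the row
by `IsConfII.link`. -/
theorem IsConfII.exists_eq_row (h : pathLE α β) (hc : IsConfII N m c)
    {D : Finset (ℤ × ℤ)} (hD : D ∈ c.parts) : ∃ p, IsDown α β p ∧ row α β p = D := by
  obtain ⟨x, L, k, rfl⟩ := hc.exists_eq_rowSet h hD
  have hin : ∀ z, x ≤ z → z ≤ x + L → 1 ≤ z ∧ z ≤ N ∧ k < gap α β z := fun z h1 h2 =>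
    (box_mem_skew h).1 (c.le hD (box_mem_rowSet.2 ⟨rfl, h1, h2⟩))
  have h1 := hin x le_rfl (by omega)
  have h2 := hin (x + L) (by omega) le_rfl
  obtain ⟨p, q, hp, hq, hpk, hpx, hxq⟩ := exists_rowEnd_of_box h h1.2.1 h1.2.2
  have hqN := hq.le
  have hpx' : (p : ℕ) + 1 = x := by
    by_contra hcon
    obtain ⟨y, rfl⟩ : ∃ y, x = y + 1 := ⟨x - 1, by omega⟩
    have hy := hq.gap_lt y (by omega) (by omega)
    obtain ⟨E, hE, hEb⟩ := c.exists_mem ((box_mem_skew h).2 ⟨by omega, by omega, hpk ▸ hy⟩ :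
      box β y k ∈ skew α β)
    have := hc.link h (by omega) (by omega) (hpk ▸ hy) h1.2.2 hE hD hEb
      (box_mem_rowSet.2 ⟨rfl, le_rfl, by omega⟩)
    subst this
    have := (box_mem_rowSet.1 hEb).2.1
    omega
  have hL : x + L = q := by
    rcases lt_trichotomy (x + L) q with hlt | heq | hlt
    · have hy := hq.gap_lt (x + L + 1) (by omega) (by omega)
      obtain ⟨E, hE, hEb⟩ := c.exists_mem ((box_mem_skew h).2 ⟨by omega, by omega, hpk ▸ hy⟩ :
        box β (x + L + 1) k ∈ skew α β)
      have := hc.link h h2.1 (by omega) h2.2.2 (hpk ▸ hy) hD hE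
        (box_mem_rowSet.2 ⟨rfl, by omega, le_rfl⟩) hEb
      subst this
      have := (box_mem_rowSet.1 hEb).2.2
      omega
    · exact heq
    · rcases hq.ends with he | he
      · omega
      · have := hin (q + 1) (by omega) (by omega)
        omega
  refine ⟨p, hp, ?_⟩
  rw [row_eq hq, hpk, hpx']
  congr 1
  omega

/-- The shape of the strips and Rule II (a) already determine the filling; the other rules only
decide whether it is admissible. -/
theorem IsConfII.parts_eq (h : pathLE α β) (hc : IsConfII N m c) : c.parts = rows α β := by
  ext D
  rw [mem_rows]
  constructor
  · exact hc.exists_eq_row h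
  · rintro ⟨p, hp, rfl⟩
    obtain ⟨q, hq⟩ := exists_rowEnd h hp
    have hpq := hq.lt
    have hqN := hq.le
    have hmem : box β (p + 1) (gap α β p) ∈ row α β p :=
      (box_mem_row hq).2 ⟨rfl, by omega, by omega⟩
    obtain ⟨E, hE, hEb⟩ := c.exists_mem ((box_mem_skew h).2 ⟨by omega, by omega,
      hq.gap_lt _ (by omega) (by omega)⟩ : box β (p + 1) (gap α β p) ∈ skew α β)
    obtain ⟨p', hp', rfl⟩ := hc.exists_eq_row h hE
    rwa [row_injective h hp hp' hmem hEb]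

theorem IsConfII.eq_rowPartition (h : pathLE α β) (hc : IsConfII N m c) : c = rowPartition h :=
  Finpartition.ext (hc.parts_eq h)

end filling

/-! ### Rows that are ballot strips -/

theorem height_add_le {N : ℕ} (β : Str N) {x i : ℕ} (h : x + i ≤ N) :
    height β (x + i) ≤ height β x + i := by
  induction i with
  | zero => simp
  | succ i ih =>
    have := ih (by omega)
    rw [← Nat.add_assoc, height_succ _ (by omega)]
    rcases sgn_eq (letter β (x + i)) with ⟨-, e⟩ | ⟨-, e⟩ <;> push_cast <;> omega

/-- The row that starts at the flipped `2` at position `p` ends at the matching `1`, which is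
flipped too, or at the anchor boxes if this `2` is unpaired. -/
def IsGoodRow {N : ℕ} (α β : Str N) (p : Fin N) : Prop :=
  (∃ j, IsPair21 β p j ∧ IsUp α β j ∧ RowEnd α β p j) ∨
    (IsUnpaired2 β p ∧ RowEnd α β p N)

theorem isBallotStrip_row {N : ℕ} {α β : Str N} {p : Fin N} {q l l' : ℕ}
    (h : RowEnd α β p q) :
    IsBallotStrip l l' (row α β p) ↔ q = p + 1 + (2 * l + l') ∧
      height β q = height β (p + 1) + l' ∧
      ∀ z, (p : ℕ) < z → z ≤ q → height β (p + 1) ≤ height β z := by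
  have h1 := h.lt
  have h2 := h.le
  rw [row_eq h, isBallotStrip_rowSet (by omega), show (p : ℕ) + 1 + (q - (p + 1)) = q by omega]
  refine and_congr (by omega) (and_congr_right fun _ => ?_)
  constructor
  · intro h3 z hz hzq
    have := h3 (z - (p + 1)) (by omega)
    rwa [show (p : ℕ) + 1 + (z - (p + 1)) = z by omega] at this
  · intro h3 i hi
    exact h3 _ (by omega) (by omega)

theorem IsPair21.isBallotStrip {N : ℕ} {α β : Str N} {p j : Fin N} (h : IsPair21 β p j)
    (hr : RowEnd α β p j) : ∃ l : ℕ, (j : ℕ) = p + 1 + 2 * l ∧ IsBallotStrip l 0 (row α β p) := by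
  have h1 := hr.lt
  have h2 := hr.le
  have h3 := height_succ_two h.2.1
  have h4 := height_succ_one h.2.2.1
  have h5 := h.2.2.2.1
  have h6 := height_emod_two β (x := p + 1) (by omega)
  have h7 := height_emod_two β (x := j) (by omega)
  push_cast at h6
  have h8 : (j : ℕ) = p + 1 + 2 * ((j - (p + 1)) / 2) := by omega
  refine ⟨(j - (p + 1)) / 2, h8, (isBallotStrip_row hr).2 ⟨h8, by push_cast; omega, ?_⟩⟩
  intro z hz hzj
  have := h.2.2.2.2 z hz hzj
  omega

theorem IsUnpaired2.isBallotStrip {N : ℕ} {α β : Str N} {p : Fin N} (h : IsUnpaired2 β p)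
    (hr : RowEnd α β p N) :
    ∃ l : ℕ, N = p + 1 + (2 * l + rank β p) ∧ IsBallotStrip l (rank β p) (row α β p) := by
  have h1 := hr.lt
  have h3 := height_succ_two h.1
  have h5 := rank_eq_height h
  have h6 := height_emod_two β (x := p + 1) (by omega)
  have h7 := height_emod_two β (x := N) le_rfl
  have h9 := height_add_le β (x := p + 1) (i := N - (p + 1)) (by omega)
  rw [show (p : ℕ) + 1 + (N - (p + 1)) = N by omega] at h9
  push_cast at h6
  have h8 : N = p + 1 + (2 * ((N - (p + 1) - rank β p) / 2) + rank β p) := by omega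
  refine ⟨(N - (p + 1) - rank β p) / 2, h8, (isBallotStrip_row hr).2 ⟨h8, by omega, ?_⟩⟩
  intro z hz hzj
  have := h.height_lt hz hzj
  omega

/-- If the row reaches the anchor boxes, the ballot condition says that the path of `β` never
returns to its height before `p`. Otherwise Rule 0 forces `l' = 0`, so both ends of the row have
equal height, and the drop of the gap after the row exhibits the matching `1` as flipped. -/
theorem isGoodRow_of_isBallotStrip {N : ℕ} {α β : Str N} (h : pathLE α β) {p : Fin N}
    (hp : IsDown α β p) {q : ℕ} (hr : RowEnd α β p q) {l l' : ℕ}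
    (hs : IsBallotStrip l l' (row α β p)) (h0 : Rule0 N (row α β p)) : IsGoodRow α β p := by
  have hpq := hr.lt
  have hqN := hr.le
  have hup := height_succ_two hp.1
  obtain ⟨-, h2, h3⟩ := (isBallotStrip_row hr).1 hs
  obtain rfl | hlt : q = N ∨ q < N := by omega
  · refine Or.inr ⟨isUnpaired2_of_height hp.1 fun y hy hyN => ?_, hr⟩
    have := h3 y hy hyN
    omega
  · have hl' : l' = 0 := by
      by_contra hcon
      have := h0 (by rw [hs.stripLength_eq]; simp only; omega) (box β q (gap α β p))
        ((box_mem_row hr).2 ⟨rfl, hpq, le_rfl⟩) (fun c hc => by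
          obtain ⟨z, -, hz, rfl⟩ := exists_of_mem_row hr hc
          simp only [box]; omega)
      simp only [box] at this
      omega
    subst hl'
    have h4 := hr.gap_lt q hpq le_rfl
    have h5 : gap α β (q + 1) ≤ gap α β p := hr.ends.resolve_left (by omega)
    have hu : IsUp α β ⟨q, hlt⟩ := by
      rcases gap_succ h ⟨q, hlt⟩ with h6 | h6 | h6
      · have := h6.2; simp only at this; omega
      · exact h6.1
      · have := h6.2; simp only at this; omega
    have hd := height_succ_one hu.1
    simp only at hd
    push_cast at h2
    refine Or.inl ⟨⟨q, hlt⟩, ⟨hpq, hp.1, hu.1, by simp only; omega, fun z hz hzq => ?_⟩, hu, hr⟩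
    have := h3 z hz hzq
    omega

theorem stripLength_snd_of_unpaired2 {N : ℕ} {α β : Str N} {p : Fin N} (hu : IsUnpaired2 β p)
    (hg : IsGoodRow α β p) : (stripLength (row α β p)).2 = rank β p := by
  rcases hg with ⟨j, hj, -⟩ | ⟨-, hr⟩
  · exact absurd hu hj.not_unpaired2
  · obtain ⟨l, -, hs⟩ := hu.isBallotStrip hr
    rw [hs.stripLength_eq]

theorem unpaired2_of_stripLength {N : ℕ} {α β : Str N} {p : Fin N} (hg : IsGoodRow α β p)
    (h : 1 ≤ (stripLength (row α β p)).2) : IsUnpaired2 β p := by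
  rcases hg with ⟨j, hj, -, hr⟩ | ⟨hu, -⟩
  · obtain ⟨l, -, hs⟩ := hj.isBallotStrip hr
    rw [hs.stripLength_eq] at h
    simp at h
  · exact hu

/-! ### A filling exists only for flips -/

/-- Good rows make the two letters of a 21 pair change together and keep unpaired `1`s fixed. The
hypotheses `heven` and `hodd` supply the flipped partner of an unlabelled unpaired `2`. -/
theorem isFlip_of_isGoodRow {N m : ℕ} {α β : Str N} (h : pathLE α β)
    (hg : ∀ p, IsDown α β p → IsGoodRow α β p)
    (heven : ∀ p, IsDown α β p → IsUnpaired2 β p → m ≤ rank β p → Even (rank β p - m) →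
      ∃ i, IsDown α β i ∧ IsUnpaired2 β i ∧ rank β i = rank β p + 1)
    (hodd : ∀ p, IsDown α β p → IsUnpaired2 β p → m ≤ rank β p → Odd (rank β p - m) →
      ∃ i, IsDown α β i ∧ IsUnpaired2 β i ∧ rank β i + 1 = rank β p) : IsFlip m α β := by
  have hup : ∀ j, IsUp α β j → ∃ i, IsDown α β i ∧ IsPair21 β i j := by
    intro j hj
    have h1 := hj.gap h
    -- The row through column `j` at the depth that disappears at `j + 1` ends exactly at `j`; being
    -- good, it starts at the `2` matched with `j`.
    obtain ⟨p, hp, hpk, hpj, hpz⟩ := exists_row h (x := j) (k := gap α β (j + 1)) j.2.le (by omega)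
    have hr : RowEnd α β p j := ⟨hpj, j.2.le, by rwa [hpk], Or.inr hpk.ge⟩
    refine ⟨p, hp, ?_⟩
    rcases hg p hp with ⟨j', hj', -, hr'⟩ | ⟨-, hr'⟩
    · rwa [Fin.ext (hr.unique hr')]
    · have := hr.unique hr'
      have := j.2
      omega
  have hdown : ∀ p, β p = two → α p ≠ two → IsDown α β p := fun p h1 h2 => ⟨h1, by simpa using h2⟩
  refine ⟨h, fun i j hij => ?_, fun i j hij => ?_, fun i hi hl h22 => ?_⟩
  · cases hαi : α i
    · right
      rcases hg i ⟨hij.2.1, hαi⟩ with ⟨j', hj', hu, -⟩ | ⟨hu, -⟩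
      · rw [hij.right_unique hj']; exact ⟨rfl, hu.2⟩
      · exact absurd hu hij.not_unpaired2
    · left
      refine ⟨rfl, ?_⟩
      by_contra hcon
      obtain ⟨i', hi', hp⟩ := hup j ⟨hij.2.2.1, by simpa using hcon⟩
      rw [hij.left_unique hp, hi'.2] at hαi
      simp at hαi
  · obtain ⟨hi, hj, hr, hm, he⟩ := isPair22_iff.1 hij
    cases hαi : α i
    · right
      obtain ⟨p, hp, hpu, hpr⟩ := hodd i ⟨hi.1, hαi⟩ hi (by omega) (by
        rw [Nat.even_iff] at he; rw [Nat.odd_iff]; omega)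
      rw [rank_injective hj hpu (by omega)]
      exact ⟨rfl, hp.2⟩
    · left
      refine ⟨rfl, ?_⟩
      by_contra hcon
      obtain ⟨p, hp, hpu, hpr⟩ := heven j (hdown j hj.1 hcon) hj hm he
      rw [rank_injective hi hpu (by omega), hp.2] at hαi
      simp at hαi
  · cases hβi : β i
    · by_contra hcon
      obtain ⟨p, -, hp⟩ := hup i ⟨hβi, by simpa using hcon⟩
      exact (hi p).2 hp
    · by_contra hcon
      have hd := hdown i hβi hcon
      have hu : IsUnpaired2 β i := ⟨hβi, hi⟩
      have hm : m ≤ rank β i := by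
        by_contra hm
        exact hl _ (hasLabel_iff.2 ⟨hu, by omega, rfl⟩)
      rcases Nat.even_or_odd (rank β i - m) with he | ho
      · obtain ⟨p, -, hpu, hpr⟩ := heven i hd hu hm he
        exact (h22 p).2 (isPair22_iff.2 ⟨hpu, hu, hpr, hm, he⟩)
      · obtain ⟨p, -, hpu, hpr⟩ := hodd i hd hu hm ho
        rw [Nat.odd_iff] at ho
        exact (h22 p).1 (isPair22_iff.2 ⟨hu, hpu, hpr.symm, by omega, by
          rw [Nat.even_iff]; omega⟩)

/-- A row with `l' ≥ 1` starts at an unpaired `2` of rank `l'`, so the strip demanded by Rule II (b)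
starts at the unpaired `2` of neighbouring rank, the other letter of the 22 pair. -/
theorem IsConfII.isFlip {N m : ℕ} (hm : 1 ≤ m) {α β : Str N} (h : pathLE α β)
    {c : Finpartition (skew α β)} (hc : IsConfII N m c) : IsFlip m α β := by
  have hparts := hc.parts_eq h
  have hrow : ∀ p, IsDown α β p → row α β p ∈ c.parts := fun p hp => by
    rw [hparts]; exact mem_rows.2 ⟨p, hp, rfl⟩
  have hg : ∀ p, IsDown α β p → IsGoodRow α β p := by
    intro p hp
    obtain ⟨q, hq⟩ := exists_rowEnd h hp
    obtain ⟨l, l', hs⟩ := hc.strips _ (hrow p hp)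
    exact isGoodRow_of_isBallotStrip h hp hq hs (hc.rule0 _ (hrow p hp))
  refine isFlip_of_isGoodRow h hg (fun p hp hu hpm he => ?_) (fun p hp hu hpm ho => ?_)
  · have hl := stripLength_snd_of_unpaired2 hu (hg p hp)
    obtain ⟨D, hD, -, h1, -⟩ := (hc.ruleIIb _ (hrow p hp) (by rwa [hl])).1 (by rwa [hl])
    rw [hparts] at hD
    obtain ⟨i, hi, rfl⟩ := mem_rows.1 hD
    have hiu := unpaired2_of_stripLength (hg i hi) (by omega)
    rw [hl, stripLength_snd_of_unpaired2 hiu (hg i hi)] at h1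
    exact ⟨i, hi, hiu, h1⟩
  · have hl := stripLength_snd_of_unpaired2 hu (hg p hp)
    obtain ⟨D, hD, -, h1, -⟩ := (hc.ruleIIb _ (hrow p hp) (by rwa [hl])).2 (by rwa [hl])
    rw [hparts] at hD
    obtain ⟨i, hi, rfl⟩ := mem_rows.1 hD
    rw [Nat.odd_iff] at ho
    have hiu := unpaired2_of_stripLength (hg i hi) (by omega)
    rw [hl, stripLength_snd_of_unpaired2 hiu (hg i hi)] at h1
    exact ⟨i, hi, hiu, h1⟩

/-! ### Flips have a filling -/

/-- Every `1` in this stretch is matched within it, and a 21 pair changes the gap by `+1` and `-1`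
together or not at all. The remaining letters are `2`s, which can only increase the gap; at a return
to the initial height none remain. -/
theorem IsFlip.gap_le {N m : ℕ} {α β : Str N} (h : IsFlip m α β) {i x : ℕ} (hix : i ≤ x)
    (hx : x ≤ N) (hy : ∀ y, i ≤ y → y ≤ x → height β i ≤ height β y) :
    gap α β i ≤ gap α β x ∧ (height β x = height β i → gap α β x = gap α β i) := by
  induction hn : x - i using Nat.strong_induction_on generalizing i x with
  | _ n ih =>
    subst hn
    obtain rfl | hlt : i = x ∨ i < x := by omega
    · exact ⟨le_rfl, fun _ => rfl⟩
    obtain ⟨j, rfl⟩ : ∃ j : Fin N, x = j + 1 := ⟨⟨x - 1, by omega⟩, by simp only; omega⟩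
    cases hβ : β j
    · obtain ⟨o, ho, hio⟩ := exists_pair21_left hβ (y := i) (by omega) (hy (j + 1) (by omega) le_rfl)
      obtain ⟨hoj, ho2, -, hoh, hoz⟩ := ho
      have hoj' : (o : ℕ) < j := hoj
      have h1 := ih (o - i) (by omega) hio o.2.le (fun y h1 h2 => hy y h1 (by omega)) rfl
      have hos := height_succ_two ho2
      have hjs := height_succ_one hβ
      have h2 := (ih (j - (o + 1)) (by omega) (i := o + 1) (x := j) hoj' j.2.le
        (fun y h1 h2 => by have := hoz y (by omega) h2; omega) rfl).2 (by omega)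
      have h3 : gap α β (j + 1) = gap α β o := by
        rcases h.pair21 o j ⟨hoj, ho2, hβ, hoh, hoz⟩ with ⟨ha, hb⟩ | ⟨ha, hb⟩
        · have h4 : gap α β (o + 1) = gap α β o := by
            rcases gap_succ h.le o with h4 | h4 | h4
            · have := h4.1.2; rw [ha] at this; simp at this
            · have := h4.1.1; rw [ho2] at this; simp at this
            · exact h4.2
          have h5 : gap α β (j + 1) = gap α β j := by
            rcases gap_succ h.le j with h5 | h5 | h5
            · have := h5.1.1; rw [hβ] at this; simp at this
            · have := h5.1.2; rw [hb] at this; simp at this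
            · exact h5.2
          omega
        · have h4 := IsDown.gap h.le (i := o) ⟨ho2, ha⟩
          have h5 := IsUp.gap h.le (i := j) ⟨hβ, hb⟩
          omega
      rw [h3, hoh]
      exact h1
    · have h1 := ih (j - i) (by omega) (by omega) j.2.le (fun y h1 h2 => hy y h1 (by omega)) rfl
      have h2 := height_succ_two hβ
      have h3 := hy j (by omega) (by omega)
      refine ⟨?_, fun _ => by omega⟩
      rcases gap_succ h.le j with h4 | h4 | h4
      · omega
      · have := h4.1.1; rw [hβ] at this; simp at this
      · omega

theorem IsFlip.isGoodRow {N m : ℕ} {α β : Str N} (h : IsFlip m α β) {p : Fin N}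
    (hp : IsDown α β p) : IsGoodRow α β p := by
  have hg := hp.gap h.le
  have hs := height_succ_two hp.1
  by_cases hu : IsUnpaired2 β p
  · refine Or.inr ⟨hu, p.2, le_rfl, fun z hz hzN => ?_, Or.inl rfl⟩
    have := (h.gap_le (i := p + 1) (x := z) hz hzN fun y h1 h2 => by
      have := hu.height_lt (show (p : ℕ) < y by omega) (by omega); omega).1
    omega
  · obtain ⟨j, hj⟩ := exists_pair21_of_not_unpaired2 hp.1 hu
    have hju : IsUp α β j := by
      refine ⟨hj.2.2.1, ?_⟩
      have := h.pair21 p j hj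
      rw [hp.2] at this
      simpa using this
    have hpj : (p : ℕ) < j := hj.1
    have hgap : ∀ z, (p : ℕ) < z → z ≤ j → gap α β (p + 1) ≤ gap α β z ∧
        (height β z = height β (p + 1) → gap α β z = gap α β (p + 1)) := fun z hz hzj =>
      h.gap_le (i := p + 1) (x := z) hz (hzj.trans j.2.le) fun y h1 h2 => by
        have := hj.2.2.2.2 y (by omega) (by omega); omega
    refine Or.inl ⟨j, hj, hju, hpj, j.2.le, fun z hz hzj => ?_, Or.inr ?_⟩
    · have := (hgap z hz hzj).1
      omega
    · have h1 := (hgap j hpj le_rfl).2 (by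
        have := height_succ_one hj.2.2.1
        have := hj.2.2.2.1
        omega)
      have h2 := hju.gap h.le
      omega

theorem IsGoodRow.exists_rowEnd {N : ℕ} {α β : Str N} (h : pathLE α β) {p : Fin N}
    (hg : IsGoodRow α β p) : ∃ q, RowEnd α β p q ∧ (q < N → letter β q = one ∧
      gap α β p ≤ gap α β (q + 1)) := by
  rcases hg with ⟨j, hj, hu, hr⟩ | ⟨-, hr⟩
  · refine ⟨j, hr, fun _ => ⟨by rw [letter_val, hu.1], ?_⟩⟩
    have h1 := hr.gap_lt j hj.1 le_rfl
    have h2 := hu.gap h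
    omega
  · exact ⟨N, hr, fun hlt => absurd hlt (lt_irrefl _)⟩

/-- A row that covers some box of another lies one level nearer to the path of `β`. Since the gap
stays above its depth throughout, it starts earlier and extends one column further or to the anchor
boxes, hence contains every covering box outside the lower row. -/
theorem ruleIIa_rows {N : ℕ} {α β : Str N} (h : pathLE α β)
    (hg : ∀ p, IsDown α β p → IsGoodRow α β p) : RuleIIa N (rows α β) := by
  intro D hD D' hD' hne hcov
  obtain ⟨p, hp, rfl⟩ := mem_rows.1 hD
  obtain ⟨p', hp', rfl⟩ := mem_rows.1 hD'
  obtain ⟨q, hr, hq⟩ := (hg p hp).exists_rowEnd h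
  obtain ⟨q', hr', -⟩ := (hg p' hp').exists_rowEnd h
  have hpq := hr.lt
  have hqN := hr.le
  have hpq' := hr'.lt
  have hqN' := hr'.le
  obtain ⟨b, hb, c, hc, hbc⟩ := hcov
  obtain ⟨x, hpx, hxq, rfl⟩ := exists_of_mem_row hr hb
  obtain ⟨y, hpy, hyq, rfl⟩ := exists_of_mem_row hr' hc
  obtain ⟨y', l, he, -, hyx, hxy, hl⟩ := covers_box (by omega) (by omega) hbc
    (by simp only [box]; omega)
  obtain ⟨rfl, rfl⟩ := box_inj.1 he
  -- A covering box of equal depth would belong to the same row, by `row_unique`.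
  have hk : gap α β p' + 1 = gap α β p := by
    have : (gap α β p' : ℤ) ≠ gap α β p := by
      intro e
      have e' : gap α β p = gap α β p' := by omega
      exact hne (by rw [row_unique hr hr' e' hpx hxq hpy hyq hxy hyx])
    rcases hl with hl | hl | hl <;> omega
  have hlow : ∀ z, (p : ℕ) ≤ z → z ≤ q + 1 → z ≤ N → gap α β p' < gap α β z := by
    intro z hz hzq hzN
    rcases Nat.lt_or_ge p z with h1 | h1
    · rcases Nat.lt_or_ge q z with h2 | h2
      · have h3 : z = q + 1 := by omega
        have := (hq (by omega)).2
        rw [h3]; omega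
      · have := hr.gap_lt z h1 h2
        omega
    · rw [show z = p by omega]; omega
  have hp'p : (p' : ℕ) < p := by
    by_contra hcon
    have := hlow p' (by omega) (by omega) (by omega)
    omega
  have hq' : ∀ z, z ≤ q + 1 → z ≤ N → z ≤ q' := by
    intro z hz hzN
    by_contra hcon
    have h1 := hr'.ends.resolve_left (by omega)
    have := hlow (q' + 1) (by omega) (by omega) (by omega)
    omega
  intro b hb c hbc hcN
  obtain ⟨x, hpx, hxq, rfl⟩ := exists_of_mem_row hr hb
  obtain ⟨y, l, rfl, hyN, hyx, hxy, hl⟩ := covers_box (by omega) (by omega) hbc hcN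
  rcases hl with hl | ⟨hl, hx, hy⟩ | ⟨hl, hx, hy⟩
  · right
    rw [hl, show (gap α β p : ℤ) - 1 = (gap α β p' : ℕ) by omega]
    exact (box_mem_row hr').2 ⟨rfl, by omega, hq' y (by omega) hyN⟩
  · left
    rw [hl]
    refine (box_mem_row hr).2 ⟨rfl, ?_, by omega⟩
    by_contra hcon
    rw [show y = p by omega, letter_val, hp.1] at hy
    simp at hy
  · left
    rw [hl]
    refine (box_mem_row hr).2 ⟨rfl, by omega, ?_⟩
    by_contra hcon
    have h1 := (hq (by omega)).1
    rw [show x = q by omega, h1] at hy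
    simp at hy

/-- Consecutive ranks mean that the path has equal heights just after `i` and just before `p`. The
gaps there agree by `IsFlip.gap_le`, so the two rows have consecutive depths. -/
theorem IsFlip.justAbove {N m : ℕ} {α β : Str N} (h : IsFlip m α β) {i p : Fin N}
    (hi : IsDown α β i) (hp : IsDown α β p) (hip : IsPair22 m β i p) :
    JustAbove (row α β p) (row α β i) ∧
      (stripLength (row α β p)).1 ≤ (stripLength (row α β i)).1 := by
  obtain ⟨hiu, hpu, hr, -, -⟩ := isPair22_iff.1 hip
  have hlt : (i : ℕ) < p := lt_of_rank_lt hiu (by omega)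
  have hgood : ∀ p, IsDown α β p → IsUnpaired2 β p → RowEnd α β p N := by
    intro p hp hu
    rcases h.isGoodRow hp with ⟨j, hj, -⟩ | ⟨-, hr⟩
    · exact absurd hu hj.not_unpaired2
    · exact hr
  have hri := hgood i hi hiu
  have hrp := hgood p hp hpu
  obtain ⟨l, hl, hs⟩ := hpu.isBallotStrip hrp
  obtain ⟨l', hl', hs'⟩ := hiu.isBallotStrip hri
  refine ⟨?_, by rw [hs.stripLength_eq, hs'.stripLength_eq]; simp only; omega⟩
  have h1 := rank_eq_height hiu
  have h2 := rank_eq_height hpu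
  have h3 := height_succ_two hi.1
  have h4 := height_succ_two hp.1
  have hg := hi.gap h.le
  have hgap := (h.gap_le (i := i + 1) (x := p) hlt p.2.le fun y h1 h2 => by
    have := hiu.height_lt (show (i : ℕ) < y by omega) (by omega); omega).2 (by omega)
  refine ⟨box β (p + 1) (gap α β p), (box_mem_row hrp).2 ⟨rfl, by omega, hrp.lt⟩, ?_⟩
  have he : ((box β (p + 1) (gap α β p)).1, (box β (p + 1) (gap α β p)).2 + 2) =
      box β (p + 1) (gap α β i) := by
    simp only [box, Prod.mk.injEq, true_and]
    rw [hgap, hg]; push_cast; ring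
  rw [he]
  exact (box_mem_row hri).2 ⟨rfl, by omega, hrp.lt⟩

theorem IsFlip.ruleIIb_rows {N m : ℕ} (hm : 1 ≤ m) {α β : Str N} (h : IsFlip m α β) :
    RuleIIb m (rows α β) := by
  intro D hD hmD
  obtain ⟨p, hp, rfl⟩ := mem_rows.1 hD
  have hu := unpaired2_of_stripLength (h.isGoodRow hp) (by omega)
  have hl := stripLength_snd_of_unpaired2 hu (h.isGoodRow hp)
  rw [hl] at hmD
  have h22 : ∃ j, IsPair22 m β p j ∨ IsPair22 m β j p := by
    by_contra hcon
    push Not at hcon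
    have := h.other p hu.2 (fun _ hlab => by have := (hasLabel_iff.1 hlab).2.1; omega) hcon
    rw [hp.1, hp.2] at this
    simp at this
  obtain ⟨j, hj | hj⟩ := h22
  · obtain ⟨-, hju, hr, hmj, he⟩ := isPair22_iff.1 hj
    have hjd : IsDown α β j := by
      refine ⟨hju.1, ?_⟩
      have := h.pair22 p j hj
      rw [hp.2] at this
      simpa using this
    have hab := h.justAbove hp hjd hj
    rw [hl]
    refine ⟨fun he' => ?_, fun _ => ⟨_, mem_rows.2 ⟨j, hjd, rfl⟩, hab.1, ?_, hab.2⟩⟩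
    · rw [Nat.even_iff] at he he'; omega
    · rw [stripLength_snd_of_unpaired2 hju (h.isGoodRow hjd), hr]
  · obtain ⟨hju, -, hr, hmj, he⟩ := isPair22_iff.1 hj
    have hjd : IsDown α β j := by
      refine ⟨hju.1, ?_⟩
      have := h.pair22 j p hj
      rw [hp.2] at this
      simpa using this
    have hab := h.justAbove hjd hp hj
    rw [hl]
    refine ⟨fun _ => ⟨_, mem_rows.2 ⟨j, hjd, rfl⟩, hab.1, ?_, hab.2⟩, fun ho => ?_⟩
    · rw [stripLength_snd_of_unpaired2 hju (h.isGoodRow hjd), hr]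
    · rw [Nat.even_iff] at he; rw [Nat.odd_iff] at ho; omega

theorem IsFlip.isConfII {N m : ℕ} (hm : 1 ≤ m) {α β : Str N} (h : IsFlip m α β) :
    IsConfII N m (rowPartition h.le) where
  strips := by
    intro D hD
    obtain ⟨p, hp, rfl⟩ := mem_rows.1 hD
    rcases h.isGoodRow hp with ⟨j, hj, -, hr⟩ | ⟨hu, hr⟩
    · obtain ⟨l, -, hs⟩ := hj.isBallotStrip hr
      exact ⟨_, _, hs⟩
    · obtain ⟨l, -, hs⟩ := hu.isBallotStrip hr
      exact ⟨_, _, hs⟩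
  rule0 := by
    intro D hD
    obtain ⟨p, hp, rfl⟩ := mem_rows.1 hD
    intro hl b hb hmax
    have hu := unpaired2_of_stripLength (h.isGoodRow hp) hl
    rcases h.isGoodRow hp with ⟨j, hj, -⟩ | ⟨-, hr⟩
    · exact absurd hu hj.not_unpaired2
    · obtain ⟨z, -, hz, rfl⟩ := exists_of_mem_row hr hb
      have := hmax _ ((box_mem_row hr).2 ⟨rfl, hr.lt, le_rfl⟩)
      simp only [box] at this ⊢
      omega
  ruleIIa := ruleIIa_rows h.le fun _ => h.isGoodRow
  ruleIIb := h.ruleIIb_rows hm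

/-! ### Weights -/

/-- The exponent of `t` to which a box contributes. -/
def boxLen (N m : ℕ) (b : ℤ × ℤ) : ℤ := if b.1 = (N : ℤ) then (m : ℤ) else 1

theorem sum_boxLen_skew {N m : ℕ} {α β : Str N} (h : pathLE α β) :
    ∑ b ∈ skew α β, boxLen N m b = wlen m β - wlen m α := by
  have := Finset.sum_sdiff (f := boxLen N m) (boxes_subset h)
  rw [eq_sub_iff_add_eq]
  exact this

theorem sum_boxLen_row {N m : ℕ} {α β : Str N} {p : Fin N} {q : ℕ} (h : RowEnd α β p q) :
    ∑ b ∈ row α β p, boxLen N m b = (q : ℤ) - (p + 1) + if q = N then (m : ℤ) else 1 := by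
  have h1 := h.lt
  have h2 := h.le
  rw [row_eq h, rowSet, Finset.sum_image (fun i _ j _ he => by
    have := (box_inj.1 he).1; omega), Finset.sum_range_succ]
  congr 1
  · rw [Finset.sum_congr rfl (g := fun _ => (1 : ℤ)) (fun i hi => by
      rw [Finset.mem_range] at hi
      rw [boxLen, if_neg]
      simp only [box]; omega)]
    simp; omega
  · rw [boxLen]
    congr 1
    simp only [box, eq_iff_iff]; omega

/-- A matched row of length `(l, 0)` has box exponent `2 l + 1` and weight `t^(2l)`, which leaves
`t⁻¹`. For an unpaired `2` of rank `r` the box exponent is `2 l + r + m`, and the three weights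
leave `(-1)^r t^(r-m)`, `1` and `t⁻¹`. -/
theorem IsGoodRow.weight {N m : ℕ} (hm : 1 ≤ m) {α β : Str N} {p : Fin N}
    (h : IsGoodRow α β p) :
    T (-∑ b ∈ row α β p, boxLen N m b) *
      stripWeight m (stripLength (row α β p)).1 (stripLength (row α β p)).2 = flipW m β p := by
  rcases h with ⟨j, hj, -, hr⟩ | ⟨hu, hr⟩
  · obtain ⟨l, hl, hs⟩ := hj.isBallotStrip hr
    have hjN : (j : ℕ) ≠ N := j.2.ne
    rw [hs.stripLength_eq, sum_boxLen_row hr, if_neg hjN, stripWeight, if_pos (by omega),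
      pow_zero, one_mul, ← T_add, flipW, if_neg hj.not_unpaired2]
    congr 1
    push_cast
    omega
  · obtain ⟨l, hl, hs⟩ := hu.isBallotStrip hr
    rw [hs.stripLength_eq, sum_boxLen_row hr, if_pos rfl, stripWeight, flipW, if_pos hu, rankW]
    split_ifs
    · rw [mul_left_comm, ← T_add]
      congr 2
      omega
    · rw [← T_add, ← T_zero]
      congr 1
      omega
    · rw [← T_add]
      congr 1
      omega

theorem IsFlip.prod_weight {N m : ℕ} (hm : 1 ≤ m) {α β : Str N} (h : IsFlip m α β) :
    ∏ D ∈ rows α β, stripWeight m (stripLength D).1 (stripLength D).2 =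
      T (wlen m β - wlen m α) * flipProd m α β := by
  have hinj : Set.InjOn (row α β) (Finset.univ.filter fun p => IsDown α β p : Finset (Fin N)) := by
    intro p hp p' hp' e
    rw [Finset.mem_coe, Finset.mem_filter] at hp hp'
    obtain ⟨b, hb⟩ := row_nonempty h.le hp.2
    exact row_injective h.le hp.2 hp'.2 hb (e ▸ hb)
  have hsum : wlen m β - wlen m α = ∑ D ∈ rows α β, ∑ b ∈ D, boxLen N m b := by
    rw [← sum_boxLen_skew h.le, ← rowPartition_parts h.le]
    conv_lhs => rw [← (rowPartition h.le).biUnion_parts]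
    exact Finset.sum_biUnion (rowPartition h.le).disjoint
  have hflip : flipProd m α β = ∏ D ∈ rows α β, (T (-∑ b ∈ D, boxLen N m b) *
      stripWeight m (stripLength D).1 (stripLength D).2) := by
    rw [rows, Finset.prod_image hinj, flipProd, ← Finset.prod_filter]
    refine Finset.prod_congr rfl fun p hp => ?_
    exact ((h.isGoodRow (Finset.mem_filter.1 hp).2).weight hm).symm
  rw [hflip, Finset.prod_mul_distrib, ← T_sum, Finset.sum_neg_distrib, ← hsum, ← mul_assoc,
    ← T_add, add_neg_cancel, T_zero, one_mul]

/-- The sum over fillings has the single term `rowPartition h` when `α` is a flip of `β`, and is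
empty otherwise. -/
theorem genQII_eq {N m : ℕ} (hm : 1 ≤ m) {α β : Str N} (h : pathLE α β) :
    genQII m α β = T (wlen m β - wlen m α) * flipCoeff m α β := by
  classical
  unfold genQII flipCoeff
  split_ifs with hf
  · rw [Finset.sum_eq_single (rowPartition h), rowPartition_parts, hf.prod_weight hm]
    · intro c hc hne
      exact absurd ((Finset.mem_filter.1 hc).2.eq_rowPartition h) hne
    · intro hc
      exact absurd (Finset.mem_filter.2 ⟨Finset.mem_univ _, hf.isConfII hm⟩) hc
  · rw [mul_zero]
    refine Finset.sum_eq_zero fun c hc => ?_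
    exact absurd ((Finset.mem_filter.1 hc).2.isFlip hm h) hf

end BallotKL

/-! ### Comparison of the two polynomials -/

theorem mainTheorem6 (N m : ℕ) (hm : 1 ≤ m) (α β : BallotKL.Str N)
    (hαβ : BallotKL.pathLE α β) :
    BallotKL.klP m α β = BallotKL.genQII m α β ∧
    (BallotKL.IsFlip m α β →
      (LaurentPolynomial.T (BallotKL.wlen m α - BallotKL.wlen m β) * BallotKL.genQII m α β
          : BallotKL.Coef) =
        LaurentPolynomial.T (BallotKL.wlen m α - BallotKL.wlen m β) * BallotKL.klP m α β ∧
      (LaurentPolynomial.T (BallotKL.wlen m α - BallotKL.wlen m β) * BallotKL.klP m α β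
          : BallotKL.Coef) =
        (-1) ^ BallotKL.signExp m α β *
          LaurentPolynomial.T (-(BallotKL.degExp m α β : ℤ))) ∧
    (¬ BallotKL.IsFlip m α β → BallotKL.klP m α β = 0) := by
  have hP := BallotKL.klP_eq hm α β
  have hQ : BallotKL.klP m α β = BallotKL.genQII m α β := by
    rw [hP, BallotKL.genQII_eq hm hαβ]
  refine ⟨hQ, fun hf => ⟨by rw [hQ], ?_⟩, fun hf => ?_⟩
  · rw [hP, BallotKL.flipCoeff, if_pos hf, ← mul_assoc, ← LaurentPolynomial.T_add,
      sub_add_sub_cancel, sub_self, LaurentPolynomial.T_zero, one_mul, BallotKL.flipProd_eq hf]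
  · rw [hP, BallotKL.flipCoeff, if_neg hf, mul_zero]
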